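/- Let $M$ be a smooth Hausdorff second countable manifold of dimension $n$ and $C=C^\infty(M)$. Let $\pi$ be a Poisson structure on $M$, i.e. a bivector field for which $\{f,g\}=\pi(df,dg)$ is a Lie bracket on $C$; let $\mu$ be a volume form on $M$ (so $M$ is orientable), and let $\phi$ be the modular vector field with respect to $\mu$, i.e. the vector field with $\mathscr{L}_{X_f}\mu=\phi(f)\mu$ for all $f\in C$, where $X_f=\{-,f\}$. Let $W$ be a geometric $C$-module, meaning $\bigcap_{p\in M}\mathfrak{m}_pW=0$ with $\mathfrak m_p=\{f\in C: f(p)=0\}$, equipped with a right Poisson module structure, i.e. an $\mathbb R$-bilinear map $\{-,-\}_W:W\times C\to W$ with $\{w,\{a,b\}\}_W=\{\{w,a\}_W,b\}_W-\{\{w,b\}_W,a\}_W$, $\{aw,b\}_W=a\{w,b\}_W+\{a,b\}w$ and $\{w,ab\}_W=b\{w,a\}_W+a\{w,b\}_W$. Let $\mathfrak X^k(W)$ be the $C$-module of skew-symmetric $\mathbb R$-multilinear maps $C^k\to W$ that are derivations in each argument, and let $\delta_W^k:\mathfrak X^k(W)\to\mathfrak X^{k+1}(W)$ be $$\delta_W^k(X)(f_1,\dots,f_{k+1})=\sum_{i}(-1)^i\{X(\dots,\widehat{f_i},\dots),f_i\}_W+\sum_{i<j}(-1)^{i+j}X(\{f_i,f_j\},\dots,\widehat{f_i},\dots,\widehat{f_j},\dots).$$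 For $X\in\mathfrak X^k(W)$ let $\iota_X:\Omega^q(M)\to W\otimes_C\Omega^{q-k}(M)$ ($q\ge k$) be the $C$-linear map with $$\iota_X(f_0\,df_1\wedge\dots\wedge df_q)=\sum_{\sigma}\operatorname{sgn}(\sigma)\,f_0X(f_{\sigma(1)},\dots,f_{\sigma(k)})\otimes df_{\sigma(k+1)}\wedge\dots\wedge df_{\sigma(q)},$$ the sum running over all $(k,q-k)$-shuffles $\sigma$. Let $W_{-\phi}$ be $W$ with the bracket $\{w,f\}_{W_{-\phi}}=\{w,f\}_W-\phi(f)w$, and let $\partial_r:W\otimes_C\Omega^r(M)\to W\otimes_C\Omega^{r-1}(M)$ be the $\mathbb R$-linear map with $$\partial_r(w\otimes f_0\,df_1\wedge\dots\wedge df_r)=\sum_i(-1)^{i-1}\{f_0w,f_i\}_{W_{-\phi}}\otimes df_1\wedge\dots\widehat{df_i}\dots\wedge df_r+\sum_{i<j}(-1)^{i+j}w\otimes f_0\,d\{f_i,f_j\}\wedge df_1\wedge\dots\widehat{df_i}\dots\widehat{df_j}\dots\wedge df_r.$$ Then $W_{-\phi}$ is again a right Poisson module, the maps $\iota_X$ and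 $\partial_r$ exist and are uniquely determined by these formulas, $\delta_W\delta_W=0$ and $\partial\partial=0$, and $\mathfrak X^k(W)=0=W\otimes_C\Omega^k(M)$ for $k>n$. For $0\le k\le n$ put $$\blacktriangle_W^k:\mathfrak X^k(W)\to W\otimes_C\Omega^{n-k}(M),\qquad \blacktriangle_W^k(X)=(-1)^{k(k+1)/2}\,\iota_X\mu .$$ Each $\blacktriangle^k_W$ is an isomorphism of $C$-modules, and for all $0\le k<n$ $$\partial_{n-k}\circ\blacktriangle_W^k=\blacktriangle_W^{k+1}\circ\delta_W^k .$$ Thus $\blacktriangle_W$ is an isomorphism from the Poisson cochain complex $(\mathfrak X^\bullet(W),\delta_W)$ onto the Poisson chain complex $(W\otimes_C\Omega^{n-\bullet}(M),\partial)$ with coefficients in $W_{-\phi}$. -/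

import Mathlib

open scoped Manifold ContDiff TensorProduct

noncomputable section

set_option linter.unusedSectionVars false

namespace TwistedDuality

section Algebra

variable {C : Type*} [CommRing C] [Algebra ℝ C]

/-- A bracket making the commutative real algebra `C` a Poisson algebra. -/
structure IsPoissonBracket (br : C →ₗ[ℝ] C →ₗ[ℝ] C) : Prop where
  self_eq_zero : ∀ a, br a a = 0
  jacobi : ∀ a b c, br a (br b c) + br b (br c a) + br c (br a b) = 0
  leibniz : ∀ a b c, br (a * b) c = a * br b c + br a c * b

variable {W : Type*} [AddCommGroup W] [Module ℝ W] [Module C W] [IsScalarTower ℝ C W]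

/-- `b` is a right Poisson module structure `{w, a}_W = b w a` on the `C`-module `W`. -/
structure IsPoissonModule (br : C →ₗ[ℝ] C →ₗ[ℝ] C) (b : W →ₗ[ℝ] C →ₗ[ℝ] W) : Prop where
  lie : ∀ w x y, b w (br x y) = b (b w x) y - b (b w y) x
  smul_left : ∀ (w : W) (x y : C), b (x • w) y = x • b w y + br x y • w
  mul_right : ∀ (w : W) (x y : C), b w (x * y) = y • b w x + x • b w y

instance (k : ℕ) : IsScalarTower ℝ C (C [⋀^Fin k]→ₗ[ℝ] W) :=
  ⟨fun _ _ _ => by ext; simp⟩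

variable (C W) in
/-- `𝔛ᵏ(W)`: the skew-symmetric `ℝ`-multilinear maps `Cᵏ → W` that are derivations in each
argument. -/
def SkewDerivation (k : ℕ) : Submodule C (C [⋀^Fin k]→ₗ[ℝ] W) where
  carrier := {X | ∀ (i : Fin k) (f : Fin k → C) (x y : C),
    X (Function.update f i (x * y)) =
      x • X (Function.update f i y) + y • X (Function.update f i x)}
  add_mem' {X Y} hX hY i f x y := by
    simp only [AlternatingMap.add_apply, hX i f x y, hY i f x y, smul_add]
    abel
  zero_mem' i f x y := by simp
  smul_mem' c X hX i f x y := by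
    simp only [AlternatingMap.smul_apply, hX i f x y, smul_add, smul_smul, mul_comm c]

/-- For a function `F` of `r` arguments, the sum over positions `i < j` of
`(-1)^(i + j) F({fᵢ, fⱼ}, f₀, …, [no fᵢ, fⱼ], …, f_r)`. The pair of positions `i ≤ j` in the code
stands for the positions `i < j + 1` of the tuple `f`. -/
def bracketSum {A : Type*} [AddCommGroup A] (br : C →ₗ[ℝ] C →ₗ[ℝ] C) :
    ∀ {r : ℕ}, ((Fin r → C) → A) → (Fin (r + 1) → C) → A
  | 0, _, _ => 0
  | m + 1, F, f => ∑ i : Fin (m + 1), ∑ j ≥ i, (-1 : ℤ) ^ (i.val + (j.val + 1)) •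
      F (Fin.cons (br (f i.castSucc) (f j.succ)) (j.removeNth (i.castSucc.removeNth f)))

/-- The value at `f` of the Poisson coboundary of the `k`-cochain `X` (positions in the tuple `f`
are numbered from `0`). -/
def coboundaryFormula (br : C →ₗ[ℝ] C →ₗ[ℝ] C) (b : W →ₗ[ℝ] C →ₗ[ℝ] W) {k : ℕ}
    (X : (Fin k → C) → W) (f : Fin (k + 1) → C) : W :=
  ∑ i, (-1 : ℤ) ^ (i.val + 1) • b (X (i.removeNth f)) (f i) + bracketSum br X f

/-- Auxiliary: `f ↦ (c ↦ {X(f), c})` with the last variable put first. -/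
def firstAux (b : W →ₗ[ℝ] C →ₗ[ℝ] W) {k : ℕ} (X : C [⋀^Fin k]→ₗ[ℝ] W) :
    C →ₗ[ℝ] C [⋀^Fin k]→ₗ[ℝ] W where
  toFun c := (b.flip c).compAlternatingMap X
  map_add' c d := by ext; simp
  map_smul' c d := by ext; simp

/-- Auxiliary: `(c, d) ↦ X({c, d}, …)`. -/
def secondAux (br : C →ₗ[ℝ] C →ₗ[ℝ] C) {m : ℕ} (X : C [⋀^Fin (m + 1)]→ₗ[ℝ] W) :
    C →ₗ[ℝ] C →ₗ[ℝ] C [⋀^Fin m]→ₗ[ℝ] W :=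
  br.compr₂ X.curryLeft

lemma br_swap {br : C →ₗ[ℝ] C →ₗ[ℝ] C} (h : ∀ a, br a a = 0) (a c : C) : br a c = - br c a := by
  have := h (a + c)
  simp only [map_add, LinearMap.add_apply, h] at this
  rw [eq_neg_iff_add_eq_zero]
  simpa [add_comm] using this

/-- The Poisson coboundary, as an alternating map. -/
def coboundaryAlt (br : C →ₗ[ℝ] C →ₗ[ℝ] C) (b : W →ₗ[ℝ] C →ₗ[ℝ] W) :
    ∀ {k : ℕ}, C [⋀^Fin k]→ₗ[ℝ] W → C [⋀^Fin (k + 1)]→ₗ[ℝ] W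
  | 0, X => - AlternatingMap.alternatizeUncurryFin (firstAux b X)
  | _ + 1, X => - AlternatingMap.alternatizeUncurryFin (firstAux b X) -
      (2⁻¹ : ℝ) • AlternatingMap.alternatizeUncurryFin
        (AlternatingMap.alternatizeUncurryFinLM ∘ₗ secondAux br X)

lemma coboundaryAlt_apply {br : C →ₗ[ℝ] C →ₗ[ℝ] C} (h : ∀ a, br a a = 0)
    (b : W →ₗ[ℝ] C →ₗ[ℝ] W) {k : ℕ} (X : C [⋀^Fin k]→ₗ[ℝ] W) (f : Fin (k + 1) → C) :
    coboundaryAlt br b X f = coboundaryFormula br b X f := by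
  have h1 : - AlternatingMap.alternatizeUncurryFin (firstAux b X) f =
      ∑ i, (-1 : ℤ) ^ (i.val + 1) • b (X (i.removeNth f)) (f i) := by
    simp only [AlternatingMap.alternatizeUncurryFin_apply, firstAux, LinearMap.coe_mk,
      AddHom.coe_mk, LinearMap.compAlternatingMap_apply, LinearMap.flip_apply, pow_succ,
      mul_neg, mul_one, neg_smul, Finset.sum_neg_distrib]
  cases k with
  | zero => simp only [coboundaryAlt, AlternatingMap.neg_apply, coboundaryFormula, bracketSum, h1,
      add_zero]
  | succ m =>
    simp only [coboundaryAlt, AlternatingMap.sub_apply, AlternatingMap.neg_apply,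
      AlternatingMap.smul_apply, coboundaryFormula, h1]
    rw [sub_eq_add_neg]
    congr 1
    rw [AlternatingMap.alternatizeUncurryFin_alternatizeUncurryFinLM_comp_apply, ← smul_neg,
      bracketSum, ← Finset.sum_neg_distrib, Finset.smul_sum]
    refine Finset.sum_congr rfl fun i _ => ?_
    rw [← Finset.sum_neg_distrib, Finset.smul_sum]
    refine Finset.sum_congr rfl fun j _ => ?_
    have e : secondAux br X (f j.succ) (f i.castSucc) =
        - secondAux br X (f i.castSucc) (f j.succ) := by
      simp only [secondAux, LinearMap.compr₂_apply]
      rw [br_swap h, map_neg]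
    rw [e, AlternatingMap.neg_apply, sub_neg_eq_add, ← two_smul ℝ, smul_comm, ← smul_neg,
      ← neg_smul, ← smul_comm, smul_smul, mul_inv_cancel₀ (two_ne_zero' ℝ), one_smul, ← add_assoc,
      pow_succ, mul_neg_one]
    rfl


lemma IsPoissonBracket.leibniz_right {br : C →ₗ[ℝ] C →ₗ[ℝ] C} (h : IsPoissonBracket br)
    (a x y : C) : br a (x * y) = x * br a y + y * br a x := by
  rw [br_swap h.self_eq_zero, h.leibniz, br_swap h.self_eq_zero a y, br_swap h.self_eq_zero a x]
  ring

lemma map_update_eq {k : ℕ} (D : C [⋀^Fin (k + 1)]→ₗ[ℝ] W) (f : Fin (k + 1) → C)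
    (i : Fin (k + 1)) (x : C) :
    D (Function.update f i x) = (-1 : ℤ) ^ (i : ℕ) • D (Matrix.vecCons x (i.removeNth f)) := by
  rw [← Fin.insertNth_removeNth, AlternatingMap.map_insertNth]

lemma mem_skewDerivation_of_cons {k : ℕ} (D : C [⋀^Fin (k + 1)]→ₗ[ℝ] W)
    (hD : ∀ (x y : C) (g : Fin k → C), D (Fin.cons (x * y) g) =
      x • D (Fin.cons y g) + y • D (Fin.cons x g)) : D ∈ SkewDerivation C W (k + 1) := by
  intro i f x y
  simp only [map_update_eq]
  have := hD x y (i.removeNth f)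
  simp only [Matrix.vecCons, this, smul_add]
  rw [smul_comm x, smul_comm y]

lemma SkewDerivation.cons_mul {k : ℕ} {X : C [⋀^Fin (k + 1)]→ₗ[ℝ] W}
    (hX : X ∈ SkewDerivation C W (k + 1)) (x y : C) (g : Fin k → C) :
    X (Fin.cons (x * y) g) = x • X (Fin.cons y g) + y • X (Fin.cons x g) := by
  have := hX 0 (Fin.cons 0 g) x y
  simpa only [Fin.update_cons_zero] using this

lemma SkewDerivation.cons_cons_mul {k : ℕ} {X : C [⋀^Fin (k + 2)]→ₗ[ℝ] W}
    (hX : X ∈ SkewDerivation C W (k + 2)) (c x y : C) (g : Fin k → C) :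
    X (Fin.cons c (Fin.cons (x * y) g : Fin (k + 1) → C)) =
      x • X (Fin.cons c (Fin.cons y g : Fin (k + 1) → C)) +
        y • X (Fin.cons c (Fin.cons x g : Fin (k + 1) → C)) := by
  have := hX 1 (Fin.cons c (Fin.cons 0 g : Fin (k + 1) → C)) x y
  have e : ∀ z : C, Function.update (Fin.cons c (Fin.cons 0 g : Fin (k + 1) → C) :
      Fin (k + 2) → C) 1 z = Fin.cons c (Fin.cons z g : Fin (k + 1) → C) := fun z => by
    rw [← Fin.succ_zero_eq_one, ← Fin.cons_update, Fin.update_cons_zero]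
  simpa only [e] using this

lemma removeNth_succ_cons {A : Type*} {k : ℕ} (i : Fin (k + 1)) (z : A)
    (g : Fin (k + 1) → A) : i.succ.removeNth (Fin.cons z g : Fin (k + 2) → A) = Fin.cons z (i.removeNth g) := by
  ext l
  refine Fin.cases ?_ (fun l => ?_) l <;> simp [Fin.removeNth]

lemma removeNth_zero_cons {A : Type*} {k : ℕ} (z : A) (g : Fin k → A) :
    (0 : Fin (k + 1)).removeNth (Fin.cons z g : Fin (k + 1) → A) = g := by
  ext l
  simp [Fin.removeNth]

/-- The part of `bracketSum` over pairs of positions not involving the position `0`. -/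
def restSum {br : C →ₗ[ℝ] C →ₗ[ℝ] C} {m : ℕ} (X : C [⋀^Fin (m + 1)]→ₗ[ℝ] W)
    (f : Fin (m + 2) → C) : W :=
  ∑ i : Fin m, ∑ j ≥ i.succ, (-1 : ℤ) ^ (i.succ.val + (j.val + 1)) •
      X (Fin.cons (br (f i.succ.castSucc) (f j.succ))
        (j.removeNth (i.succ.castSucc.removeNth f)))

lemma restSum_mul {br : C →ₗ[ℝ] C →ₗ[ℝ] C} {m : ℕ} {X : C [⋀^Fin (m + 1)]→ₗ[ℝ] W}
    (hX : X ∈ SkewDerivation C W (m + 1)) (x y : C) (g : Fin (m + 1) → C) :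
    restSum (br := br) X (Fin.cons (x * y) g) =
      x • restSum (br := br) X (Fin.cons y g) + y • restSum (br := br) X (Fin.cons x g) := by
  simp only [restSum, Finset.smul_sum, ← Finset.sum_add_distrib]
  refine Finset.sum_congr rfl fun i _ => Finset.sum_congr rfl fun j hj => ?_
  cases m with
  | zero => exact i.elim0
  | succ m =>
    obtain ⟨j, rfl⟩ : ∃ l, j = Fin.succ l := by
      refine Fin.exists_succ_eq.2 ?_ |>.imp fun _ h => h.symm
      rintro rfl
      simp at hj
    simp only [← Fin.succ_castSucc, removeNth_succ_cons, Fin.cons_succ]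
    rw [SkewDerivation.cons_cons_mul hX, smul_add, smul_comm x, smul_comm y]

lemma coboundaryFormula_cons_mul {br : C →ₗ[ℝ] C →ₗ[ℝ] C} (h : IsPoissonBracket br)
    {b : W →ₗ[ℝ] C →ₗ[ℝ] W} (hb : IsPoissonModule br b) {k : ℕ} {X : C [⋀^Fin k]→ₗ[ℝ] W}
    (hX : X ∈ SkewDerivation C W k) (x y : C) (g : Fin k → C) :
    coboundaryFormula br b X (Fin.cons (x * y) g) =
      x • coboundaryFormula br b X (Fin.cons y g) +
        y • coboundaryFormula br b X (Fin.cons x g) := by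
  cases k with
  | zero =>
    have e : ∀ z : C, coboundaryFormula br b X (Fin.cons z g) = - b (X g) z := fun z => by
      simp [coboundaryFormula, bracketSum]
    rw [e, e, e, hb.mul_right, smul_neg, smul_neg]
    abel
  | succ m =>
    have e : ∀ z : C, coboundaryFormula br b X (Fin.cons z g) = - b (X g) z +
        (∑ i : Fin (m + 1), (-1 : ℤ) ^ i.val • (b (X (Fin.cons z (i.removeNth g))) (g i) -
          X (Fin.cons (br z (g i)) (i.removeNth g)))) +
        restSum (br := br) X (Fin.cons z g) := fun z => by
      have e1 : ∑ i : Fin (m + 2), (-1 : ℤ) ^ (i.val + 1) •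
            b (X (i.removeNth (Fin.cons z g : Fin (m + 2) → C)))
              ((Fin.cons z g : Fin (m + 2) → C) i) =
          - b (X g) z +
            ∑ i : Fin (m + 1), (-1 : ℤ) ^ i.val • b (X (Fin.cons z (i.removeNth g))) (g i) := by
        rw [Fin.sum_univ_succ]
        simp [removeNth_succ_cons, pow_succ]
      have e2 : bracketSum br X (Fin.cons z g : Fin (m + 2) → C) =
          - (∑ i : Fin (m + 1), (-1 : ℤ) ^ i.val •
            X (Fin.cons (br z (g i)) (i.removeNth g))) +
          restSum (br := br) X (Fin.cons z g) := by
        have : Finset.Ici (0 : Fin (m + 1)) = Finset.univ := by ext; simp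
        rw [bracketSum, Fin.sum_univ_succ, restSum, this, ← Finset.sum_neg_distrib]
        congr 1
        refine Finset.sum_congr rfl fun i _ => ?_
        rw [Fin.castSucc_zero, removeNth_zero_cons, Fin.cons_zero, Fin.cons_succ, Fin.val_zero,
          zero_add, pow_succ, mul_neg_one, neg_smul]
      rw [coboundaryFormula, e1, e2]
      simp only [smul_sub, Finset.sum_sub_distrib]
      abel
    rw [e, e, e, restSum_mul hX, hb.mul_right]
    have : ∀ i : Fin (m + 1), b (X (Fin.cons (x * y) (i.removeNth g))) (g i) -
          X (Fin.cons (br (x * y) (g i)) (i.removeNth g)) =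
        x • (b (X (Fin.cons y (i.removeNth g))) (g i) -
          X (Fin.cons (br y (g i)) (i.removeNth g))) +
        y • (b (X (Fin.cons x (i.removeNth g))) (g i) -
          X (Fin.cons (br x (g i)) (i.removeNth g))) := fun i => by
      have hadd : ∀ (c d : C) (t : Fin m → C), X (Fin.cons (c + d) t) =
          X (Fin.cons c t) + X (Fin.cons d t) := fun c d t => X.map_vecCons_add t c d
      rw [h.leibniz, hadd, SkewDerivation.cons_mul hX, SkewDerivation.cons_mul hX,
        SkewDerivation.cons_mul hX, map_add, LinearMap.add_apply, hb.smul_left, hb.smul_left,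
        smul_sub, smul_sub]
      abel
    simp only [this, smul_add, Finset.smul_sum, smul_neg, Finset.sum_add_distrib,
      smul_comm x ((-1 : ℤ) ^ _), smul_comm y ((-1 : ℤ) ^ _)]
    abel

/-- The Poisson coboundary `δ : 𝔛ᵏ(W) → 𝔛ᵏ⁺¹(W)`,
`δX(f₁, …, f_{k+1}) = ∑ᵢ (-1)ⁱ {X(…, [no fᵢ], …), fᵢ}_W + ∑_{i<j} (-1)^{i+j} X({fᵢ, fⱼ}, …, [no fᵢ, fⱼ], …)`,
where `[no ⋯]` marks omitted entries. -/
def coboundary {br : C →ₗ[ℝ] C →ₗ[ℝ] C} (h : IsPoissonBracket br)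
    {b : W →ₗ[ℝ] C →ₗ[ℝ] W} (hb : IsPoissonModule br b) (k : ℕ) :
    SkewDerivation C W k →ₗ[ℝ] SkewDerivation C W (k + 1) where
  toFun X := ⟨coboundaryAlt br b X.1, mem_skewDerivation_of_cons _ fun x y g => by
    simp only [coboundaryAlt_apply h.self_eq_zero]
    exact coboundaryFormula_cons_mul h hb X.2 x y g⟩
  map_add' X Y := by
    ext f
    simp only [coboundaryAlt_apply h.self_eq_zero, Submodule.coe_add, AlternatingMap.add_apply]
    cases k <;>
    simp [coboundaryFormula, bracketSum, Finset.sum_add_distrib] <;> abel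
  map_smul' c X := by
    ext f
    change coboundaryAlt br b (c • X.1) f = c • coboundaryAlt br b X.1 f
    simp only [coboundaryAlt_apply h.self_eq_zero]
    cases k <;>
    simp [coboundaryFormula, bracketSum, Finset.smul_sum, smul_comm c]

lemma coboundary_apply {br : C →ₗ[ℝ] C →ₗ[ℝ] C} (h : IsPoissonBracket br)
    {b : W →ₗ[ℝ] C →ₗ[ℝ] W} (hb : IsPoissonModule br b) {k : ℕ} (X : SkewDerivation C W k)
    (f : Fin (k + 1) → C) : (coboundary h hb k X).1 f = coboundaryFormula br b X.1 f :=
  coboundaryAlt_apply h.self_eq_zero b X.1 f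

end Algebra

section Manifold

variable (n : ℕ) (M : Type*) [TopologicalSpace M] [ChartedSpace (EuclideanSpace ℝ (Fin n)) M]

/-- `C^∞(M)`. -/
abbrev SmoothFunction : Type _ := C^∞⟮𝓡 n, M; 𝓘(ℝ, ℝ), ℝ⟯

/-- Smooth vector fields on `M`, i.e. smooth sections of `TM`. -/
abbrev SmoothVectorField [IsManifold (𝓡 n) ∞ M] : Type _ :=
  Cₛ^∞⟮𝓡 n; EuclideanSpace ℝ (Fin n), (TangentSpace (𝓡 n) : M → Type _)⟯

variable {n M}

/-- The differential `d_p f`, an element of the cotangent space `T_p^*M`. -/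
def diffAt (f : M → ℝ) (p : M) : Module.Dual ℝ (TangentSpace (𝓡 n) p) :=
  (mfderiv (𝓡 n) 𝓘(ℝ, ℝ) f p).toLinearMap

variable [IsManifold (𝓡 n) ∞ M]

/-- The linear map `ℝⁿ → T_pM` taking `v` to the tangent vector with components `v` in the chart
around `p₀`. -/
def ofChart (p₀ p : M) : EuclideanSpace ℝ (Fin n) →ₗ[ℝ] TangentSpace (𝓡 n) p :=
  ((trivializationAt (EuclideanSpace ℝ (Fin n)) (TangentSpace (𝓡 n) : M → Type _) p₀).symmL
    ℝ p).toLinearMap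

/-- The linear map `T_pM → ℝⁿ` taking a tangent vector to its components in the chart
around `p₀`. -/
def toChart (p₀ p : M) : TangentSpace (𝓡 n) p →ₗ[ℝ] EuclideanSpace ℝ (Fin n) :=
  ((trivializationAt (EuclideanSpace ℝ (Fin n))
    (TangentSpace (𝓡 n) : M → Type _) p₀).continuousLinearMapAt ℝ p).toLinearMap

lemma ofChart_toChart {p₀ p : M} (hp : p ∈ (chartAt (EuclideanSpace ℝ (Fin n)) p₀).source)
    (v : TangentSpace (𝓡 n) p) : ofChart p₀ p (toChart p₀ p v) = v :=
  Bundle.Trivialization.symmL_continuousLinearMapAt _ (by simpa using hp) v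

lemma contMDiffOn_diffAt_section {f : M → ℝ} (hf : ContMDiff (𝓡 n) 𝓘(ℝ, ℝ) ∞ f)
    {s : ∀ p : M, TangentSpace (𝓡 n) p} {U : Set M}
    (hs : ContMDiffOn (𝓡 n) ((𝓡 n).prod 𝓘(ℝ, EuclideanSpace ℝ (Fin n))) ∞
      (fun p => (⟨p, s p⟩ : TangentBundle (𝓡 n) M)) U) :
    ContMDiffOn (𝓡 n) 𝓘(ℝ, ℝ) ∞ (fun p => diffAt f p (s p)) U := by
  have h1 : ContMDiff (𝓡 n).tangent 𝓘(ℝ, ℝ).tangent ∞ (tangentMap (𝓡 n) 𝓘(ℝ, ℝ) f) :=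
    hf.contMDiff_tangentMap (by simp)
  exact (contMDiff_snd_tangentBundle_modelSpace ℝ 𝓘(ℝ, ℝ)).comp_contMDiffOn (h1.comp_contMDiffOn hs)

lemma contMDiffOn_diffAt_ofChart {f : M → ℝ} (hf : ContMDiff (𝓡 n) 𝓘(ℝ, ℝ) ∞ f) (p₀ : M)
    (v : EuclideanSpace ℝ (Fin n)) :
    ContMDiffOn (𝓡 n) 𝓘(ℝ, ℝ) ∞ (fun p => diffAt f p (ofChart p₀ p v))
      (chartAt (EuclideanSpace ℝ (Fin n)) p₀).source := by
  refine contMDiffOn_diffAt_section hf ?_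
  set e := trivializationAt (EuclideanSpace ℝ (Fin n)) (TangentSpace (𝓡 n) : M → Type _) p₀
  have hb : (chartAt (EuclideanSpace ℝ (Fin n)) p₀).source = e.baseSet :=
    (TangentBundle.trivializationAt_baseSet p₀).symm
  rw [hb, e.contMDiffOn_section_baseSet_iff]
  refine (contMDiffOn_const (c := v)).congr fun p hp => ?_
  have := congrArg Prod.snd (e.apply_mk_symm hp v)
  rwa [← e.symmL_apply (R := ℝ) hp] at this

lemma diffAt_add (f g : SmoothFunction n M) (p : M) :
    diffAt (n := n) (f + g : SmoothFunction n M) p = diffAt (n := n) f p + diffAt (n := n) g p := by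
  ext v
  exact congrArg (fun L => L v) (mfderiv_add (f.mdifferentiableAt (x := p)) g.mdifferentiableAt)

lemma diffAt_smul (c : ℝ) (f : SmoothFunction n M) (p : M) :
    diffAt (n := n) (c • f : SmoothFunction n M) p = c • diffAt (n := n) f p := by
  ext v
  exact congrArg (fun L => L v) (const_smul_mfderiv (f.mdifferentiableAt (x := p)) c)

lemma diffAt_mul (f g : SmoothFunction n M) (p : M) :
    diffAt (n := n) (f * g : SmoothFunction n M) p = f p • diffAt (n := n) g p + g p • diffAt (n := n) f p := by
  ext v
  exact congrArg (fun L => L v) 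
    ((f.mdifferentiableAt (x := p)).hasMFDerivAt.mul g.mdifferentiableAt.hasMFDerivAt).mfderiv

/-- The action `f ↦ φ(f) = df(φ)` of a smooth vector field `φ` on `C^∞(M)`. -/
def derivAlong (φ : SmoothVectorField n M) : SmoothFunction n M →ₗ[ℝ] SmoothFunction n M where
  toFun f := ⟨fun p => diffAt f p (φ p), by
    rw [← contMDiffOn_univ]
    exact contMDiffOn_diffAt_section f.contMDiff φ.contMDiff.contMDiffOn⟩
  map_add' f g := by
    ext p
    exact congrArg (fun L => L (φ p)) (diffAt_add f g p)
  map_smul' c f := by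
    ext p
    exact congrArg (fun L => L (φ p)) (diffAt_smul c f p)

variable (n M) in
/-- `Ω^k(M)`: the families of alternating `k`-linear forms on the tangent spaces of `M` whose
components in every chart are smooth. -/
def SmoothForm (k : ℕ) : AddSubgroup (∀ p : M, TangentSpace (𝓡 n) p [⋀^Fin k]→ₗ[ℝ] ℝ) where
  carrier := {α | ∀ (p₀ : M) (v : Fin k → EuclideanSpace ℝ (Fin n)),
    ContMDiffOn (𝓡 n) 𝓘(ℝ, ℝ) ∞ (fun p => α p fun i => ofChart p₀ p (v i))
      (chartAt (EuclideanSpace ℝ (Fin n)) p₀).source}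
  add_mem' hα hβ p₀ v := (hα p₀ v).add (hβ p₀ v)
  zero_mem' _ _ := contMDiffOn_const
  neg_mem' hα p₀ v := (hα p₀ v).neg

/-- `Ω^k(M)` is a `C^∞(M)`-module under pointwise multiplication. -/
instance (k : ℕ) : Module (SmoothFunction n M) (SmoothForm n M k) where
  smul f α := ⟨fun p => f p • α.1 p, fun p₀ v => f.contMDiff.contMDiffOn.mul (α.2 p₀ v)⟩
  one_smul α := Subtype.ext <| funext fun p => one_smul ℝ (α.1 p)
  mul_smul f g α := Subtype.ext <| funext fun p => mul_smul (f p) (g p) (α.1 p)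
  smul_zero f := Subtype.ext <| funext fun p => smul_zero (f p)
  smul_add f α β := Subtype.ext <| funext fun p => smul_add (f p) (α.1 p) (β.1 p)
  add_smul f g α := Subtype.ext <| funext fun p => add_smul (f p) (g p) (α.1 p)
  zero_smul α := Subtype.ext <| funext fun p => zero_smul ℝ (α.1 p)

/-- `df₁ ∧ ⋯ ∧ df_k`, whose value on tangent vectors `v₁, …, v_k` at `p` is `det (d_p fᵢ(vⱼ))`. -/
def wedgeDiff {k : ℕ} (f : Fin k → SmoothFunction n M) : SmoothForm n M k :=
  ⟨fun p => Matrix.detRowAlternating.compLinearMap (LinearMap.pi fun i => diffAt (f i) p),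
    fun p₀ v => by
      have h : ∀ p, (Matrix.detRowAlternating.compLinearMap
          (LinearMap.pi fun i => diffAt (f i) p)) (fun i => ofChart p₀ p (v i)) =
          ∑ σ : Equiv.Perm (Fin k), ((Equiv.Perm.sign σ : ℤ) : ℝ) *
            ∏ i, diffAt (f i) p (ofChart p₀ p (v (σ i))) := fun p =>
        Matrix.det_apply' (Matrix.of fun i j => diffAt (f j) p (ofChart p₀ p (v i)))
      simp only [h]
      refine contMDiffOn_finsetSum fun σ _ => contMDiffOn_const.mul ?_
      refine contMDiffOn_finsetProd fun i _ => ?_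
      exact contMDiffOn_diffAt_ofChart (f i).contMDiff p₀ _⟩

lemma wedgeDiff_apply {k : ℕ} (f : Fin k → SmoothFunction n M) (p : M)
    (v : Fin k → TangentSpace (𝓡 n) p) :
    (wedgeDiff f).1 p v = (Matrix.of fun i j => diffAt (f i) p (v j)).det := by
  rw [← Matrix.det_transpose]
  rfl

variable (n M) in
/-- A bivector field on `M`: a family of alternating bilinear forms on the cotangent spaces whose
components in every chart are smooth. -/
structure BivectorField where
  toFun : ∀ p : M, Module.Dual ℝ (TangentSpace (𝓡 n) p) →ₗ[ℝ]
    Module.Dual ℝ (TangentSpace (𝓡 n) p) →ₗ[ℝ] ℝ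
  self_eq_zero : ∀ p α, toFun p α α = 0
  smooth : ∀ (p₀ : M) (α β : Module.Dual ℝ (EuclideanSpace ℝ (Fin n))),
    ContMDiffOn (𝓡 n) 𝓘(ℝ, ℝ) ∞ (fun p => toFun p (α ∘ₗ toChart p₀ p) (β ∘ₗ toChart p₀ p))
      (chartAt (EuclideanSpace ℝ (Fin n)) p₀).source

lemma diffAt_eq_sum (f : M → ℝ) {p₀ p : M}
    (hp : p ∈ (chartAt (EuclideanSpace ℝ (Fin n)) p₀).source) :
    diffAt f p = ∑ i, diffAt f p (ofChart p₀ p (EuclideanSpace.basisFun (Fin n) ℝ i)) •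
      ((EuclideanSpace.basisFun (Fin n) ℝ).toBasis.coord i ∘ₗ toChart p₀ p) := by
  ext v
  conv_lhs => rw [← ofChart_toChart hp v,
    ← (EuclideanSpace.basisFun (Fin n) ℝ).toBasis.sum_repr (toChart p₀ p v)]
  simp [mul_comm]

lemma BivectorField.contMDiff_apply (π : BivectorField n M) (f g : SmoothFunction n M) :
    ContMDiff (𝓡 n) 𝓘(ℝ, ℝ) ∞ (fun p => π.toFun p (diffAt f p) (diffAt g p)) := by
  intro p₀
  have hU : (chartAt (EuclideanSpace ℝ (Fin n)) p₀).source ∈ nhds p₀ :=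
    (chartAt (EuclideanSpace ℝ (Fin n)) p₀).open_source.mem_nhds (mem_chart_source _ p₀)
  refine ContMDiffOn.contMDiffAt ?_ hU
  have h : ∀ p ∈ (chartAt (EuclideanSpace ℝ (Fin n)) p₀).source,
      π.toFun p (diffAt f p) (diffAt g p) =
      ∑ i, ∑ j, diffAt f p (ofChart p₀ p (EuclideanSpace.basisFun (Fin n) ℝ i)) *
        (diffAt g p (ofChart p₀ p (EuclideanSpace.basisFun (Fin n) ℝ j)) *
        π.toFun p ((EuclideanSpace.basisFun (Fin n) ℝ).toBasis.coord i ∘ₗ toChart p₀ p)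
          ((EuclideanSpace.basisFun (Fin n) ℝ).toBasis.coord j ∘ₗ toChart p₀ p)) := by
    intro p hp
    conv_lhs => rw [diffAt_eq_sum f hp, diffAt_eq_sum g hp]
    simp only [map_sum, map_smul, LinearMap.sum_apply, LinearMap.smul_apply, smul_eq_mul,
      Finset.mul_sum]
    rw [Finset.sum_comm]
    refine Finset.sum_congr rfl fun i _ => Finset.sum_congr rfl fun j _ => ?_
    ring
  refine ContMDiffOn.congr ?_ h
  refine contMDiffOn_finsetSum fun i _ => contMDiffOn_finsetSum fun j _ => ?_
  exact (contMDiffOn_diffAt_ofChart f.contMDiff p₀ _).mul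
    ((contMDiffOn_diffAt_ofChart g.contMDiff p₀ _).mul (π.smooth p₀ _ _))

/-- The bracket `{f, g} = π(df, dg)` on `C^∞(M)`. -/
def BivectorField.bracket (π : BivectorField n M) :
    SmoothFunction n M →ₗ[ℝ] SmoothFunction n M →ₗ[ℝ] SmoothFunction n M :=
  LinearMap.mk₂ ℝ (fun f g => ⟨_, π.contMDiff_apply f g⟩)
    (fun f f' g => by
      ext p
      change π.toFun p (diffAt (f + f' : SmoothFunction n M) p) (diffAt g p) =
        π.toFun p (diffAt f p) (diffAt g p) + π.toFun p (diffAt f' p) (diffAt g p)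
      rw [diffAt_add, map_add, LinearMap.add_apply])
    (fun c f g => by
      ext p
      change π.toFun p (diffAt (c • f : SmoothFunction n M) p) (diffAt g p) =
        c • π.toFun p (diffAt f p) (diffAt g p)
      rw [diffAt_smul, map_smul, LinearMap.smul_apply])
    (fun f g g' => by
      ext p
      change π.toFun p (diffAt f p) (diffAt (g + g' : SmoothFunction n M) p) =
        π.toFun p (diffAt f p) (diffAt g p) + π.toFun p (diffAt f p) (diffAt g' p)
      rw [diffAt_add, map_add])
    (fun c f g => by
      ext p
      change π.toFun p (diffAt f p) (diffAt (c • g : SmoothFunction n M) p) =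
        c • π.toFun p (diffAt f p) (diffAt g p)
      rw [diffAt_smul, map_smul])

lemma BivectorField.bracket_apply (π : BivectorField n M) (f g : SmoothFunction n M) (p : M) :
    π.bracket f g p = π.toFun p (diffAt f p) (diffAt g p) :=
  rfl

variable (n M) in
/-- A Poisson structure on `M`: a bivector field whose bracket is a Lie bracket. -/
structure PoissonStructure extends BivectorField n M where
  jacobi : ∀ f g h : SmoothFunction n M,
    toBivectorField.bracket f (toBivectorField.bracket g h) +
      toBivectorField.bracket g (toBivectorField.bracket h f) +
      toBivectorField.bracket h (toBivectorField.bracket f g) = 0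

lemma PoissonStructure.isPoissonBracket (π : PoissonStructure n M) :
    IsPoissonBracket π.bracket where
  self_eq_zero f := by
    ext p
    exact π.self_eq_zero p _
  jacobi := π.jacobi
  leibniz f g h := by
    ext p
    change π.toFun p (diffAt (f * g : SmoothFunction n M) p) (diffAt h p) =
      f p * π.toFun p (diffAt g p) (diffAt h p) + π.toFun p (diffAt f p) (diffAt h p) * g p
    rw [diffAt_mul]
    simp [mul_comm]

instance (p : M) : FiniteDimensional ℝ (TangentSpace (𝓡 n) p) :=
  inferInstanceAs (FiniteDimensional ℝ (EuclideanSpace ℝ (Fin n)))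

/-- The Hamiltonian vector field `X_f = -π^♯(df)`: at `p` it is the tangent vector with
`α(X_f) = π(α, d_p f)` for all covectors `α`, so that `X_f(g) = {g, f}`. -/
def PoissonStructure.hamiltonian (π : PoissonStructure n M) (f : M → ℝ) (p : M) :
    TangentSpace (𝓡 n) p :=
  (Module.evalEquiv ℝ (TangentSpace (𝓡 n) p)).symm ((π.toFun p).flip (diffAt f p))

lemma PoissonStructure.apply_hamiltonian (π : PoissonStructure n M) (f : M → ℝ) (p : M)
    (α : Module.Dual ℝ (TangentSpace (𝓡 n) p)) :
    α (π.hamiltonian f p) = π.toFun p α (diffAt f p) := by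
  rw [hamiltonian, Module.apply_evalEquiv_symm_apply]
  rfl

/-- The value at `p` of `(ℒ_X α)(Y₁, …, Y_k) = X(α(Y₁, …, Y_k)) - ∑ᵢ α(Y₁, …, [X, Yᵢ], …, Y_k)`,
where `ℒ_X` is the Lie derivative along the vector field `X`. -/
def lieDerivative {k : ℕ} (X : ∀ p : M, TangentSpace (𝓡 n) p) (α : SmoothForm n M k)
    (Y : Fin k → SmoothVectorField n M) (p : M) : ℝ :=
  diffAt (fun q => α.1 q fun i => Y i q) p (X p) -
    ∑ i, α.1 p (Function.update (fun l => Y l p) i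
      (VectorField.mlieBracket (𝓡 n) X (fun q => Y i q) p))

/-- `μ` is a volume form: a nowhere vanishing form of top degree. -/
def IsVolumeForm (μ : SmoothForm n M n) : Prop :=
  ∀ p, μ.1 p ≠ 0

/-- `φ` is the modular vector field with respect to `μ`: `ℒ_{X_f} μ = φ(f) μ` for all `f`. -/
def IsModularVectorField (π : PoissonStructure n M) (μ : SmoothForm n M n)
    (φ : SmoothVectorField n M) : Prop :=
  ∀ (f : SmoothFunction n M) (Y : Fin n → SmoothVectorField n M) (p : M),
    lieDerivative (π.hamiltonian f) μ Y p = derivAlong φ f p * μ.1 p fun i => Y i p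

variable (W : Type*) [AddCommGroup W] [Module ℝ W] [Module (SmoothFunction n M) W]
  [IsScalarTower ℝ (SmoothFunction n M) W]

variable (n M) in
/-- The maximal ideal `𝔪_p` of functions vanishing at `p`. -/
def vanishingIdeal (p : M) : Ideal (SmoothFunction n M) :=
  RingHom.ker (ContMDiffMap.evalRingHom (I := 𝓡 n) (n := ∞) (I' := 𝓘(ℝ, ℝ)) (R := ℝ) p)

variable (n M) in
/-- The `C^∞(M)`-module `W` is geometric: `⋂_p 𝔪_p W = 0`. -/
def IsGeometric : Prop :=
  ⨅ p : M, vanishingIdeal n M p • (⊤ : Submodule (SmoothFunction n M) W) = ⊥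

variable {W}

/-- The twist of a bracket `{w, f}_W` by a vector field: `{w, f} = {w, f}_W + φ(f) w`. -/
def twist (b : W →ₗ[ℝ] SmoothFunction n M →ₗ[ℝ] W) (φ : SmoothVectorField n M) :
    W →ₗ[ℝ] SmoothFunction n M →ₗ[ℝ] W :=
  LinearMap.mk₂ ℝ (fun w f => b w f + derivAlong φ f • w)
    (fun w w' f => by simp only [map_add, LinearMap.add_apply, smul_add]; abel)
    (fun c w f => by simp only [map_smul, LinearMap.smul_apply, smul_add, smul_comm c])
    (fun w f g => by simp only [map_add, add_smul]; abel)
    (fun c w f => by simp only [map_smul, smul_add, smul_assoc])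

/-- `W ⊗_{C^∞(M)} Ω^j(M)`. -/
abbrev FormsWithValues (W : Type*) [AddCommGroup W] [Module (SmoothFunction n M) W] (j : ℕ) :
    Type _ :=
  W ⊗[SmoothFunction n M] SmoothForm n M j

/-- For `X ∈ 𝔛ᵏ(W)` and `q = k + j`, the `C^∞(M)`-linear map `ι` from `q`-forms to `j`-forms with
values in `W` satisfies, with `σ` running over the `(k, j)`-shuffles,
`ι(f₀ df₁ ∧ ⋯ ∧ df_q) = ∑_σ sgn(σ) f₀ X(f_{σ(1)}, …, f_{σ(k)}) ⊗ df_{σ(k+1)} ∧ ⋯ ∧ df_{σ(q)}`. -/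
def IsInteriorProduct {k j q : ℕ} (h : k + j = q) (X : SkewDerivation (SmoothFunction n M) W k)
    (ι : SmoothForm n M q →ₗ[SmoothFunction n M] FormsWithValues (n := n) (M := M) W j) : Prop :=
  ∀ (f₀ : SmoothFunction n M) (f : Fin q → SmoothFunction n M),
    ι (f₀ • wedgeDiff f) =
      ∑ σ : Equiv.Perm (Fin q) with
        StrictMono (fun i : Fin k => σ (Fin.cast h (Fin.castAdd j i))) ∧
        StrictMono (fun i : Fin j => σ (Fin.cast h (Fin.natAdd k i))),
        (Equiv.Perm.sign σ : ℤ) •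
          ((f₀ • X.1 fun i : Fin k => f (σ (Fin.cast h (Fin.castAdd j i)))) ⊗ₜ
            wedgeDiff fun i : Fin j => f (σ (Fin.cast h (Fin.natAdd k i))))

/-- The interior product `ι_X`, the map singled out by `IsInteriorProduct`. -/
def interiorProduct {k j q : ℕ} (h : k + j = q) (X : SkewDerivation (SmoothFunction n M) W k) :
    SmoothForm n M q →ₗ[SmoothFunction n M] FormsWithValues (n := n) (M := M) W j :=
  Classical.epsilon (IsInteriorProduct h X)

/-- The `ℝ`-linear map `∂ : W ⊗ Ω^{r+1}(M) → W ⊗ Ω^r(M)` satisfies the formula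
`∂(w ⊗ f₀ df₁ ∧ ⋯ ∧ df_{r+1}) = ∑ᵢ (-1)^{i-1} {f₀ w, fᵢ}_W ⊗ df₁ ∧ ⋯ [no dfᵢ] ⋯ ∧ df_{r+1}
  + ∑_{i<j} (-1)^{i+j} w ⊗ f₀ d{fᵢ, fⱼ} ∧ df₁ ∧ ⋯ [no dfᵢ, dfⱼ] ⋯ ∧ df_{r+1}`
of the Poisson boundary with coefficients in `(W, b)`. (In the code the `fᵢ` are numbered from
`0`, so `(-1)^{i-1}` becomes `(-1)^i`.) -/
def IsPoissonBoundary (π : PoissonStructure n M) (b : W →ₗ[ℝ] SmoothFunction n M →ₗ[ℝ] W) {r : ℕ}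
    (D : FormsWithValues (n := n) (M := M) W (r + 1) →ₗ[ℝ]
      FormsWithValues (n := n) (M := M) W r) : Prop :=
  ∀ (w : W) (f₀ : SmoothFunction n M) (f : Fin (r + 1) → SmoothFunction n M),
    D (w ⊗ₜ (f₀ • wedgeDiff f)) =
      ∑ i, (-1 : ℤ) ^ i.val • (b (f₀ • w) (f i) ⊗ₜ[SmoothFunction n M] wedgeDiff (i.removeNth f)) +
      bracketSum π.bracket (fun g => w ⊗ₜ[SmoothFunction n M] (f₀ • wedgeDiff g)) f

/-- The Poisson boundary `∂_{r+1}` with coefficients in `(W, b)`, the map singled out by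
`IsPoissonBoundary`. -/
def poissonBoundary (π : PoissonStructure n M) (b : W →ₗ[ℝ] SmoothFunction n M →ₗ[ℝ] W) (r : ℕ) :
    FormsWithValues (n := n) (M := M) W (r + 1) →ₗ[ℝ] FormsWithValues (n := n) (M := M) W r :=
  Classical.epsilon (IsPoissonBoundary π b)

/-- `▲ᵏ = (-1)^{k(k+1)/2} (X ↦ ι_X μ)`, from `𝔛ᵏ(W)` to `W ⊗ Ω^j(M)`, `k + j = n`. -/
def signedStar (μ : SmoothForm n M n) {k j : ℕ} (h : k + j = n)
    (X : SkewDerivation (SmoothFunction n M) W k) : FormsWithValues (n := n) (M := M) W j :=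
  (-1 : ℤ) ^ (k * (k + 1) / 2) • interiorProduct h X μ

end Manifold

end TwistedDuality

end

open TwistedDuality

open scoped Manifold ContDiff TensorProduct

noncomputable section

set_option linter.unusedSectionVars false

namespace TwistedDuality

/-! ### Cartan calculus on alternating maps, and δδ = 0. -/

section CartanCalculus

variable {C : Type*} [CommRing C] [Algebra ℝ C]
variable {W : Type*} [AddCommGroup W] [Module ℝ W]

/-! Everything rests on a finite global dual frame: functions y_a and vector fields E_a with v = ∑
dy_a(v) E_a for all tangent vectors v (`exists_isDualFrame`). Over a compact set, finitely many
functions whose differentials span can be cut down to 2n of them by generic projections. This bound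
does not depend on the compact set, so the families can be glued along shells of an exhaustion. The
E_a are the gradients of the y_a for the metric ∑ dy_a².

The frame shows that forms are spanned over C by the products df₁ ∧ ⋯ ∧ df_k, so ι_X and ∂ are
determined by their formulas. Geometricity of W enters through Hadamard's lemma: a function
vanishing to second order at p lies in 𝔪_p², hence a derivation D : C → W maps it into 𝔪_p W.
Subtracting first-order approximations at every p gives D f = ∑ E_a(f) D(y_a)
(`IsGeometric.expandsDerivations`). With this, ι_X is built recursively from the frame, and it
satisfies the antiderivation rule `iota_extMul`.

Since dg ∧ μ = 0, that rule becomes ▲(X(g, …)) = -dg ∧ ▲X (`starMap_ins`); the sign (-1)^{k(k+1)/2}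
makes it uniform in the degree. Injectivity of ▲ follows by inserting functions until degree 0 is
reached, where ▲ is w ↦ w ⊗ μ. Surjectivity follows by inserting functions into elements of top
degree.

Compatibility with the differentials is Cartan calculus. If i_g is insertion of g and L_g the Lie
derivative along the Hamiltonian field of g, then i_g δ + δ i_g = -L_g, and ∂(dg ∧ ω) + dg ∧ ∂ω =
L_g ω. It is therefore enough that ▲ intertwines the Lie derivatives (`starMap_lieDer`). In degree 0
this is the modularity of φ, and the twist by -φ is exactly the correction it produces. The boundary
∂ is then obtained by transporting δ along ▲, so ∂∂ = 0 follows from δδ = 0. Finally W_{-φ} is a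
Poisson module because φ is a Poisson vector field, as seen from commutators of Lie derivatives on
the n-vector field dual to μ. -/

lemma alternatingMap_ext_curryLeft {k : ℕ} {X Y : C [⋀^Fin (k + 1)]→ₗ[ℝ] W}
    (h : ∀ c, X.curryLeft c = Y.curryLeft c) : X = Y := by
  ext v
  have := congrArg (fun Z => Z (Fin.tail v)) (h (v 0))
  simpa [Matrix.vecCons, Fin.cons_self_tail] using this

lemma map_cons_cons_swap {k : ℕ} (X : C [⋀^Fin (k + 2)]→ₗ[ℝ] W) (c d : C) (v : Fin k → C) :
    X (Fin.cons c (Fin.cons d v : Fin (k + 1) → C)) =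
      - X (Fin.cons d (Fin.cons c v : Fin (k + 1) → C)) := by
  have h : ∀ a, X (Fin.cons a (Fin.cons a v : Fin (k + 1) → C)) = 0 := fun a =>
    X.map_eq_zero_of_eq _ (i := 0) (j := 1) (by simp) (by simp)
  have hadd1 : ∀ (a b : C) (t : Fin (k + 1) → C), X (Fin.cons (a + b) t) =
      X (Fin.cons a t) + X (Fin.cons b t) := fun a b t => X.map_vecCons_add t a b
  have hadd2 : ∀ (z a b : C), X (Fin.cons z (Fin.cons (a + b) v : Fin (k + 1) → C)) =
      X (Fin.cons z (Fin.cons a v : Fin (k + 1) → C)) +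
        X (Fin.cons z (Fin.cons b v : Fin (k + 1) → C)) := fun z a b =>
    (X.curryLeft z).map_vecCons_add v a b
  have := h (c + d)
  rw [hadd1, hadd2, hadd2, h, h, zero_add, add_zero] at this
  exact eq_neg_of_add_eq_zero_left this

lemma curryLeft_curryLeft_swap {k : ℕ} (X : C [⋀^Fin (k + 2)]→ₗ[ℝ] W) (c d : C) :
    (X.curryLeft c).curryLeft d = - (X.curryLeft d).curryLeft c := by
  ext v
  exact map_cons_cons_swap X c d v

/-- `v ↦ ∑ᵢ X(v₁, …, x(vᵢ), …, v_k)`. -/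
def derAlt (x : C →ₗ[ℝ] C) : ∀ {k : ℕ}, C [⋀^Fin k]→ₗ[ℝ] W → C [⋀^Fin k]→ₗ[ℝ] W
  | 0, _ => 0
  | _ + 1, X => AlternatingMap.alternatizeUncurryFin (X.curryLeft ∘ₗ x)

lemma derAlt_apply (x : C →ₗ[ℝ] C) {k : ℕ} (X : C [⋀^Fin k]→ₗ[ℝ] W) (v : Fin k → C) :
    derAlt x X v = ∑ i, X (Function.update v i (x (v i))) := by
  cases k with
  | zero => simp [derAlt]
  | succ k =>
    simp only [derAlt, AlternatingMap.alternatizeUncurryFin_apply]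
    refine Finset.sum_congr rfl fun i _ => ?_
    exact ((Fin.insertNth_removeNth (α := fun _ => C) i (x (v i)) v) ▸
      X.map_insertNth i (x (v i)) (i.removeNth v)).symm

lemma curryLeft_derAlt (x : C →ₗ[ℝ] C) {k : ℕ} (X : C [⋀^Fin (k + 1)]→ₗ[ℝ] W) (c : C) :
    (derAlt x X).curryLeft c = X.curryLeft (x c) + derAlt x (X.curryLeft c) := by
  ext v
  change derAlt x X (Fin.cons c v) = X (Fin.cons (x c) v) + derAlt x (X.curryLeft c) v
  rw [derAlt_apply, derAlt_apply, Fin.sum_univ_succ, Fin.cons_zero, Fin.update_cons_zero]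
  congr 1
  refine Finset.sum_congr rfl fun i _ => ?_
  rw [Fin.cons_succ, ← Fin.cons_update]
  rfl

/-- The Lie derivative `u ∘ X - ∑ᵢ X(…, x(·), …)` of an alternating map for endomorphisms `x` of
the source and `u` of the target. -/
def lieAlt (x : C →ₗ[ℝ] C) (u : W →ₗ[ℝ] W) {k : ℕ} (X : C [⋀^Fin k]→ₗ[ℝ] W) :
    C [⋀^Fin k]→ₗ[ℝ] W :=
  u.compAlternatingMap X - derAlt x X

lemma lieAlt_apply (x : C →ₗ[ℝ] C) (u : W →ₗ[ℝ] W) {k : ℕ} (X : C [⋀^Fin k]→ₗ[ℝ] W)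
    (v : Fin k → C) :
    lieAlt x u X v = u (X v) - ∑ i, X (Function.update v i (x (v i))) := by
  rw [← derAlt_apply]
  rfl

lemma lieAlt_sub (x : C →ₗ[ℝ] C) (u : W →ₗ[ℝ] W) {k : ℕ} (X Y : C [⋀^Fin k]→ₗ[ℝ] W) :
    lieAlt x u (X - Y) = lieAlt x u X - lieAlt x u Y := by
  ext v
  simp only [lieAlt_apply, AlternatingMap.sub_apply, map_sub, Finset.sum_sub_distrib]
  abel

lemma lieAlt_neg (x : C →ₗ[ℝ] C) (u : W →ₗ[ℝ] W) {k : ℕ} (X : C [⋀^Fin k]→ₗ[ℝ] W) :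
    lieAlt x u (-X) = -lieAlt x u X := by
  ext v
  simp only [lieAlt_apply, AlternatingMap.neg_apply, map_neg, Finset.sum_neg_distrib]
  abel

lemma curryLeft_lieAlt (x : C →ₗ[ℝ] C) (u : W →ₗ[ℝ] W) {k : ℕ} (X : C [⋀^Fin (k + 1)]→ₗ[ℝ] W)
    (c : C) :
    (lieAlt x u X).curryLeft c = lieAlt x u (X.curryLeft c) - X.curryLeft (x c) := by
  have : (lieAlt x u X).curryLeft c =
      (u.compAlternatingMap X).curryLeft c - (derAlt x X).curryLeft c := by
    ext v
    rfl
  rw [this, curryLeft_derAlt, lieAlt, sub_sub, add_comm (derAlt x _)]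
  rfl

lemma curryLeft_sub_apply {k : ℕ} (X Y : C [⋀^Fin (k + 1)]→ₗ[ℝ] W) (c : C) :
    (X - Y).curryLeft c = X.curryLeft c - Y.curryLeft c :=
  rfl

/-- In degree 0 only the target endomorphisms act. Otherwise inserting a function lowers the degree,
and by `curryLeft_lieAlt` the correction terms assemble into the commutator on the source. -/
lemma lieAlt_commutator (x y : C →ₗ[ℝ] C) (u v : W →ₗ[ℝ] W) {k : ℕ} (X : C [⋀^Fin k]→ₗ[ℝ] W) :
    lieAlt x u (lieAlt y v X) - lieAlt y v (lieAlt x u X) =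
      lieAlt (x ∘ₗ y - y ∘ₗ x) (u ∘ₗ v - v ∘ₗ u) X := by
  induction k with
  | zero =>
    ext w
    simp [lieAlt_apply]
  | succ k ih =>
    refine alternatingMap_ext_curryLeft fun c => ?_
    simp only [curryLeft_sub_apply, curryLeft_lieAlt, lieAlt_sub, ← ih, LinearMap.sub_apply,
      LinearMap.comp_apply, map_sub]
    abel

variable {br : C →ₗ[ℝ] C →ₗ[ℝ] C} {b : W →ₗ[ℝ] C →ₗ[ℝ] W}

lemma curryLeft_coboundaryAlt_zero [Module C W] [IsScalarTower ℝ C W] (h : ∀ a, br a a = 0)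
    (X : C [⋀^Fin 0]→ₗ[ℝ] W) (c : C) :
    (coboundaryAlt br b X).curryLeft c = - lieAlt (br.flip c) (b.flip c) X := by
  ext v
  change coboundaryAlt br b X (Fin.cons c v) = - lieAlt (br.flip c) (b.flip c) X v
  rw [coboundaryAlt_apply h, lieAlt_apply]
  simp [coboundaryFormula, bracketSum]

lemma bracketSum_one {A : Type*} [AddCommGroup A] (F : (Fin 1 → C) → A) (z : C) (g : Fin 1 → C) :
    bracketSum br F (Fin.cons z g : Fin 2 → C) =
      - ∑ i : Fin 1, (-1 : ℤ) ^ i.val • F (Fin.cons (br z (g i)) (i.removeNth g)) := by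
  have : Finset.Ici (0 : Fin 1) = Finset.univ := by decide
  simp [bracketSum, this]

/-- Pairs involving position 0 give the displayed sum. In every other pair z stands directly behind
the bracket, and `hG` moves it to the front at the cost of a sign; shifting both positions by one
does not change (-1)^{i+j}. `G` is left abstract so that the lemma serves cochains (insertion of z)
as well as forms (where dz is split off). -/
lemma bracketSum_cons {A : Type*} [AddCommGroup A] {m : ℕ} (F : (Fin (m + 2) → C) → A)
    (G : (Fin (m + 1) → C) → A) (z : C)
    (hG : ∀ c (t : Fin m → C),
      F (Fin.cons c (Fin.cons z t : Fin (m + 1) → C)) = - G (Fin.cons c t))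
    (g : Fin (m + 2) → C) :
    bracketSum br F (Fin.cons z g : Fin (m + 3) → C) =
      - ∑ i : Fin (m + 2), (-1 : ℤ) ^ i.val • F (Fin.cons (br z (g i)) (i.removeNth g)) -
        bracketSum br G g := by
  have h0 : Finset.Ici (0 : Fin (m + 2)) = Finset.univ := by ext; simp
  rw [bracketSum, Fin.sum_univ_succ, h0, ← Finset.sum_neg_distrib, sub_eq_add_neg]
  congr 1
  · refine Finset.sum_congr rfl fun i _ => ?_
    rw [Fin.castSucc_zero, removeNth_zero_cons, Fin.cons_zero, Fin.cons_succ, Fin.val_zero,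
      zero_add, pow_succ, mul_neg_one, neg_smul]
  · rw [bracketSum, ← Finset.sum_neg_distrib]
    refine Finset.sum_congr rfl fun i _ => ?_
    rw [← Finset.sum_neg_distrib]
    have h1 : Finset.Ici i.succ = (Finset.Ici i).map (Fin.succEmb _) := by
      ext j
      refine Fin.cases ?_ (fun j => ?_) j <;> simp [Fin.succ_ne_zero]
    rw [h1, Finset.sum_map]
    refine Finset.sum_congr rfl fun j _ => ?_
    simp only [Fin.coe_succEmb, ← Fin.succ_castSucc, removeNth_succ_cons, Fin.cons_succ, hG,
      smul_neg, Fin.val_succ, neg_inj]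
    congr 1
    ring

lemma sum_update_flip (h : ∀ a, br a a = 0) {k : ℕ} (X : C [⋀^Fin (k + 1)]→ₗ[ℝ] W)
    (c : C) (v : Fin (k + 1) → C) :
    ∑ i, X (Function.update v i (br.flip c (v i))) =
      - ∑ i : Fin (k + 1), (-1 : ℤ) ^ i.val • X (Fin.cons (br c (v i)) (i.removeNth v)) := by
  rw [← Finset.sum_neg_distrib]
  refine Finset.sum_congr rfl fun i _ => ?_
  rw [← smul_neg, LinearMap.flip_apply, br_swap h, ← Fin.insertNth_removeNth,
    AlternatingMap.map_insertNth]
  congr 1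
  exact congrArg (fun Z => Z (i.removeNth v)) (X.curryLeft.map_neg (br c (v i)))

/-- Cartan's formula i_c δ + δ i_c = -L_c. It replaces the explicit double sums in all later
arguments. -/
lemma curryLeft_coboundaryAlt [Module C W] [IsScalarTower ℝ C W] (h : ∀ a, br a a = 0)
    {k : ℕ} (X : C [⋀^Fin (k + 1)]→ₗ[ℝ] W) (c : C) :
    (coboundaryAlt br b X).curryLeft c =
      - lieAlt (br.flip c) (b.flip c) X - coboundaryAlt br b (X.curryLeft c) := by
  ext v
  change coboundaryAlt br b X (Fin.cons c v) =
    - lieAlt (br.flip c) (b.flip c) X v - coboundaryAlt br b (X.curryLeft c) v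
  rw [coboundaryAlt_apply h, coboundaryAlt_apply h, lieAlt_apply]
  have e1 : ∑ i : Fin (k + 2), (-1 : ℤ) ^ (i.val + 1) •
        b (X (i.removeNth (Fin.cons c v : Fin (k + 2) → C)))
          ((Fin.cons c v : Fin (k + 2) → C) i) =
      - b (X v) c - ∑ i : Fin (k + 1), (-1 : ℤ) ^ (i.val + 1) •
        b (X.curryLeft c (i.removeNth v)) (v i) := by
    rw [Fin.sum_univ_succ]
    simp [removeNth_succ_cons, pow_succ, Matrix.vecCons]
  have e2 := sum_update_flip h X c v
  cases k with
  | zero =>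
    rw [coboundaryFormula, coboundaryFormula, e1, e2, bracketSum_one]
    simp only [bracketSum, LinearMap.flip_apply]
    abel
  | succ k =>
    rw [coboundaryFormula, coboundaryFormula, e1, e2,
      bracketSum_cons (br := br) X (X.curryLeft c) c (fun d t => map_cons_cons_swap X d c t)]
    simp only [LinearMap.flip_apply]
    abel

section Module

variable [Module C W] [IsScalarTower ℝ C W]

lemma coboundaryAlt_sub (h : ∀ a, br a a = 0) {k : ℕ} (X Y : C [⋀^Fin k]→ₗ[ℝ] W) :
    coboundaryAlt br b (X - Y) = coboundaryAlt br b X - coboundaryAlt br b Y := by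
  induction k with
  | zero =>
    refine alternatingMap_ext_curryLeft fun c => ?_
    rw [curryLeft_sub_apply, curryLeft_coboundaryAlt_zero h, curryLeft_coboundaryAlt_zero h,
      curryLeft_coboundaryAlt_zero h, lieAlt_sub]
    abel
  | succ k ih =>
    refine alternatingMap_ext_curryLeft fun c => ?_
    rw [curryLeft_sub_apply, curryLeft_coboundaryAlt h, curryLeft_coboundaryAlt h,
      curryLeft_coboundaryAlt h, lieAlt_sub, curryLeft_sub_apply, ih]
    abel

lemma coboundaryAlt_neg (h : ∀ a, br a a = 0) {k : ℕ} (X : C [⋀^Fin k]→ₗ[ℝ] W) :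
    coboundaryAlt br b (-X) = -coboundaryAlt br b X := by
  have h0 : coboundaryAlt br b (0 : C [⋀^Fin k]→ₗ[ℝ] W) = 0 := by
    rw [← sub_self (0 : C [⋀^Fin k]→ₗ[ℝ] W), coboundaryAlt_sub h, sub_self]
  rw [← zero_sub, coboundaryAlt_sub h, h0, zero_sub]

lemma IsPoissonBracket.flip_commutator (h : IsPoissonBracket br) (c d : C) :
    br.flip c ∘ₗ br.flip d - br.flip d ∘ₗ br.flip c = br.flip (br d c) := by
  ext a
  simp only [LinearMap.sub_apply, LinearMap.comp_apply, LinearMap.flip_apply]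
  have := h.jacobi a d c
  rw [br_swap h.self_eq_zero d (br c a), br_swap h.self_eq_zero c (br a d),
    br_swap h.self_eq_zero c a, map_neg, LinearMap.neg_apply, neg_neg] at this
  linear_combination -this

lemma IsPoissonModule.flip_commutator (hb : IsPoissonModule br b) (c d : C) :
    b.flip c ∘ₗ b.flip d - b.flip d ∘ₗ b.flip c = b.flip (br d c) := by
  ext w
  simp only [LinearMap.sub_apply, LinearMap.comp_apply, LinearMap.flip_apply, hb.lie]

/-- Induction on the degree. After inserting d, Cartan's formula leaves the commutator of L_c and
L_d. By the Jacobi identity and the module axiom this is L_{{d, c}}, which cancels the correction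
term coming from `curryLeft_lieAlt`. -/
lemma lieAlt_coboundaryAlt (h : IsPoissonBracket br) (hb : IsPoissonModule br b) (c : C) {k : ℕ}
    (X : C [⋀^Fin k]→ₗ[ℝ] W) :
    lieAlt (br.flip c) (b.flip c) (coboundaryAlt br b X) =
      coboundaryAlt br b (lieAlt (br.flip c) (b.flip c) X) := by
  induction k with
  | zero =>
    refine alternatingMap_ext_curryLeft fun d => ?_
    rw [curryLeft_lieAlt, curryLeft_coboundaryAlt_zero h.self_eq_zero,
      curryLeft_coboundaryAlt_zero h.self_eq_zero, curryLeft_coboundaryAlt_zero h.self_eq_zero,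
      lieAlt_neg, LinearMap.flip_apply, ← h.flip_commutator, ← hb.flip_commutator,
      ← lieAlt_commutator]
    abel
  | succ k ih =>
    refine alternatingMap_ext_curryLeft fun d => ?_
    rw [curryLeft_lieAlt, curryLeft_coboundaryAlt h.self_eq_zero,
      curryLeft_coboundaryAlt h.self_eq_zero, curryLeft_coboundaryAlt h.self_eq_zero,
      curryLeft_lieAlt, coboundaryAlt_sub h.self_eq_zero, ← ih, lieAlt_sub,
      lieAlt_neg, LinearMap.flip_apply, ← h.flip_commutator, ← hb.flip_commutator,
      ← lieAlt_commutator]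
    abel

/-- By Cartan's formula, i_d δδX = -L_d δX + δ L_d X + δδ i_d X. The first two terms cancel because
L_d commutes with δ, and the last vanishes by induction. -/
lemma coboundaryAlt_coboundaryAlt (h : IsPoissonBracket br) (hb : IsPoissonModule br b) {k : ℕ}
    (X : C [⋀^Fin k]→ₗ[ℝ] W) : coboundaryAlt br b (coboundaryAlt br b X) = 0 := by
  induction k with
  | zero =>
    refine alternatingMap_ext_curryLeft fun d => ?_
    rw [curryLeft_coboundaryAlt h.self_eq_zero, curryLeft_coboundaryAlt_zero h.self_eq_zero,
      coboundaryAlt_neg h.self_eq_zero, lieAlt_coboundaryAlt h hb]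
    simp
  | succ k ih =>
    refine alternatingMap_ext_curryLeft fun d => ?_
    rw [curryLeft_coboundaryAlt h.self_eq_zero, curryLeft_coboundaryAlt h.self_eq_zero,
      coboundaryAlt_sub h.self_eq_zero, ih, coboundaryAlt_neg h.self_eq_zero,
      lieAlt_coboundaryAlt h hb]
    simp

lemma coboundary_coboundary (h : IsPoissonBracket br) (hb : IsPoissonModule br b) (k : ℕ)
    (X : SkewDerivation C W k) :
    coboundary h hb (k + 1) (coboundary h hb k X) = 0 :=
  Subtype.ext (coboundaryAlt_coboundaryAlt h hb X.1)

end Module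

end CartanCalculus

/-! ### Contraction of α ∧ η on a single vector space. -/

section ExteriorAlgebra

variable {V : Type*} [AddCommGroup V] [Module ℝ V]

lemma curryLeft_alternatizeUncurryFin_smulRight_zero (α : Module.Dual ℝ V)
    (η : V [⋀^Fin 0]→ₗ[ℝ] ℝ) (e : V) :
    (AlternatingMap.alternatizeUncurryFin (α.smulRight η)).curryLeft e = α e • η := by
  ext v
  change AlternatingMap.alternatizeUncurryFin (α.smulRight η) (Matrix.vecCons e v) = _
  rw [AlternatingMap.alternatizeUncurryFin_apply]
  simp [Subsingleton.elim _ v]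

/-- Here `alternatizeUncurryFin (α.smulRight η)` is α ∧ η, so this is the antiderivation rule for
contraction by e. -/
lemma curryLeft_alternatizeUncurryFin_smulRight {k : ℕ} (α : Module.Dual ℝ V)
    (η : V [⋀^Fin (k + 1)]→ₗ[ℝ] ℝ) (e : V) :
    (AlternatingMap.alternatizeUncurryFin (α.smulRight η)).curryLeft e =
      α e • η - AlternatingMap.alternatizeUncurryFin (α.smulRight (η.curryLeft e)) := by
  ext v
  change AlternatingMap.alternatizeUncurryFin (α.smulRight η) (Fin.cons e v) =
    α e * η v - AlternatingMap.alternatizeUncurryFin (α.smulRight (η.curryLeft e)) v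
  rw [AlternatingMap.alternatizeUncurryFin_apply, AlternatingMap.alternatizeUncurryFin_apply,
    Fin.sum_univ_succ]
  simp [removeNth_succ_cons, pow_succ, Matrix.vecCons, sub_eq_add_neg]

lemma alternatingMap_sum_apply {k : ℕ} {ι : Type*} (s : Finset ι) (X : ι → V [⋀^Fin k]→ₗ[ℝ] ℝ)
    (v : Fin k → V) : (∑ i ∈ s, X i) v = ∑ i ∈ s, X i v := by
  classical
  induction s using Finset.induction_on with
  | empty => rfl
  | insert a s ha ih => rw [Finset.sum_insert ha, Finset.sum_insert ha, AlternatingMap.add_apply, ih]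

end ExteriorAlgebra

/-! ### Exterior multiplication, contraction and dual frames on forms. -/

section Forms

variable {n : ℕ} {M : Type*} [TopologicalSpace M] [ChartedSpace (EuclideanSpace ℝ (Fin n)) M]
  [IsManifold (𝓡 n) ∞ M]

lemma smoothFunction_sum_apply {ι : Type*} (s : Finset ι) (f : ι → SmoothFunction n M) (p : M) :
    (∑ i ∈ s, f i) p = ∑ i ∈ s, f i p :=
  map_sum (ContMDiffMap.evalRingHom (I := 𝓡 n) (n := ∞) (I' := 𝓘(ℝ, ℝ)) (R := ℝ) p) f s

lemma SmoothForm.ext {k : ℕ} {α β : SmoothForm n M k} (h : ∀ p v, α.1 p v = β.1 p v) : α = β :=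
  Subtype.ext <| funext fun p => AlternatingMap.ext (h p)

@[simp] lemma SmoothForm.coe_add {k : ℕ} (α β : SmoothForm n M k) (p : M) :
    (α + β).1 p = α.1 p + β.1 p :=
  rfl

@[simp] lemma SmoothForm.coe_smul {k : ℕ} (f : SmoothFunction n M) (α : SmoothForm n M k) (p : M) :
    (f • α).1 p = f p • α.1 p :=
  rfl

@[simp] lemma SmoothForm.coe_sum {k : ℕ} {ι : Type*} (s : Finset ι) (α : ι → SmoothForm n M k)
    (p : M) : (∑ i ∈ s, α i).1 p = ∑ i ∈ s, (α i).1 p := by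
  classical
  induction s using Finset.induction_on with
  | empty => rfl
  | insert a s ha ih => rw [Finset.sum_insert ha, Finset.sum_insert ha, SmoothForm.coe_add, ih]

/-- The exterior product `dg ∧ η`. -/
def extMul (g : SmoothFunction n M) {k : ℕ} :
    SmoothForm n M k →ₗ[SmoothFunction n M] SmoothForm n M (k + 1) where
  toFun η := ⟨fun p => AlternatingMap.alternatizeUncurryFin ((diffAt g p).smulRight (η.1 p)),
    fun p₀ v => by
      simp only [AlternatingMap.alternatizeUncurryFin_apply, LinearMap.smulRight_apply,
        AlternatingMap.smul_apply, smul_eq_mul, zsmul_eq_mul]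
      refine contMDiffOn_finsetSum fun i _ => contMDiffOn_const.mul ?_
      exact (contMDiffOn_diffAt_ofChart g.contMDiff p₀ _).mul (η.2 p₀ (i.removeNth v))⟩
  map_add' η ζ := SmoothForm.ext fun p v => by
    simp [AlternatingMap.alternatizeUncurryFin_apply, Finset.sum_add_distrib]
  map_smul' f η := SmoothForm.ext fun p v => by
    simp [AlternatingMap.alternatizeUncurryFin_apply, mul_left_comm, Finset.mul_sum]

lemma extMul_apply (g : SmoothFunction n M) {k : ℕ} (η : SmoothForm n M k) (p : M) :
    (extMul g η).1 p = AlternatingMap.alternatizeUncurryFin ((diffAt g p).smulRight (η.1 p)) :=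
  rfl

lemma contMDiffOn_toChart (E : SmoothVectorField n M) (p₀ : M) (i : Fin n) :
    ContMDiffOn (𝓡 n) 𝓘(ℝ, ℝ) ∞ (fun p => toChart p₀ p (E p) i)
      (chartAt (EuclideanSpace ℝ (Fin n)) p₀).source := by
  set e := trivializationAt (EuclideanSpace ℝ (Fin n)) (TangentSpace (𝓡 n) : M → Type _) p₀
  have hb : (chartAt (EuclideanSpace ℝ (Fin n)) p₀).source = e.baseSet :=
    (TangentBundle.trivializationAt_baseSet p₀).symm
  have h := (e.contMDiffOn_section_baseSet_iff (n := ∞) (IB := 𝓡 n) (s := fun p => E p)).1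
    E.contMDiff.contMDiffOn
  rw [hb]
  have h2 : ContMDiffOn (𝓡 n) 𝓘(ℝ, ℝ) ∞ (fun p => (e ⟨p, E p⟩).2 i) e.baseSet :=
    (EuclideanSpace.proj (𝕜 := ℝ) i).contMDiff.comp_contMDiffOn h
  refine h2.congr fun p hp => ?_
  change (e.continuousLinearMapAt ℝ p (E p)) i = _
  rw [Bundle.Trivialization.continuousLinearMapAt_apply, Bundle.Trivialization.linearMapAt_apply,
    if_pos hp]

lemma eq_sum_ofChart {p₀ p : M} (hp : p ∈ (chartAt (EuclideanSpace ℝ (Fin n)) p₀).source)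
    (v : TangentSpace (𝓡 n) p) :
    v = ∑ i, toChart p₀ p v i • ofChart p₀ p (EuclideanSpace.basisFun (Fin n) ℝ i) := by
  conv_lhs => rw [← ofChart_toChart hp v,
    ← (EuclideanSpace.basisFun (Fin n) ℝ).toBasis.sum_repr (toChart p₀ p v)]
  simp

/-- The contraction `η(E, …)`. -/
def contract (E : SmoothVectorField n M) {k : ℕ} :
    SmoothForm n M (k + 1) →ₗ[SmoothFunction n M] SmoothForm n M k where
  toFun η := ⟨fun p => (η.1 p).curryLeft (E p), fun p₀ v => by
    -- Smoothness of η is given only on vectors with constant components in a chart, so E is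
    -- expanded in the coordinate fields.
    have h : ∀ p ∈ (chartAt (EuclideanSpace ℝ (Fin n)) p₀).source,
        (η.1 p).curryLeft (E p) (fun i => ofChart p₀ p (v i)) =
        ∑ i, toChart p₀ p (E p) i * η.1 p (fun j => ofChart p₀ p
          ((Fin.cons (EuclideanSpace.basisFun (Fin n) ℝ i) v :
            Fin (k + 1) → EuclideanSpace ℝ (Fin n)) j)) := fun p hp => by
      conv_lhs => rw [eq_sum_ofChart hp (E p), map_sum, alternatingMap_sum_apply]
      refine Finset.sum_congr rfl fun i _ => ?_
      rw [map_smul, AlternatingMap.smul_apply, smul_eq_mul, AlternatingMap.curryLeft_apply_apply]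
      congr 2
      ext j : 1
      refine Fin.cases ?_ (fun j => ?_) j <;> simp
    refine ContMDiffOn.congr ?_ h
    exact contMDiffOn_finsetSum fun i _ => (contMDiffOn_toChart E p₀ i).mul (η.2 p₀ _)⟩
  map_add' η ζ := SmoothForm.ext fun p v => by simp
  map_smul' f η := SmoothForm.ext fun p v => by simp

lemma contract_apply (E : SmoothVectorField n M) {k : ℕ} (η : SmoothForm n M (k + 1)) (p : M) :
    (contract E η).1 p = (η.1 p).curryLeft (E p) :=
  rfl

lemma contract_extMul_zero (E : SmoothVectorField n M) (g : SmoothFunction n M)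
    (η : SmoothForm n M 0) : contract E (extMul g η) = derivAlong E g • η :=
  Subtype.ext <| funext fun p =>
    curryLeft_alternatizeUncurryFin_smulRight_zero (diffAt g p) (η.1 p) (E p)

lemma contract_extMul (E : SmoothVectorField n M) (g : SmoothFunction n M) {k : ℕ}
    (η : SmoothForm n M (k + 1)) :
    contract E (extMul g η) = derivAlong E g • η - extMul g (contract E η) :=
  Subtype.ext <| funext fun p =>
    curryLeft_alternatizeUncurryFin_smulRight (diffAt g p) (η.1 p) (E p)

/-- Laplace expansion of the determinant along its first row. -/
lemma extMul_wedgeDiff (g : SmoothFunction n M) {k : ℕ} (f : Fin k → SmoothFunction n M) :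
    extMul g (wedgeDiff f) = wedgeDiff (Fin.cons g f) := by
  refine SmoothForm.ext fun p v => ?_
  rw [wedgeDiff_apply, Matrix.det_succ_row_zero, extMul_apply,
    AlternatingMap.alternatizeUncurryFin_apply]
  refine Finset.sum_congr rfl fun i _ => ?_
  rw [LinearMap.smulRight_apply, AlternatingMap.smul_apply, wedgeDiff_apply, zsmul_eq_mul,
    smul_eq_mul, ← mul_assoc]
  simp [Matrix.submatrix, Fin.removeNth]

lemma extMul_mul (x y : SmoothFunction n M) {k : ℕ} (η : SmoothForm n M k) :
    extMul (x * y) η = x • extMul y η + y • extMul x η := by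
  refine SmoothForm.ext fun p v => ?_
  simp only [extMul_apply, diffAt_mul, SmoothForm.coe_add, SmoothForm.coe_smul,
    AlternatingMap.alternatizeUncurryFin_apply, AlternatingMap.add_apply,
    AlternatingMap.smul_apply, LinearMap.smulRight_apply, LinearMap.add_apply,
    LinearMap.smul_apply, smul_eq_mul, Finset.mul_sum, ← Finset.sum_add_distrib, zsmul_eq_mul]
  refine Finset.sum_congr rfl fun i _ => ?_
  ring

lemma wedgeDiff_cons_mul (x y : SmoothFunction n M) {k : ℕ} (f : Fin k → SmoothFunction n M) :
    wedgeDiff (Fin.cons (x * y) f : Fin (k + 1) → SmoothFunction n M) =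
      x • wedgeDiff (Fin.cons y f : Fin (k + 1) → SmoothFunction n M) +
        y • wedgeDiff (Fin.cons x f : Fin (k + 1) → SmoothFunction n M) := by
  simp only [← extMul_wedgeDiff, extMul_mul]

lemma wedgeDiff_apply_eq_detRow {k : ℕ} (f : Fin k → SmoothFunction n M) (p : M)
    (v : Fin k → TangentSpace (𝓡 n) p) :
    (wedgeDiff f).1 p v =
      Matrix.detRowAlternating (fun i j => diffAt (f i) p (v j)) :=
  wedgeDiff_apply f p v

lemma diffAt_update {k : ℕ} (f : Fin k → SmoothFunction n M) (i : Fin k)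
    (x : SmoothFunction n M) (p : M) (v : Fin k → TangentSpace (𝓡 n) p) :
    (fun l j => diffAt (Function.update f i x l) p (v j)) =
      Function.update (fun l j => diffAt (f l) p (v j)) i (fun j => diffAt x p (v j)) := by
  funext l
  rcases eq_or_ne l i with rfl | h <;> simp [*]

lemma wedgeDiff_update_add {k : ℕ} (f : Fin k → SmoothFunction n M) (i : Fin k)
    (x y : SmoothFunction n M) :
    wedgeDiff (Function.update f i (x + y)) =
      wedgeDiff (Function.update f i x) + wedgeDiff (Function.update f i y) := by
  refine SmoothForm.ext fun p v => ?_
  rw [SmoothForm.coe_add, AlternatingMap.add_apply, wedgeDiff_apply_eq_detRow,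
    wedgeDiff_apply_eq_detRow, wedgeDiff_apply_eq_detRow, diffAt_update, diffAt_update,
    diffAt_update, ← AlternatingMap.map_update_add, diffAt_add]
  rfl

/-- The only scalars acting on `SmoothForm` are smooth functions, so the real number c appears as a
constant function. -/
lemma wedgeDiff_update_smul {k : ℕ} (f : Fin k → SmoothFunction n M) (i : Fin k) (c : ℝ)
    (x : SmoothFunction n M) :
    wedgeDiff (Function.update f i (c • x)) =
      (c • (1 : SmoothFunction n M)) • wedgeDiff (Function.update f i x) := by
  refine SmoothForm.ext fun p v => ?_
  rw [SmoothForm.coe_smul, AlternatingMap.smul_apply, wedgeDiff_apply_eq_detRow,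
    wedgeDiff_apply_eq_detRow, diffAt_update,
    diffAt_update, diffAt_smul]
  have : (c • (1 : SmoothFunction n M)) p = c := mul_one c
  rw [this, ← AlternatingMap.map_update_smul]
  rfl

lemma wedgeDiff_eq_zero {k : ℕ} (f : Fin k → SmoothFunction n M) {i j : Fin k} (h : f i = f j)
    (hij : i ≠ j) : wedgeDiff f = 0 := by
  refine SmoothForm.ext fun p v => ?_
  rw [wedgeDiff_apply_eq_detRow]
  refine AlternatingMap.map_eq_zero_of_eq _ _ ?_ hij
  simp [h]

/-- The vector fields `E_a` and the functions `y_a` form dual global frames: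
`v = ∑ₐ dy_a(v) E_a` for every tangent vector `v`. -/
def IsDualFrame {N : ℕ} (y : Fin N → SmoothFunction n M) (E : Fin N → SmoothVectorField n M) :
    Prop :=
  ∀ (p : M) (v : TangentSpace (𝓡 n) p), v = ∑ a, diffAt (y a) p v • E a p

variable {N : ℕ} {y : Fin N → SmoothFunction n M} {E : Fin N → SmoothVectorField n M}

/-- An Euler identity: the frame gives η(v, …) = ∑ dy_a(v) η(E_a, …), and antisymmetrizing the left
side counts η once for each of its k + 1 arguments. -/
lemma IsDualFrame.sum_extMul_contract (h : IsDualFrame y E) {k : ℕ} (η : SmoothForm n M (k + 1)) :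
    ∑ a, extMul (y a) (contract (E a) η) = (k + 1) • η := by
  refine Subtype.ext <| funext fun p => ?_
  have e : ∑ a, (diffAt (y a) p).smulRight ((η.1 p).curryLeft (E a p)) = (η.1 p).curryLeft := by
    refine LinearMap.ext fun v => ?_
    conv_rhs => rw [h p v, map_sum]
    simp [LinearMap.sum_apply]
  have := congrArg AlternatingMap.alternatizeUncurryFin e
  rw [AlternatingMap.alternatizeUncurryFin_curryLeft, ← AlternatingMap.alternatizeUncurryFinLM_apply,
    map_sum] at this
  rw [SmoothForm.coe_sum]
  exact this

lemma constSmul_injective {k : ℕ} {x : SmoothForm n M k} (m : ℕ) :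
    (((m + 1 : ℕ) : ℝ)⁻¹ • (1 : SmoothFunction n M)) • (m + 1) • x = x := by
  refine SmoothForm.ext fun p v => ?_
  change (((m + 1 : ℕ) : ℝ)⁻¹ • (1 : ℝ)) * (((m + 1) • x).1 p v) = x.1 p v
  have : ((m + 1) • x).1 p v = ((m + 1 : ℕ) : ℝ) * x.1 p v := by
    change (m + 1) • (x.1 p v) = _
    rw [nsmul_eq_mul]
  have h0 : ((m + 1 : ℕ) : ℝ) ≠ 0 := by positivity
  rw [this, smul_eq_mul, mul_one, inv_mul_cancel_left₀ h0]

/-- The Euler identity writes η as a finite sum of terms dy_a ∧ (form of lower degree), up to the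
factor k + 1. Finiteness of the frame makes this a global statement without partitions of unity. -/
lemma IsDualFrame.span_wedgeDiff (h : IsDualFrame y E) (k : ℕ) :
    Submodule.span (SmoothFunction n M) (Set.range (wedgeDiff (n := n) (M := M) (k := k))) = ⊤ := by
  induction k with
  | zero =>
    refine eq_top_iff.2 fun η _ => ?_
    have hs : ContMDiff (𝓡 n) 𝓘(ℝ, ℝ) ∞ (fun p => η.1 p 0) := fun p₀ =>
      ((η.2 p₀ 0).congr fun p _ => by congr 1; exact Subsingleton.elim _ _).contMDiffAt
        ((chartAt (EuclideanSpace ℝ (Fin n)) p₀).open_source.mem_nhds (mem_chart_source _ p₀))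
    let c : SmoothFunction n M := ⟨fun p => η.1 p 0, hs⟩
    have : η = c • wedgeDiff (n := n) (M := M) (k := 0) 0 := by
      refine SmoothForm.ext fun p v => ?_
      rw [SmoothForm.coe_smul, AlternatingMap.smul_apply, wedgeDiff_apply, Matrix.det_fin_zero,
        smul_eq_mul, mul_one, Subsingleton.elim v 0]
      rfl
    rw [this]
    exact Submodule.smul_mem _ _ (Submodule.subset_span ⟨_, rfl⟩)
  | succ k ih =>
    refine eq_top_iff.2 fun η _ => ?_
    rw [← constSmul_injective (x := η) k, ← h.sum_extMul_contract]
    refine Submodule.smul_mem _ _ (Submodule.sum_mem _ fun a _ => ?_)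
    have : contract (E a) η ∈ Submodule.span (SmoothFunction n M)
      (Set.range (wedgeDiff (n := n) (M := M) (k := k))) := ih ▸ Submodule.mem_top
    have h2 := Submodule.mem_map_of_mem (f := extMul (y a)) this
    rw [Submodule.map_span] at h2
    refine Submodule.span_mono ?_ h2
    rintro _ ⟨_, ⟨f, rfl⟩, rfl⟩
    exact ⟨_, (extMul_wedgeDiff _ f).symm⟩

lemma subsingleton_smoothForm {k : ℕ} (hk : n < k) : Subsingleton (SmoothForm n M k) := by
  refine ⟨fun α β => SmoothForm.ext fun p v => ?_⟩
  have hv : ¬ LinearIndependent ℝ v := fun hv => by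
    have h1 := hv.fintype_card_le_finrank
    have h2 : Module.finrank ℝ (TangentSpace (𝓡 n) p) = n :=
      finrank_euclideanSpace_fin
    rw [h2, Fintype.card_fin] at h1
    omega
  rw [AlternatingMap.map_linearDependent _ _ hv, AlternatingMap.map_linearDependent _ _ hv]

end Forms

/-! ### Insertion of functions into skew derivations. -/

section Insertion

variable {C : Type*} [CommRing C] [Algebra ℝ C]
variable {W : Type*} [AddCommGroup W] [Module ℝ W] [Module C W] [IsScalarTower ℝ C W]

/-- The insertion `X ↦ X(c, …)` of a function into the first argument. -/
def SkewDerivation.ins (c : C) {k : ℕ} :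
    SkewDerivation C W (k + 1) →ₗ[C] SkewDerivation C W k where
  toFun X := ⟨X.1.curryLeft c, fun i f x y => by
    have := X.2 i.succ (Fin.cons c f) x y
    simp only [← Fin.cons_update] at this
    exact this⟩
  map_add' X Y := rfl
  map_smul' a X := rfl

lemma SkewDerivation.coe_ins (c : C) {k : ℕ} (X : SkewDerivation C W (k + 1)) :
    (ins c X).1 = X.1.curryLeft c :=
  rfl

lemma SkewDerivation.ins_apply (c : C) {k : ℕ} (X : SkewDerivation C W (k + 1)) (v : Fin k → C) :
    (ins c X).1 v = X.1 (Fin.cons c v) :=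
  rfl

lemma SkewDerivation.ins_swap (c d : C) {k : ℕ} (X : SkewDerivation C W (k + 2)) :
    ins c (ins d X) = - ins d (ins c X) :=
  Subtype.ext (curryLeft_curryLeft_swap X.1 d c)

lemma SkewDerivation.ext_ins {k : ℕ} {X Y : SkewDerivation C W (k + 1)}
    (h : ∀ c, ins c X = ins c Y) : X = Y :=
  Subtype.ext (alternatingMap_ext_curryLeft fun c => congrArg Subtype.val (h c))

lemma SkewDerivation.coe_sum {k : ℕ} {ι : Type*} (s : Finset ι) (X : ι → SkewDerivation C W k)
    (v : Fin k → C) : (∑ i ∈ s, X i).1 v = ∑ i ∈ s, (X i).1 v := by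
  classical
  induction s using Finset.induction_on with
  | empty => rfl
  | insert a s ha ih => rw [Finset.sum_insert ha, Finset.sum_insert ha, ← ih]; rfl

/-- The inverse of `k + 1`, as a scalar. -/
def invSucc (C : Type*) [CommRing C] [Algebra ℝ C] (k : ℕ) : C :=
  algebraMap ℝ C ((k + 1 : ℕ) : ℝ)⁻¹

lemma invSucc_smul {V : Type*} [AddCommGroup V] [Module C V] (k : ℕ) (v : V) :
    invSucc C k • (k + 1) • v = v := by
  have h0 : ((k + 1 : ℕ) : ℝ) ≠ 0 := by positivity
  rw [← Nat.cast_smul_eq_nsmul C, smul_smul, invSucc, ← map_natCast (algebraMap ℝ C), ← map_mul,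
    inv_mul_cancel₀ h0, map_one, one_smul]

lemma succ_nsmul_cancel (C : Type*) [CommRing C] [Algebra ℝ C] {V : Type*} [AddCommGroup V]
    [Module C V] (k : ℕ) {v w : V} (h : (k + 1) • v = (k + 1) • w) : v = w := by
  rw [← invSucc_smul (C := C) k v, h, invSucc_smul]

lemma add_neg_one_pow_smul {V : Type*} [AddCommGroup V] (a b : V) (m : ℕ) :
    a + (-1 : ℤ) ^ m • b = a - (-1 : ℤ) ^ (m + 1) • b := by
  rw [pow_succ, mul_neg_one, neg_smul, sub_neg_eq_add]

lemma sum_neg_sub_smul {V V' ι : Type*} [AddCommGroup V] [Module C V] [AddCommGroup V']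
    [Module C V'] (s : Finset ι) (a : ι → V) (b : ι → V') (z : ℤ) (L : V' →ₗ[C] V) :
    ∑ i ∈ s, (-a i - z • L (b i)) = -∑ i ∈ s, a i - z • L (∑ i ∈ s, b i) := by
  rw [Finset.sum_sub_distrib, Finset.sum_neg_distrib, map_sum, Finset.smul_sum]

/-- The arithmetic of the induction step in `iota_extMul`: one copy of A comes from E_a(g) η, and m
+ 1 more come from the induction hypothesis. -/
lemma sub_eq_succ_smul_add {V : Type*} [AddCommGroup V] (m : ℕ) (s : ℤ) (A T P Q e : V)
    (hT : T = -P - s • Q) (hP : (m + 1) • A = P) (hQ : (m + 1 + 1) • e = Q) :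
    A - T = (m + 1 + 1) • (A + s • e) := by
  rw [hT, ← hP, ← hQ, smul_add, smul_comm s, succ_nsmul A (m + 1)]
  abel

end Insertion

/-! ### The interior product built from a dual frame. -/

section InteriorProduct

variable {n : ℕ} {M : Type*} [TopologicalSpace M] [ChartedSpace (EuclideanSpace ℝ (Fin n)) M]
  [IsManifold (𝓡 n) ∞ M]

/-- The identification of forms of equal degrees. -/
def castForm {q j : ℕ} (h : j = q) : SmoothForm n M q →ₗ[SmoothFunction n M] SmoothForm n M j :=
  h ▸ LinearMap.id

variable (W : Type*) [AddCommGroup W] [Module ℝ W] [Module (SmoothFunction n M) W]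
  [IsScalarTower ℝ (SmoothFunction n M) W]

/-- The exterior product `dg ∧` on forms with values in `W`. -/
def extMulTensor (g : SmoothFunction n M) (j : ℕ) :
    FormsWithValues (n := n) (M := M) W j →ₗ[SmoothFunction n M]
      FormsWithValues (n := n) (M := M) W (j + 1) :=
  LinearMap.lTensor W (extMul g)

variable {N : ℕ} (y : Fin N → SmoothFunction n M) (E : Fin N → SmoothVectorField n M)

/-- Every derivation `D` of `C^∞(M)` with values in `W` is determined by the frame:
`D(f) = ∑ₐ E_a(f) D(y_a)`. -/
def ExpandsDerivations : Prop :=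
  ∀ D : SmoothFunction n M →ₗ[ℝ] W, (∀ x z, D (x * z) = x • D z + z • D x) →
    ∀ f, D f = ∑ a, derivAlong (E a) f • D (y a)

/-- The interior product `ι_X`, in terms of a dual frame. -/
def iota : ∀ (k j q : ℕ), k + j = q → SkewDerivation (SmoothFunction n M) W k
    →ₗ[SmoothFunction n M] SmoothForm n M q →ₗ[SmoothFunction n M]
      FormsWithValues (n := n) (M := M) W j
  | 0, j, q, h =>
    { toFun := fun X => TensorProduct.mk (SmoothFunction n M) W (SmoothForm n M j) (X.1 0) ∘ₗ
        castForm (by omega)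
      map_add' := fun X Y => by
        ext η
        exact TensorProduct.add_tmul _ _ _
      map_smul' := fun c X => rfl }
  | _ + 1, _, 0, _ => 0
  -- The sum over a of ι_{X(y_a, …)} applied to η(E_a, …) pairs each of the k + 1 arguments of X
  -- with η once, hence the division by k + 1.
  | k + 1, j, q + 1, h => invSucc (SmoothFunction n M) k • ∑ a,
      (LinearMap.lcomp (SmoothFunction n M) _ (contract (E a))) ∘ₗ
        (iota k j q (by omega)) ∘ₗ SkewDerivation.ins (y a)

variable {W y E}

lemma iota_zero (j : ℕ) (X : SkewDerivation (SmoothFunction n M) W 0) (η : SmoothForm n M j) :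
    iota W y E 0 j j (zero_add j) X η = X.1 0 ⊗ₜ η :=
  rfl

lemma succ_smul_iota_succ (k j q : ℕ) (h : k + 1 + j = q + 1)
    (X : SkewDerivation (SmoothFunction n M) W (k + 1)) (η : SmoothForm n M (q + 1)) :
    (k + 1) • iota W y E (k + 1) j (q + 1) h X η =
      ∑ a, iota W y E k j q (by omega) (SkewDerivation.ins (y a) X) (contract (E a) η) := by
  have : iota W y E (k + 1) j (q + 1) h X η = invSucc (SmoothFunction n M) k •
      ∑ a, iota W y E k j q (by omega) (SkewDerivation.ins (y a) X) (contract (E a) η) := by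
    simp [iota, LinearMap.sum_apply]
  rw [this, smul_comm, invSucc_smul]

lemma iota_extMul_base (j : ℕ) (X : SkewDerivation (SmoothFunction n M) W 0)
    (g : SmoothFunction n M) (q : ℕ) (h : 0 + (j + 1) = q + 1) (η : SmoothForm n M q) :
    iota W y E 0 (j + 1) (q + 1) h X (extMul g η) =
      extMulTensor W g j (iota W y E 0 j q (by omega) X η) := by
  obtain rfl : j = q := by omega
  rfl

-- From here on only `iota_zero`, `succ_smul_iota_succ` and `iota_extMul_base` are used about the
-- recursion.
attribute [irreducible] iota

/-- With the remaining arguments fixed, X is a derivation in its first argument, to which `hW`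
applies. -/
lemma ExpandsDerivations.sum_ins (hW : ExpandsDerivations W y E) {k : ℕ}
    (X : SkewDerivation (SmoothFunction n M) W (k + 1)) (g : SmoothFunction n M) :
    SkewDerivation.ins g X = ∑ a, derivAlong (E a) g • SkewDerivation.ins (y a) X := by
  refine Subtype.ext (AlternatingMap.ext fun v => ?_)
  rw [SkewDerivation.coe_sum]
  let D : SmoothFunction n M →ₗ[ℝ] W :=
    { toFun := fun c => X.1 (Fin.cons c v)
      map_add' := fun c d => X.1.map_vecCons_add v c d
      map_smul' := fun c d => X.1.map_vecCons_smul v c d }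
  exact hW D (fun x z => SkewDerivation.cons_mul X.2 x z v) g

lemma ExpandsDerivations.sum_iota_smul (hW : ExpandsDerivations W y E) (k j q : ℕ)
    (h : k + j = q) (X : SkewDerivation (SmoothFunction n M) W (k + 1)) (g : SmoothFunction n M)
    (η : SmoothForm n M q) :
    ∑ a, iota W y E k j q h (SkewDerivation.ins (y a) X) (derivAlong (E a) g • η) =
      iota W y E k j q h (SkewDerivation.ins g X) η := by
  rw [hW.sum_ins X g, map_sum, LinearMap.sum_apply]
  simp

lemma iota_ins_swap (k j q : ℕ) (h : k + j = q)
    (X : SkewDerivation (SmoothFunction n M) W (k + 2)) (c d : SmoothFunction n M)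
    (η : SmoothForm n M q) :
    iota W y E k j q h (SkewDerivation.ins c (SkewDerivation.ins d X)) η =
      - iota W y E k j q h (SkewDerivation.ins d (SkewDerivation.ins c X)) η := by
  rw [SkewDerivation.ins_swap, map_neg, LinearMap.neg_apply]

/-- The case of `iota_extMul` in which the term dg ∧ ι_X η is absent, since ι_X η would have degree
-1. -/
lemma iota_extMul_zero (hW : ExpandsDerivations W y E) (k q : ℕ) (h : k + 1 + 0 = q + 1)
    (X : SkewDerivation (SmoothFunction n M) W (k + 1)) (g : SmoothFunction n M)
    (η : SmoothForm n M q) :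
    iota W y E (k + 1) 0 (q + 1) h X (extMul g η) =
      iota W y E k 0 q (by omega) (SkewDerivation.ins g X) η := by
  induction k generalizing q with
  | zero =>
    obtain rfl : q = 0 := by omega
    refine succ_nsmul_cancel (SmoothFunction n M) 0 ?_
    rw [succ_smul_iota_succ]
    simp only [contract_extMul_zero]
    rw [hW.sum_iota_smul]
    exact (one_nsmul _).symm
  | succ k ih =>
    obtain ⟨q, rfl⟩ : ∃ r, q = r + 1 := ⟨k, by omega⟩
    refine succ_nsmul_cancel (SmoothFunction n M) (k + 1) ?_
    rw [succ_smul_iota_succ]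
    simp only [contract_extMul, map_sub, Finset.sum_sub_distrib]
    rw [hW.sum_iota_smul]
    have : ∀ a, iota W y E (k + 1) 0 (q + 1) (by omega) (SkewDerivation.ins (y a) X)
          (extMul g (contract (E a) η)) =
        - iota W y E k 0 q (by omega) (SkewDerivation.ins (y a) (SkewDerivation.ins g X))
          (contract (E a) η) := fun a => by
      rw [ih q (by omega), SkewDerivation.ins_swap, map_neg, LinearMap.neg_apply]
    refine (congrArg (_ - ·) ((Finset.sum_congr rfl fun a _ => this a).trans
      (Finset.sum_neg_distrib _))).trans ?_
    rw [← succ_smul_iota_succ (h := by omega), sub_neg_eq_add]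
    exact (succ_nsmul' _ _).symm

/-- The antiderivation rule for ι_X. In the recursion, contracting dg ∧ η with E_a gives E_a(g) η -
dg ∧ η(E_a, …). The first part sums to ι_{X(g, …)} η by the expansion of derivations. The second is
handled by induction, exchanging the two inserted functions y_a and g at the cost of a sign. -/
lemma iota_extMul (hW : ExpandsDerivations W y E) (k j q : ℕ) (h : k + 1 + (j + 1) = q + 1)
    (X : SkewDerivation (SmoothFunction n M) W (k + 1)) (g : SmoothFunction n M)
    (η : SmoothForm n M q) :
    iota W y E (k + 1) (j + 1) (q + 1) h X (extMul g η) =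
      iota W y E k (j + 1) q (by omega) (SkewDerivation.ins g X) η +
        (-1 : ℤ) ^ (k + 1) • extMulTensor W g j (iota W y E (k + 1) j q (by omega) X η) := by
  induction k generalizing q with
  | zero =>
    obtain ⟨q, rfl⟩ : ∃ r, q = r + 1 := ⟨j, by omega⟩
    refine succ_nsmul_cancel (SmoothFunction n M) 0 ?_
    rw [succ_smul_iota_succ]
    simp only [contract_extMul, map_sub, Finset.sum_sub_distrib]
    rw [hW.sum_iota_smul]
    have h2 := succ_smul_iota_succ (W := W) (y := y) (E := E) 0 j q (by omega) X η
    simp only [iota_extMul_base, ← map_sum, ← h2]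
    simp [sub_eq_add_neg]
  | succ k ih =>
    obtain ⟨q, rfl⟩ : ∃ r, q = r + 1 := ⟨k + j + 1, by omega⟩
    refine succ_nsmul_cancel (SmoothFunction n M) (k + 1) ?_
    rw [succ_smul_iota_succ]
    simp only [contract_extMul, map_sub, Finset.sum_sub_distrib]
    rw [hW.sum_iota_smul]
    have : ∀ a, iota W y E (k + 1) (j + 1) (q + 1) (by omega) (SkewDerivation.ins (y a) X)
          (extMul g (contract (E a) η)) =
        - iota W y E k (j + 1) q (by omega) (SkewDerivation.ins (y a) (SkewDerivation.ins g X))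
          (contract (E a) η) - (-1 : ℤ) ^ (k + 1 + 1) •
            extMulTensor W g j (iota W y E (k + 1) j q (by omega) (SkewDerivation.ins (y a) X)
              (contract (E a) η)) := fun a => by
      have e := iota_ins_swap (E := E) (y := y) k (j + 1) q (by omega) X g (y a) (contract (E a) η)
      exact (ih q (by omega) _ _).trans ((congrArg (· + _) e).trans (add_neg_one_pow_smul _ _ _))
    have hT := (Finset.sum_congr rfl fun a (_ : a ∈ Finset.univ) => this a).trans
      (sum_neg_sub_smul _ _ _ _ (extMulTensor W g j))
    have hP := succ_smul_iota_succ (W := W) (y := y) (E := E) k (j + 1) q (by omega)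
      (SkewDerivation.ins g X) η
    have hQ := succ_smul_iota_succ (W := W) (y := y) (E := E) (k + 1) j q (by omega) X η
    exact sub_eq_succ_smul_add k _ _ _ _ _ _ hT hP
      ((map_nsmul _ _ _).symm.trans (congrArg (extMulTensor W g j) hQ))

lemma iota_wedgeDiff (hW : ExpandsDerivations W y E) (k : ℕ)
    (X : SkewDerivation (SmoothFunction n M) W k) (f : Fin k → SmoothFunction n M) :
    iota W y E k 0 k (add_zero k) X (wedgeDiff f) = X.1 f ⊗ₜ wedgeDiff (k := 0) 0 := by
  induction k with
  | zero =>
    rw [Subsingleton.elim f 0]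
    exact iota_zero 0 X _
  | succ k ih =>
    rw [← Fin.cons_self_tail f, ← extMul_wedgeDiff, iota_extMul_zero hW, ih,
      SkewDerivation.ins_apply]

end InteriorProduct

/-! ### Shuffles, split according to the position of the value 0. -/

section Shuffles

/-- The permutation `σ` of `Fin (q + 1)` with `σ(p) = 0` that is given by `τ` elsewhere. -/
def extendPerm {q : ℕ} (p : Fin (q + 1)) (τ : Equiv.Perm (Fin q)) : Equiv.Perm (Fin (q + 1)) :=
  Equiv.Perm.decomposeFin.symm (0, τ) * p.cycleRange

lemma extendPerm_self {q : ℕ} (p : Fin (q + 1)) (τ : Equiv.Perm (Fin q)) :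
    extendPerm p τ p = 0 := by
  simp [extendPerm]

lemma extendPerm_succAbove {q : ℕ} (p : Fin (q + 1)) (τ : Equiv.Perm (Fin q)) (l : Fin q) :
    extendPerm p τ (p.succAbove l) = (τ l).succ := by
  simp [extendPerm]

lemma sign_extendPerm {q : ℕ} (p : Fin (q + 1)) (τ : Equiv.Perm (Fin q)) :
    (Equiv.Perm.sign (extendPerm p τ) : ℤ) = (-1) ^ p.val * (Equiv.Perm.sign τ : ℤ) := by
  simp [extendPerm, Equiv.Perm.sign_mul, mul_comm]

lemma extendPerm_injective {q : ℕ} (p : Fin (q + 1)) : Function.Injective (extendPerm p) := by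
  intro τ τ' h
  ext l
  have := congrArg (fun σ => σ (p.succAbove l)) h
  simp only [extendPerm_succAbove] at this
  exact congrArg Fin.val (Fin.succ_injective _ this)

lemma exists_extendPerm_eq {q : ℕ} {p : Fin (q + 1)} {σ : Equiv.Perm (Fin (q + 1))}
    (h : σ p = 0) : ∃ τ, extendPerm p τ = σ := by
  refine ⟨(Equiv.Perm.decomposeFin (σ * p.cycleRange⁻¹)).2, ?_⟩
  have h0 : (Equiv.Perm.decomposeFin (σ * p.cycleRange⁻¹)).1 = 0 := by
    have h1 := Equiv.Perm.decomposeFin_symm_apply_zero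
      (Equiv.Perm.decomposeFin (σ * p.cycleRange⁻¹)).1
      (Equiv.Perm.decomposeFin (σ * p.cycleRange⁻¹)).2
    rw [Prod.mk.eta, Equiv.symm_apply_apply] at h1
    rw [← h1, Equiv.Perm.mul_apply, Equiv.Perm.inv_def, Fin.cycleRange_symm_zero, h]
  rw [extendPerm]
  conv_lhs => rw [← h0, Prod.mk.eta, Equiv.symm_apply_apply]
  simp

/-- The position `i` of the first block of `k` among `q = k + j` positions. -/
abbrev firstBlock {k j q : ℕ} (h : k + j = q) (i : Fin k) : Fin q := Fin.cast h (Fin.castAdd j i)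

/-- The position `i` of the second block of `j` among `q = k + j` positions. -/
abbrev secondBlock {k j q : ℕ} (h : k + j = q) (i : Fin j) : Fin q := Fin.cast h (Fin.natAdd k i)

/-- The `(k, j)`-shuffles. -/
def shuffles {k j q : ℕ} (h : k + j = q) : Finset (Equiv.Perm (Fin q)) :=
  {σ | StrictMono (fun i => σ (firstBlock h i)) ∧ StrictMono (fun i => σ (secondBlock h i))}

lemma mem_shuffles {k j q : ℕ} {h : k + j = q} {σ : Equiv.Perm (Fin q)} :
    σ ∈ shuffles h ↔ StrictMono (fun i => σ (firstBlock h i)) ∧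
      StrictMono (fun i => σ (secondBlock h i)) := by
  simp [shuffles]

lemma perm_eq_one_of_strictMono {q : ℕ} {σ : Equiv.Perm (Fin q)} (h : StrictMono σ) : σ = 1 := by
  have := Subsingleton.elim (h.orderIsoOfSurjective _ σ.surjective) (OrderIso.refl _)
  ext i
  exact congrArg (fun e : Fin q ≃o Fin q => (e i).val) this

lemma shuffles_zero_left {j q : ℕ} (h : 0 + j = q) : shuffles h = {1} := by
  ext σ
  rw [mem_shuffles, Finset.mem_singleton]
  constructor
  · rintro ⟨-, h2⟩
    refine perm_eq_one_of_strictMono fun a b hab => ?_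
    have := @h2 ⟨a, by omega⟩ ⟨b, by omega⟩ hab
    simpa [secondBlock] using this
  · rintro rfl
    refine ⟨fun i => i.elim0, fun a b hab => ?_⟩
    have := Fin.lt_def.1 hab
    change 0 + a.val < 0 + b.val
    omega

lemma shuffles_zero_right {k q : ℕ} (h : k + 0 = q) : shuffles h = {1} := by
  ext σ
  rw [mem_shuffles, Finset.mem_singleton]
  constructor
  · rintro ⟨h1, -⟩
    refine perm_eq_one_of_strictMono fun a b hab => ?_
    have := @h1 ⟨a, by omega⟩ ⟨b, by omega⟩ hab
    simpa [firstBlock] using this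
  · rintro rfl
    exact ⟨fun a b hab => hab, fun i => i.elim0⟩

lemma strictMono_iff_of_cons {m q : ℕ} {u : Fin (m + 1) → Fin (q + 1)} {v : Fin m → Fin q}
    (h0 : u 0 = 0) (h : ∀ i, u i.succ = (v i).succ) : StrictMono u ↔ StrictMono v := by
  constructor
  · intro hu a b hab
    have := hu (Fin.succ_lt_succ_iff.2 hab)
    rwa [h, h, Fin.succ_lt_succ_iff] at this
  · intro hv a b hab
    obtain ⟨b, rfl⟩ := Fin.exists_succ_eq.2 (Fin.ne_zero_of_lt hab)
    rw [h]
    refine Fin.cases (fun _ => ?_) (fun a hab => ?_) a hab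
    · rw [h0]
      exact Fin.succ_pos _
    · rw [h, Fin.succ_lt_succ_iff]
      exact hv (Fin.succ_lt_succ_iff.1 hab)

lemma strictMono_iff_of_succ {m q : ℕ} {u : Fin m → Fin (q + 1)} {v : Fin m → Fin q}
    (h : ∀ i, u i = (v i).succ) : StrictMono u ↔ StrictMono v := by
  simp only [StrictMono, h, Fin.succ_lt_succ_iff]

section

variable {k j q : ℕ} (h : k + 1 + (j + 1) = q + 1)

lemma firstBlock_zero : firstBlock h 0 = 0 := by
  ext; simp

lemma firstBlock_succ (i : Fin k) :
    firstBlock h i.succ = (0 : Fin (q + 1)).succAbove (firstBlock (by omega : k + (j + 1) = q) i) := by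
  ext; simp

lemma secondBlock_eq_succAbove_zero (i : Fin (j + 1)) :
    secondBlock h i = (0 : Fin (q + 1)).succAbove (secondBlock (by omega : k + (j + 1) = q) i) := by
  ext
  simp
  omega

lemma firstBlock_eq_succAbove (i : Fin (k + 1)) :
    firstBlock h i = (secondBlock h 0).succAbove
      (firstBlock (by omega : k + 1 + j = q) i) := by
  rw [Fin.succAbove_of_castSucc_lt _ _ (by simp [Fin.lt_def]; omega)]
  ext; simp

lemma secondBlock_succ (i : Fin j) :
    secondBlock h i.succ = (secondBlock h 0).succAbove
      (secondBlock (by omega : k + 1 + j = q) i) := by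
  rw [Fin.succAbove_of_le_castSucc _ _ (by simp [Fin.le_def])]
  ext
  simp
  omega

lemma extendPerm_zero_mem_shuffles (τ : Equiv.Perm (Fin q)) :
    extendPerm 0 τ ∈ shuffles h ↔ τ ∈ shuffles (by omega : k + (j + 1) = q) := by
  rw [mem_shuffles, mem_shuffles]
  refine and_congr (strictMono_iff_of_cons ?_ fun i => ?_) (strictMono_iff_of_succ fun i => ?_)
  · rw [firstBlock_zero, extendPerm_self]
  · rw [firstBlock_succ, extendPerm_succAbove]
  · rw [secondBlock_eq_succAbove_zero, extendPerm_succAbove]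

lemma extendPerm_secondBlock_mem_shuffles (τ : Equiv.Perm (Fin q)) :
    extendPerm (secondBlock h 0) τ ∈ shuffles h ↔
      τ ∈ shuffles (by omega : k + 1 + j = q) := by
  rw [mem_shuffles, mem_shuffles]
  refine and_congr (strictMono_iff_of_succ fun i => ?_) (strictMono_iff_of_cons ?_ fun i => ?_)
  · rw [firstBlock_eq_succAbove, extendPerm_succAbove]
  · rw [extendPerm_self]
  · rw [secondBlock_succ, extendPerm_succAbove]

/-- A shuffle increases on each block, so its least value 0 is taken at the first position of one of
the two blocks. -/
lemma shuffles_apply_eq_zero {σ : Equiv.Perm (Fin (q + 1))} (hσ : σ ∈ shuffles h) (h0 : σ 0 ≠ 0) :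
    σ (secondBlock h 0) = 0 := by
  rw [mem_shuffles] at hσ
  obtain ⟨p, hp⟩ := σ.surjective 0
  by_cases hk : p.val < k + 1
  · exfalso
    have hp1 : firstBlock h ⟨p, hk⟩ = p := by ext; simp
    rcases eq_or_ne p 0 with rfl | hne
    · exact h0 hp
    have := @hσ.1 0 ⟨p, hk⟩ (by
      rw [Fin.lt_def]
      exact Nat.pos_of_ne_zero fun e => hne (Fin.ext e))
    simp only [hp1, hp] at this
    exact absurd this (Fin.not_lt_zero _)
  · have hp1 : secondBlock h ⟨p - (k + 1), by omega⟩ = p := by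
      ext
      simp
      omega
    rcases eq_or_ne (⟨p - (k + 1), by omega⟩ : Fin (j + 1)) 0 with e | hne
    · rw [← e, hp1, hp]
    have := hσ.2 (Fin.pos_iff_ne_zero.2 hne)
    simp only [hp1, hp] at this
    exact absurd this (Fin.not_lt_zero _)

/-- The combinatorial counterpart of `iota_extMul`: removing the value 0 leaves a shuffle whose
first or second block is shorter by one. -/
lemma sum_shuffles {A : Type*} [AddCommMonoid A] (F : Equiv.Perm (Fin (q + 1)) → A) :
    ∑ σ ∈ shuffles h, F σ = ∑ τ ∈ shuffles (by omega : k + (j + 1) = q), F (extendPerm 0 τ) +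
      ∑ τ ∈ shuffles (by omega : k + 1 + j = q), F (extendPerm (secondBlock h 0) τ) := by
  classical
  rw [← Finset.sum_filter_add_sum_filter_not _ (fun σ => σ 0 = 0)]
  congr 1
  · refine (Finset.sum_bij (fun τ _ => extendPerm 0 τ) ?_ ?_ ?_ ?_).symm
    · exact fun τ hτ => Finset.mem_filter.2
        ⟨(extendPerm_zero_mem_shuffles h τ).2 hτ, extendPerm_self _ _⟩
    · exact fun τ _ τ' _ e => extendPerm_injective _ e
    · intro σ hσ
      obtain ⟨h1, h2⟩ := Finset.mem_filter.1 hσ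
      obtain ⟨τ, rfl⟩ := exists_extendPerm_eq h2
      exact ⟨τ, (extendPerm_zero_mem_shuffles h τ).1 h1, rfl⟩
    · exact fun _ _ => rfl
  · refine (Finset.sum_bij (fun τ _ => extendPerm (secondBlock h 0) τ) ?_ ?_ ?_ ?_).symm
    · refine fun τ hτ => Finset.mem_filter.2
        ⟨(extendPerm_secondBlock_mem_shuffles h τ).2 hτ, fun e => ?_⟩
      have := (extendPerm (secondBlock h 0) τ).injective
        (e.trans (extendPerm_self (secondBlock h 0) τ).symm)
      simpa using congrArg Fin.val this
    · exact fun τ _ τ' _ e => extendPerm_injective _ e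
    · intro σ hσ
      obtain ⟨h1, h2⟩ := Finset.mem_filter.1 hσ
      obtain ⟨τ, rfl⟩ := exists_extendPerm_eq (shuffles_apply_eq_zero h h1 h2)
      exact ⟨τ, (extendPerm_secondBlock_mem_shuffles h τ).1 h1, rfl⟩
    · exact fun _ _ => rfl

end

end Shuffles

/-! ### The shuffle formula and uniqueness of ι_X. -/

section InteriorProduct

variable {n : ℕ} {M : Type*} [TopologicalSpace M] [ChartedSpace (EuclideanSpace ℝ (Fin n)) M]
  [IsManifold (𝓡 n) ∞ M]
variable {W : Type*} [AddCommGroup W] [Module ℝ W] [Module (SmoothFunction n M) W]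
  [IsScalarTower ℝ (SmoothFunction n M) W]
variable {N : ℕ} {y : Fin N → SmoothFunction n M} {E : Fin N → SmoothVectorField n M}

lemma extMulTensor_sum (g : SmoothFunction n M) (j : ℕ) {ι : Type*} (s : Finset ι)
    (x : ι → FormsWithValues (n := n) (M := M) W j) :
    extMulTensor W g j (∑ i ∈ s, x i) = ∑ i ∈ s, extMulTensor W g j (x i) :=
  map_sum (extMulTensor W g j) x s

lemma extMulTensor_zsmul_tmul (g : SmoothFunction n M) (j : ℕ) (z : ℤ) (w : W)
    (f : Fin j → SmoothFunction n M) :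
    extMulTensor W g j (z • (w ⊗ₜ[SmoothFunction n M] wedgeDiff f)) =
      z • (w ⊗ₜ[SmoothFunction n M] wedgeDiff (Fin.cons g f)) := by
  rw [map_zsmul, extMulTensor, LinearMap.lTensor_tmul, extMul_wedgeDiff]

set_option maxHeartbeats 800000 in
-- Both sides satisfy the same recursion when the first function g is split off. The value 0 in the
-- first block corresponds to g inserted into X, and in the second block to dg ∧. In the latter case
-- 0 is taken at position k + 1, which by `sign_extendPerm` gives the sign of `iota_extMul`.
lemma iota_wedgeDiff_eq_sum (hW : ExpandsDerivations W y E) (q k j : ℕ) (h : k + j = q)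
    (X : SkewDerivation (SmoothFunction n M) W k) (f : Fin q → SmoothFunction n M) :
    iota W y E k j q h X (wedgeDiff f) =
      ∑ σ ∈ shuffles h, (Equiv.Perm.sign σ : ℤ) •
        ((X.1 fun i => f (σ (firstBlock h i))) ⊗ₜ[SmoothFunction n M]
          wedgeDiff fun i => f (σ (secondBlock h i))) := by
  induction q generalizing k j with
  | zero =>
    obtain rfl : k = 0 := by omega
    obtain rfl : j = 0 := by omega
    rw [shuffles_zero_left, Finset.sum_singleton, Equiv.Perm.sign_one, Units.val_one, one_smul,
      iota_zero]
    rw [Subsingleton.elim (fun i => f ((1 : Equiv.Perm (Fin 0)) (firstBlock h i))) 0,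
      Subsingleton.elim (fun i => f ((1 : Equiv.Perm (Fin 0)) (secondBlock h i))) f]
  | succ q ih =>
    rcases k with _ | k
    · obtain rfl : j = q + 1 := by omega
      rw [shuffles_zero_left, Finset.sum_singleton, Equiv.Perm.sign_one, Units.val_one, one_smul,
        iota_zero]
      rw [Subsingleton.elim (fun i => f ((1 : Equiv.Perm (Fin (q + 1))) (firstBlock h i))) 0]
      congr 2
      ext i : 1
      congr 1
      ext
      simp
    · rcases j with _ | j
      · obtain rfl : k = q := by omega
        rw [shuffles_zero_right, Finset.sum_singleton, Equiv.Perm.sign_one, Units.val_one, one_smul,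
          iota_wedgeDiff hW]
        congr 2
        exact Subsingleton.elim _ _
      · obtain ⟨g, f, rfl⟩ : ∃ (g : SmoothFunction n M) (f' : Fin q → SmoothFunction n M),
            f = Fin.cons g f' := ⟨f 0, Fin.tail f, (Fin.cons_self_tail f).symm⟩
        let G : Equiv.Perm (Fin (q + 1)) → FormsWithValues (n := n) (M := M) W (j + 1) := fun σ =>
          (Equiv.Perm.sign σ : ℤ) •
            ((X.1 fun i => (Fin.cons g f : Fin (q + 1) → SmoothFunction n M) (σ (firstBlock h i)))
              ⊗ₜ[SmoothFunction n M] wedgeDiff fun i =>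
                (Fin.cons g f : Fin (q + 1) → SmoothFunction n M) (σ (secondBlock h i)))
        have hA : iota W y E k (j + 1) q (by omega) (SkewDerivation.ins g X) (wedgeDiff f) =
            ∑ τ ∈ shuffles (by omega : k + (j + 1) = q), G (extendPerm 0 τ) := by
          rw [ih]
          refine Finset.sum_congr rfl fun τ _ => ?_
          have e1 : (fun i => (Fin.cons g f : Fin (q + 1) → SmoothFunction n M)
              (extendPerm 0 τ (firstBlock h i))) =
              Fin.cons g fun i => f (τ (firstBlock (by omega : k + (j + 1) = q) i)) := by
            ext i : 1
            refine Fin.cases ?_ (fun i => ?_) i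
            · rw [firstBlock_zero, extendPerm_self, Fin.cons_zero, Fin.cons_zero]
            · rw [firstBlock_succ, extendPerm_succAbove, Fin.cons_succ, Fin.cons_succ]
          have e2 : (fun i => (Fin.cons g f : Fin (q + 1) → SmoothFunction n M)
              (extendPerm 0 τ (secondBlock h i))) =
              fun i => f (τ (secondBlock (by omega : k + (j + 1) = q) i)) := by
            ext i : 1
            rw [secondBlock_eq_succAbove_zero, extendPerm_succAbove, Fin.cons_succ]
          simp only [G, e1, e2, sign_extendPerm, SkewDerivation.ins_apply, Fin.val_zero, pow_zero,
            one_mul]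
        have hB : (-1 : ℤ) ^ (k + 1) • extMulTensor W g j
            (iota W y E (k + 1) j q (by omega) X (wedgeDiff f)) =
            ∑ τ ∈ shuffles (by omega : k + 1 + j = q), G (extendPerm (secondBlock h 0) τ) := by
          rw [ih, extMulTensor_sum, Finset.smul_sum]
          refine Finset.sum_congr rfl fun τ _ => ?_
          have e1 : (fun i => (Fin.cons g f : Fin (q + 1) → SmoothFunction n M)
              (extendPerm (secondBlock h 0) τ (firstBlock h i))) =
              fun i => f (τ (firstBlock (by omega : k + 1 + j = q) i)) := by
            ext i : 1
            rw [firstBlock_eq_succAbove, extendPerm_succAbove, Fin.cons_succ]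
          have e2 : (fun i => (Fin.cons g f : Fin (q + 1) → SmoothFunction n M)
              (extendPerm (secondBlock h 0) τ (secondBlock h i))) =
              Fin.cons g fun i => f (τ (secondBlock (by omega : k + 1 + j = q) i)) := by
            ext i : 1
            refine Fin.cases ?_ (fun i => ?_) i
            · rw [extendPerm_self, Fin.cons_zero, Fin.cons_zero]
            · rw [secondBlock_succ, extendPerm_succAbove, Fin.cons_succ, Fin.cons_succ]
          simp only [G, e1, e2]
          rw [extMulTensor_zsmul_tmul, sign_extendPerm, mul_smul]
          rfl
        rw [← extMul_wedgeDiff, iota_extMul hW, hA, hB]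
        exact (sum_shuffles h G).symm

lemma isInteriorProduct_iota (hW : ExpandsDerivations W y E) {q k j : ℕ} (h : k + j = q)
    (X : SkewDerivation (SmoothFunction n M) W k) :
    IsInteriorProduct h X (iota W y E k j q h X) := by
  intro f₀ f
  rw [map_smul, iota_wedgeDiff_eq_sum hW, Finset.smul_sum]
  refine Finset.sum_congr rfl fun σ _ => ?_
  rw [smul_comm f₀, TensorProduct.smul_tmul']

lemma IsInteriorProduct.unique (hE : IsDualFrame y E) {q k j : ℕ} {h : k + j = q}
    {X : SkewDerivation (SmoothFunction n M) W k}
    {ι ι' : SmoothForm n M q →ₗ[SmoothFunction n M] FormsWithValues (n := n) (M := M) W j}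
    (hι : IsInteriorProduct h X ι) (hι' : IsInteriorProduct h X ι') : ι = ι' := by
  refine LinearMap.ext_on_range (hE.span_wedgeDiff q) fun f => ?_
  have h1 := hι 1 f
  rw [one_smul] at h1
  have h2 := hι' 1 f
  rw [one_smul] at h2
  rw [h1, h2]

lemma interiorProduct_eq_iota (hE : IsDualFrame y E) (hW : ExpandsDerivations W y E) {q k j : ℕ}
    (h : k + j = q) (X : SkewDerivation (SmoothFunction n M) W k) :
    interiorProduct h X = iota W y E k j q h X :=
  IsInteriorProduct.unique hE
    (Classical.epsilon_spec (p := IsInteriorProduct h X) ⟨_, isInteriorProduct_iota hW h X⟩)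
    (isInteriorProduct_iota hW h X)

end InteriorProduct

/-! ### Dividing top forms by a volume form. -/

section VolumeForm

variable {n : ℕ} {M : Type*} [TopologicalSpace M] [ChartedSpace (EuclideanSpace ℝ (Fin n)) M]
  [IsManifold (𝓡 n) ∞ M]

/-- The smooth function `η(Y₁, …, Y_k)`. -/
def evalForm : ∀ {k : ℕ}, (Fin k → SmoothVectorField n M) →
    SmoothForm n M k →ₗ[SmoothFunction n M] SmoothFunction n M
  | 0, _ =>
    { toFun := fun η => ⟨fun p => η.1 p 0, fun p₀ =>
        ((η.2 p₀ 0).congr fun p _ => by congr 1; exact Subsingleton.elim _ _).contMDiffAt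
          ((chartAt (EuclideanSpace ℝ (Fin n)) p₀).open_source.mem_nhds (mem_chart_source _ p₀))⟩
      map_add' := fun _ _ => rfl
      map_smul' := fun _ _ => rfl }
  | _ + 1, Y => evalForm (Fin.tail Y) ∘ₗ contract (Y 0)

lemma evalForm_apply {k : ℕ} (Y : Fin k → SmoothVectorField n M) (η : SmoothForm n M k) (p : M) :
    evalForm Y η p = η.1 p fun i => Y i p := by
  induction k with
  | zero =>
    change η.1 p 0 = _
    congr 1
    exact Subsingleton.elim _ _
  | succ k ih =>
    change evalForm (Fin.tail Y) (contract (Y 0) η) p = _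
    rw [ih, contract_apply, AlternatingMap.curryLeft_apply_apply]
    congr 1
    ext i : 1
    refine Fin.cases rfl (fun i => rfl) i

variable {N : ℕ} {y : Fin N → SmoothFunction n M} {E : Fin N → SmoothVectorField n M}

/-- The vectors E_a(p) span the tangent space, so by multilinearity a form vanishing on all tuples
of them is zero. -/
lemma IsDualFrame.exists_apply_ne_zero (hE : IsDualFrame y E) {k : ℕ} {η : SmoothForm n M k}
    {p : M} (h : η.1 p ≠ 0) : ∃ b : Fin k → Fin N, η.1 p (fun i => E (b i) p) ≠ 0 := by
  classical
  by_contra! hb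
  refine h (AlternatingMap.ext fun v => ?_)
  have hv : v = fun i => ∑ a, diffAt (y a) p (v i) • E a p := funext fun i => hE p (v i)
  have h1 := (η.1 p).toMultilinearMap.map_sum (fun i a => diffAt (y a) p (v i) • E a p)
  rw [← hv] at h1
  refine h1.trans (Finset.sum_eq_zero fun b _ => ?_)
  rw [MultilinearMap.map_smul_univ]
  exact smul_eq_zero_of_right _ (hb b)

/-- The denominator of `starForm`. -/
def frameNorm (E : Fin N → SmoothVectorField n M) (μ : SmoothForm n M n) : SmoothFunction n M :=
  ∑ b : Fin n → Fin N, evalForm (E ∘ b) μ * evalForm (E ∘ b) μ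

lemma frameNorm_ne_zero (hE : IsDualFrame y E) {μ : SmoothForm n M n} (hμ : IsVolumeForm μ)
    (p : M) : frameNorm E μ p ≠ 0 := by
  obtain ⟨b, hb⟩ := hE.exists_apply_ne_zero (hμ p)
  rw [frameNorm, smoothFunction_sum_apply]
  refine (Finset.sum_pos' (fun b _ => mul_self_nonneg (evalForm (E ∘ b) μ p))
    ⟨b, Finset.mem_univ _, mul_self_pos.2 ?_⟩).ne'
  rw [evalForm_apply]
  exact hb

/-- The inverse of `frameNorm`. -/
def frameNormInv (hE : IsDualFrame y E) {μ : SmoothForm n M n} (hμ : IsVolumeForm μ) :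
    SmoothFunction n M :=
  ⟨fun p => (frameNorm E μ p)⁻¹, (frameNorm E μ).contMDiff.inv₀ (frameNorm_ne_zero hE hμ)⟩

/-- The `C^∞(M)`-linear function `η ↦ η / μ` on forms of top degree. -/
def starForm (hE : IsDualFrame y E) {μ : SmoothForm n M n} (hμ : IsVolumeForm μ) :
    SmoothForm n M n →ₗ[SmoothFunction n M] SmoothFunction n M :=
  frameNormInv hE hμ • ∑ b : Fin n → Fin N, evalForm (E ∘ b) μ • evalForm (E ∘ b)

lemma exists_eq_smul_of_top {μ η : SmoothForm n M n} {p : M} (hμ : μ.1 p ≠ 0) :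
    ∃ c : ℝ, η.1 p = c • μ.1 p := by
  have e : Module.Basis (Fin n) ℝ (TangentSpace (𝓡 n) p) :=
    (EuclideanSpace.basisFun (Fin n) ℝ).toBasis
  have h1 := (μ.1 p).eq_smul_basis_det e
  have h2 := (η.1 p).eq_smul_basis_det e
  have h3 : μ.1 p e ≠ 0 := fun h => hμ (by rw [h1, h, zero_smul])
  refine ⟨η.1 p e / μ.1 p e, ?_⟩
  refine h2.trans (Eq.trans ?_ (congrArg ((η.1 p e / μ.1 p e) • ·) h1.symm))
  rw [smul_smul, div_mul_cancel₀ _ h3]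

/-- At each point η = c μ, so the quotient of ∑ μ(E_b) η(E_b) by ∑ μ(E_b)² is c. Summing over all
frame tuples avoids choosing a basis of the tangent spaces: the denominator vanishes nowhere
although each single μ(E_b) may vanish somewhere. -/
lemma starForm_smul (hE : IsDualFrame y E) {μ : SmoothForm n M n} (hμ : IsVolumeForm μ)
    (η : SmoothForm n M n) : starForm hE hμ η • μ = η := by
  refine Subtype.ext <| funext fun p => ?_
  obtain ⟨c, hc⟩ := exists_eq_smul_of_top (η := η) (hμ p)
  have h1 : starForm hE hμ η p = (frameNorm E μ p)⁻¹ * (c * frameNorm E μ p) := by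
    have : starForm hE hμ η p = (frameNorm E μ p)⁻¹ *
        (∑ b : Fin n → Fin N, evalForm (E ∘ b) μ • evalForm (E ∘ b) η : SmoothFunction n M) p := by
      simp only [starForm, LinearMap.smul_apply, LinearMap.sum_apply]
      rfl
    rw [this]
    congr 1
    rw [frameNorm, smoothFunction_sum_apply, smoothFunction_sum_apply, Finset.mul_sum]
    refine Finset.sum_congr rfl fun b _ => ?_
    change evalForm (E ∘ b) μ p * evalForm (E ∘ b) η p =
      c * (evalForm (E ∘ b) μ p * evalForm (E ∘ b) μ p)
    rw [evalForm_apply (E ∘ b) η, hc, AlternatingMap.smul_apply, ← evalForm_apply (E ∘ b) μ,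
      smul_eq_mul]
    ring
  rw [SmoothForm.coe_smul, h1, hc, mul_comm c, inv_mul_cancel_left₀ (frameNorm_ne_zero hE hμ p)]

lemma smul_volumeForm_injective {μ : SmoothForm n M n} (hμ : IsVolumeForm μ)
    {f g : SmoothFunction n M} (h : f • μ = g • μ) : f = g := by
  ext p
  have h1 : f p • μ.1 p = g p • μ.1 p := congrArg (fun η : SmoothForm n M n => η.1 p) h
  exact smul_left_injective ℝ (hμ p) h1

lemma starForm_self (hE : IsDualFrame y E) {μ : SmoothForm n M n} (hμ : IsVolumeForm μ) :
    starForm hE hμ μ = 1 :=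
  smul_volumeForm_injective hμ (by rw [starForm_smul, one_smul])

section WedgeAlt

variable {V : Type*} [AddCommGroup V] [Module ℝ V] [Module (SmoothFunction n M) V]
  [IsScalarTower ℝ (SmoothFunction n M) V]

/-- The alternating map `f ↦ L(df₁ ∧ ⋯ ∧ df_k)`. -/
def wedgeAlt {k : ℕ} (L : SmoothForm n M k →ₗ[SmoothFunction n M] V) :
    SmoothFunction n M [⋀^Fin k]→ₗ[ℝ] V where
  toFun f := L (wedgeDiff f)
  map_update_add' {inst} f i x z := by
    rw [Subsingleton.elim inst (instDecidableEqFin k), wedgeDiff_update_add, map_add]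
  map_update_smul' {inst} f i c x := by
    rw [Subsingleton.elim inst (instDecidableEqFin k), wedgeDiff_update_smul, map_smul, smul_assoc,
      one_smul]
  map_eq_zero_of_eq' f i j h hij := by
    rw [wedgeDiff_eq_zero f h hij, map_zero]

lemma wedgeAlt_apply {k : ℕ} (L : SmoothForm n M k →ₗ[SmoothFunction n M] V)
    (f : Fin k → SmoothFunction n M) : wedgeAlt L f = L (wedgeDiff f) :=
  rfl

lemma wedgeAlt_mem {k : ℕ} (L : SmoothForm n M k →ₗ[SmoothFunction n M] V) :
    wedgeAlt L ∈ SkewDerivation (SmoothFunction n M) V k := by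
  cases k with
  | zero => exact fun i => i.elim0
  | succ k =>
    refine mem_skewDerivation_of_cons _ fun x z f => ?_
    rw [wedgeAlt_apply, wedgeDiff_cons_mul, map_add, map_smul, map_smul]
    rfl

end WedgeAlt

end VolumeForm

/-! ### Bijectivity of ▲. -/

section Duality

variable {n : ℕ} {M : Type*} [TopologicalSpace M] [ChartedSpace (EuclideanSpace ℝ (Fin n)) M]
  [IsManifold (𝓡 n) ∞ M]
variable {W : Type*} [AddCommGroup W] [Module ℝ W] [Module (SmoothFunction n M) W]
  [IsScalarTower ℝ (SmoothFunction n M) W]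
variable {N : ℕ} {y : Fin N → SmoothFunction n M} {E : Fin N → SmoothVectorField n M}

/-- The map `W ⊗ Ω → W` induced by a linear function on forms. -/
def tensorEval {j : ℕ} (L : SmoothForm n M j →ₗ[SmoothFunction n M] SmoothFunction n M) :
    FormsWithValues (n := n) (M := M) W j →ₗ[SmoothFunction n M] W :=
  TensorProduct.rid (SmoothFunction n M) W ∘ₗ LinearMap.lTensor W L

lemma tensorEval_tmul {j : ℕ} (L : SmoothForm n M j →ₗ[SmoothFunction n M] SmoothFunction n M)
    (w : W) (η : SmoothForm n M j) : tensorEval L (w ⊗ₜ η) = L η • w := by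
  simp [tensorEval]

/-- In full degree ι_X(df₁ ∧ ⋯ ∧ df_k) recovers X(f₁, …, f_k), and for k > n the form on the left is
zero. -/
lemma subsingleton_skewDerivation (hW : ExpandsDerivations W y E) {k : ℕ} (hk : n < k) :
    Subsingleton (SkewDerivation (SmoothFunction n M) W k) := by
  have h0 : ∀ X : SkewDerivation (SmoothFunction n M) W k, X = 0 := fun X => by
    refine Subtype.ext (AlternatingMap.ext fun f => ?_)
    have h1 := iota_wedgeDiff hW k X f
    have := subsingleton_smoothForm (M := M) hk
    rw [Subsingleton.elim (wedgeDiff f) 0, map_zero] at h1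
    have h2 := congrArg (tensorEval (evalForm (n := n) (M := M) (k := 0) Fin.elim0)) h1
    rw [map_zero, tensorEval_tmul] at h2
    have h3 : evalForm (n := n) (M := M) (k := 0) Fin.elim0 (wedgeDiff 0) = 1 := by
      ext p
      rw [evalForm_apply, wedgeDiff_apply, Matrix.det_fin_zero]
      rfl
    rw [h3, one_smul] at h2
    exact h2.symm
  exact ⟨fun X Y => (h0 X).trans (h0 Y).symm⟩

/-- The sign `(-1)^{k(k+1)/2}`. -/
def starSign (k : ℕ) : ℤ := (-1) ^ (k * (k + 1) / 2)

lemma starSign_succ (k : ℕ) : starSign (k + 1) = (-1) ^ (k + 1) * starSign k := by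
  have : (k + 1) * (k + 1 + 1) = k * (k + 1) + (k + 1) * 2 := by ring
  rw [starSign, this, Nat.add_mul_div_right _ _ two_pos, pow_add, mul_comm]
  rfl

lemma starSign_mul_self (k : ℕ) : starSign k * starSign k = 1 := by
  rw [starSign, ← mul_pow]
  simp

variable (W y E) in
/-- The map `X ↦ (-1)^{k(k+1)/2} ι_X μ`, in terms of a dual frame. -/
def starMap (μ : SmoothForm n M n) (k j : ℕ) (h : k + j = n) :
    SkewDerivation (SmoothFunction n M) W k →ₗ[SmoothFunction n M]
      FormsWithValues (n := n) (M := M) W j :=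
  starSign k • (iota W y E k j n h).flip μ

lemma starMap_apply (μ : SmoothForm n M n) (k j : ℕ) (h : k + j = n)
    (X : SkewDerivation (SmoothFunction n M) W k) :
    starMap W y E μ k j h X = starSign k • iota W y E k j n h X μ :=
  rfl

lemma iota_extMul_of_eq (hW : ExpandsDerivations W y E) (k j q : ℕ) (h : k + 1 + j = q)
    (X : SkewDerivation (SmoothFunction n M) W (k + 1)) (g : SmoothFunction n M)
    {η : SmoothForm n M q} (hη : extMul g η = 0) :
    iota W y E k (j + 1) q (by omega) (SkewDerivation.ins g X) η =
      - (-1 : ℤ) ^ (k + 1) • extMulTensor W g j (iota W y E (k + 1) j q h X η) := by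
  have := iota_extMul hW k j q (by omega) X g η
  rw [hη, map_zero] at this
  rw [neg_smul]
  exact eq_neg_of_add_eq_zero_left this.symm

/-- The form dg ∧ μ has degree n + 1 and vanishes, so the antiderivation rule relates ι_{X(g, …)} μ
to dg ∧ ι_X μ. Its degree-dependent sign is absorbed by `starSign_succ`, which is what the exponent
k(k+1)/2 is for. -/
lemma starMap_ins (hW : ExpandsDerivations W y E) (μ : SmoothForm n M n) (k j : ℕ)
    (h : k + 1 + j = n) (h' : k + (j + 1) = n)
    (X : SkewDerivation (SmoothFunction n M) W (k + 1)) (g : SmoothFunction n M) :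
    starMap W y E μ k (j + 1) h' (SkewDerivation.ins g X) =
      - extMulTensor W g j (starMap W y E μ (k + 1) j h X) := by
  have := subsingleton_smoothForm (M := M) (Nat.lt_succ_self n)
  rw [starMap_apply, starMap_apply,
    iota_extMul_of_eq hW k j n h X g (Subsingleton.elim (extMul g μ) 0), starSign_succ,
    map_zsmul, smul_smul, ← neg_smul]
  congr 1
  ring

lemma starSign_smul_injective {V : Type*} [AddCommGroup V] (k : ℕ) {v : V}
    (h : starSign k • v = 0) : v = 0 := by
  rw [← one_smul ℤ v, ← starSign_mul_self k, mul_smul, h, smul_zero]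

/-- If ▲X = 0, then ▲(X(g, …)) = -dg ∧ ▲X = 0 for every g, so all insertions of X vanish by
induction. In degree 0, an equation w ⊗ μ = 0 is divided by μ. -/
lemma starMap_injective (hE : IsDualFrame y E) (hW : ExpandsDerivations W y E)
    {μ : SmoothForm n M n} (hμ : IsVolumeForm μ) (k j : ℕ) (h : k + j = n) :
    Function.Injective (starMap W y E μ k j h) := by
  rw [injective_iff_map_eq_zero]
  induction k generalizing j with
  | zero =>
    intro X hX
    obtain rfl : j = n := by omega
    have h1 := starSign_smul_injective 0 hX
    have h2 := congrArg (tensorEval (starForm hE hμ)) ((iota_zero j X μ).symm.trans h1)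
    rw [tensorEval_tmul, starForm_self, one_smul] at h2
    refine Subtype.ext (AlternatingMap.ext fun v => ?_)
    rw [Subsingleton.elim v 0]
    exact h2.trans (LinearMap.map_zero _)
  | succ k ih =>
    intro X hX
    refine SkewDerivation.ext_ins fun g => ?_
    rw [ih (j + 1) (by omega) (SkewDerivation.ins g X) (by
      rw [starMap_ins hW μ k j h, hX, map_zero, neg_zero]), map_zero]

/-- The `n`-vector `f ↦ (df₁ ∧ ⋯ ∧ df_n / μ) w`. -/
def topSkewDerivation (hE : IsDualFrame y E) {μ : SmoothForm n M n} (hμ : IsVolumeForm μ) (w : W) :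
    SkewDerivation (SmoothFunction n M) W n :=
  ⟨wedgeAlt ((starForm hE hμ).smulRight w), wedgeAlt_mem _⟩

/-- Contraction with this element is division by μ followed by tensoring with w; both sides are
compared on products of exact forms, which span. -/
lemma iota_topSkewDerivation (hE : IsDualFrame y E) (hW : ExpandsDerivations W y E)
    {μ : SmoothForm n M n} (hμ : IsVolumeForm μ) (w : W) :
    iota W y E n 0 n (add_zero n) (topSkewDerivation hE hμ w) μ =
      w ⊗ₜ wedgeDiff (k := 0) 0 := by
  have : iota W y E n 0 n (add_zero n) (topSkewDerivation hE hμ w) =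
      (starForm hE hμ).smulRight (w ⊗ₜ wedgeDiff (k := 0) 0) := by
    refine LinearMap.ext_on_range (hE.span_wedgeDiff n) fun f => ?_
    rw [iota_wedgeDiff hW, LinearMap.smulRight_apply, TensorProduct.smul_tmul']
    rfl
  rw [this, LinearMap.smulRight_apply, starForm_self, one_smul]

/-- Start from the top degree, where w ⊗ 1 is reached, and create each further factor df by
inserting f, using `starMap_ins`. -/
lemma exists_starMap_eq (hE : IsDualFrame y E) (hW : ExpandsDerivations W y E)
    {μ : SmoothForm n M n} (hμ : IsVolumeForm μ) (j k : ℕ) (h : k + j = n) (w : W)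
    (f : Fin j → SmoothFunction n M) :
    ∃ X, starMap W y E μ k j h X = w ⊗ₜ wedgeDiff f := by
  induction j generalizing k with
  | zero =>
    obtain rfl : k = n := by omega
    refine ⟨starSign k • topSkewDerivation hE hμ w, ?_⟩
    rw [map_zsmul, starMap_apply, iota_topSkewDerivation hE hW, smul_smul, starSign_mul_self,
      one_smul, Subsingleton.elim f 0]
  | succ j ih =>
    obtain ⟨X, hX⟩ := ih (k + 1) (by omega) (Fin.tail f)
    refine ⟨- SkewDerivation.ins (f 0) X, ?_⟩
    rw [map_neg, starMap_ins hW μ k j (by omega), hX, neg_neg, extMulTensor,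
      LinearMap.lTensor_tmul, extMul_wedgeDiff, Fin.cons_self_tail]

/-- Stated for additive subgroups because it is also applied to the locus where two ℝ-linear
boundaries agree, which is not visibly a C-submodule. Coefficients of forms are moved into w. -/
lemma IsDualFrame.tensor_induction (hE : IsDualFrame y E) {j : ℕ}
    (S : AddSubgroup (FormsWithValues (n := n) (M := M) W j))
    (h : ∀ (w : W) (f : Fin j → SmoothFunction n M), w ⊗ₜ wedgeDiff f ∈ S)
    (x : FormsWithValues (n := n) (M := M) W j) : x ∈ S := by
  induction x using TensorProduct.induction_on with
  | zero => exact zero_mem S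
  | add x z hx hz => exact add_mem hx hz
  | tmul w η =>
    have hη : η ∈ Submodule.span (SmoothFunction n M)
      (Set.range (wedgeDiff (n := n) (M := M) (k := j))) := hE.span_wedgeDiff j ▸ Submodule.mem_top
    induction hη using Submodule.span_induction generalizing w with
    | mem η h1 =>
      obtain ⟨f, rfl⟩ := h1
      exact h w f
    | zero => rw [TensorProduct.tmul_zero]; exact zero_mem S
    | add a b _ _ ha hb => rw [TensorProduct.tmul_add]; exact add_mem (ha w) (hb w)
    | smul c a _ ha => rw [← TensorProduct.smul_tmul]; exact ha (c • w)

lemma starMap_bijective (hE : IsDualFrame y E) (hW : ExpandsDerivations W y E)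
    {μ : SmoothForm n M n} (hμ : IsVolumeForm μ) (k j : ℕ) (h : k + j = n) :
    Function.Bijective (starMap W y E μ k j h) := by
  refine ⟨starMap_injective hE hW hμ k j h, fun x => ?_⟩
  exact hE.tensor_induction (LinearMap.range (starMap W y E μ k j h)).toAddSubgroup
    (fun w f => exists_starMap_eq hE hW hμ j k h w f) x

end Duality

/-! ### Lie derivatives on 𝔛ᵏ(W). -/

section LieDerivative

variable {C : Type*} [CommRing C] [Algebra ℝ C]
variable {W : Type*} [AddCommGroup W] [Module ℝ W] [Module C W] [IsScalarTower ℝ C W]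
variable {br : C →ₗ[ℝ] C →ₗ[ℝ] C} {b : W →ₗ[ℝ] C →ₗ[ℝ] W}

/-- The Lie derivative along `g` on `𝔛ᵏ(W)`. -/
def lieDer (h : IsPoissonBracket br) (hb : IsPoissonModule br b) (g : C) :
    ∀ {k : ℕ}, SkewDerivation C W k → SkewDerivation C W k
  | 0, X => - SkewDerivation.ins g (coboundary h hb 0 X)
  | k + 1, X => - SkewDerivation.ins g (coboundary h hb (k + 1) X) -
      coboundary h hb k (SkewDerivation.ins g X)

/-- Defining the Lie derivative through Cartan's formula makes it a derivation in each argument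
without further work; this lemma recovers the explicit expression. -/
lemma coe_lieDer (h : IsPoissonBracket br) (hb : IsPoissonModule br b) (g : C) {k : ℕ}
    (X : SkewDerivation C W k) : (lieDer h hb g X).1 = lieAlt (br.flip g) (b.flip g) X.1 := by
  cases k with
  | zero =>
    change - (coboundaryAlt br b X.1).curryLeft g = _
    rw [curryLeft_coboundaryAlt_zero h.self_eq_zero, neg_neg]
  | succ k =>
    change - (coboundaryAlt br b X.1).curryLeft g - coboundaryAlt br b (X.1.curryLeft g) = _
    rw [curryLeft_coboundaryAlt h.self_eq_zero]
    abel

lemma ins_lieDer (h : IsPoissonBracket br) (hb : IsPoissonModule br b) (g c : C) {k : ℕ}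
    (X : SkewDerivation C W (k + 1)) :
    SkewDerivation.ins c (lieDer h hb g X) =
      lieDer h hb g (SkewDerivation.ins c X) - SkewDerivation.ins (br c g) X := by
  refine Subtype.ext ?_
  rw [SkewDerivation.coe_ins, coe_lieDer, curryLeft_lieAlt]
  change _ = (lieDer h hb g (SkewDerivation.ins c X)).1 - X.1.curryLeft (br c g)
  rw [coe_lieDer]
  rfl

lemma lieDer_neg (h : IsPoissonBracket br) (hb : IsPoissonModule br b) (g : C) {k : ℕ}
    (X : SkewDerivation C W k) : lieDer h hb g (-X) = - lieDer h hb g X := by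
  refine Subtype.ext ?_
  change _ = - (lieDer h hb g X).1
  rw [coe_lieDer, coe_lieDer, ← lieAlt_neg]
  rfl

lemma coboundary_ins (h : IsPoissonBracket br) (hb : IsPoissonModule br b) (g : C) {k : ℕ}
    (X : SkewDerivation C W (k + 1)) :
    coboundary h hb k (SkewDerivation.ins g X) =
      - lieDer h hb g X - SkewDerivation.ins g (coboundary h hb (k + 1) X) := by
  rw [lieDer]
  abel

end LieDerivative

/-! ### Lie derivative and boundary of decomposable forms. -/

section Boundary

variable {n : ℕ} {M : Type*} [TopologicalSpace M] [ChartedSpace (EuclideanSpace ℝ (Fin n)) M]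
  [IsManifold (𝓡 n) ∞ M]
variable {W : Type*} [AddCommGroup W] [Module ℝ W] [Module (SmoothFunction n M) W]
  [IsScalarTower ℝ (SmoothFunction n M) W]
variable {N : ℕ} {y : Fin N → SmoothFunction n M} {E : Fin N → SmoothVectorField n M}

/-- The `W ⊗ Ω`-valued alternating map `f ↦ w ⊗ df₁ ∧ ⋯ ∧ df_j`. -/
def tensorWedge (w : W) (j : ℕ) :
    SmoothFunction n M [⋀^Fin j]→ₗ[ℝ] FormsWithValues (n := n) (M := M) W j :=
  wedgeAlt (TensorProduct.mk (SmoothFunction n M) W (SmoothForm n M j) w)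

lemma tensorWedge_apply (w : W) {j : ℕ} (f : Fin j → SmoothFunction n M) :
    tensorWedge w j f = w ⊗ₜ wedgeDiff f :=
  rfl

lemma extMulTensor_tmul (g : SmoothFunction n M) {j : ℕ} (w : W) (f : Fin j → SmoothFunction n M) :
    extMulTensor W g j (w ⊗ₜ wedgeDiff f) = w ⊗ₜ wedgeDiff (Fin.cons g f) := by
  rw [extMulTensor, LinearMap.lTensor_tmul, extMul_wedgeDiff]

variable (br : SmoothFunction n M →ₗ[ℝ] SmoothFunction n M →ₗ[ℝ] SmoothFunction n M)
  (b : W →ₗ[ℝ] SmoothFunction n M →ₗ[ℝ] W)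

/-- The Lie derivative of `w ⊗ df₁ ∧ ⋯ ∧ df_j` along `g`. -/
def lieForm (g : SmoothFunction n M) (w : W) {j : ℕ} (f : Fin j → SmoothFunction n M) :
    FormsWithValues (n := n) (M := M) W j :=
  b w g ⊗ₜ wedgeDiff f + ∑ i, w ⊗ₜ wedgeDiff (Function.update f i (br.flip g (f i)))

/-- The Poisson boundary of `w ⊗ df₁ ∧ ⋯ ∧ df_{r+1}`. -/
def boundaryFormula (w : W) {r : ℕ} (f : Fin (r + 1) → SmoothFunction n M) :
    FormsWithValues (n := n) (M := M) W r :=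
  ∑ i, (-1 : ℤ) ^ i.val • (b w (f i) ⊗ₜ wedgeDiff (i.removeNth f)) +
    bracketSum br (fun g => w ⊗ₜ wedgeDiff g) f

variable {br b}

lemma lieForm_cons (g c : SmoothFunction n M) (w : W) {j : ℕ} (f : Fin j → SmoothFunction n M) :
    lieForm br b g w (Fin.cons c f : Fin (j + 1) → SmoothFunction n M) =
      extMulTensor W c j (lieForm br b g w f) + w ⊗ₜ wedgeDiff (Fin.cons (br c g) f) := by
  rw [lieForm, Fin.sum_univ_succ, Fin.cons_zero, Fin.update_cons_zero, LinearMap.flip_apply,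
    lieForm, LinearMap.map_add, extMulTensor_tmul, extMulTensor_sum, add_assoc,
    add_comm (w ⊗ₜ wedgeDiff (Fin.cons (br c g) f))]
  congr 2
  refine Finset.sum_congr rfl fun i _ => ?_
  rw [extMulTensor_tmul, ← Fin.cons_update]
  rfl

lemma boundaryFormula_one (g : SmoothFunction n M) (w : W) (f : Fin 0 → SmoothFunction n M) :
    boundaryFormula br b w (Fin.cons g f : Fin 1 → SmoothFunction n M) = lieForm br b g w f := by
  rw [boundaryFormula, lieForm, bracketSum]
  simp

lemma bracketSum_extMulTensor (g : SmoothFunction n M) {r j : ℕ}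
    (F : (Fin r → SmoothFunction n M) → FormsWithValues (n := n) (M := M) W j)
    (f : Fin (r + 1) → SmoothFunction n M) :
    bracketSum br (fun t => extMulTensor W g j (F t)) f =
      extMulTensor W g j (bracketSum br F f) := by
  cases r with
  | zero => exact (LinearMap.map_zero _).symm
  | succ r =>
    simp only [bracketSum, extMulTensor_sum, LinearMap.map_smul_of_tower]

lemma bracketSum_tensor_cons (h : ∀ a, br a a = 0) (g : SmoothFunction n M) (w : W) {r : ℕ}
    (f : Fin (r + 1) → SmoothFunction n M) :
    bracketSum br (fun t => w ⊗ₜ[SmoothFunction n M] wedgeDiff t)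
        (Fin.cons g f : Fin (r + 2) → SmoothFunction n M) =
      ∑ i, w ⊗ₜ[SmoothFunction n M] wedgeDiff (Function.update f i (br.flip g (f i))) -
        extMulTensor W g r (bracketSum br (fun t => w ⊗ₜ wedgeDiff t) f) := by
  have e2 := sum_update_flip h (tensorWedge w (r + 1)) g f
  simp only [tensorWedge_apply] at e2
  rw [e2]
  cases r with
  | zero =>
    rw [bracketSum_one, bracketSum, LinearMap.map_zero, sub_zero]
  | succ r =>
    rw [← bracketSum_extMulTensor]
    refine bracketSum_cons _ _ g (fun c t => ?_) f
    rw [extMulTensor_tmul]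
    exact map_cons_cons_swap (tensorWedge w (r + 2)) c g t

/-- The homological Cartan formula ∂(dg ∧ ω) = L_g ω - dg ∧ ∂ω. It is a statement about tuples of
functions, since the boundary is not yet known to be well defined on forms. -/
lemma boundaryFormula_cons (h : ∀ a, br a a = 0) (g : SmoothFunction n M) (w : W) {r : ℕ}
    (f : Fin (r + 1) → SmoothFunction n M) :
    boundaryFormula br b w (Fin.cons g f : Fin (r + 2) → SmoothFunction n M) =
      lieForm br b g w f - extMulTensor W g r (boundaryFormula br b w f) := by
  have e1 : ∑ i : Fin (r + 2), (-1 : ℤ) ^ i.val •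
        (b w ((Fin.cons g f : Fin (r + 2) → SmoothFunction n M) i) ⊗ₜ[SmoothFunction n M]
          wedgeDiff (i.removeNth (Fin.cons g f : Fin (r + 2) → SmoothFunction n M))) =
      b w g ⊗ₜ wedgeDiff f - extMulTensor W g r
        (∑ i, (-1 : ℤ) ^ i.val • (b w (f i) ⊗ₜ wedgeDiff (i.removeNth f))) := by
    rw [Fin.sum_univ_succ, extMulTensor_sum, sub_eq_add_neg, ← Finset.sum_neg_distrib]
    congr 1
    · rw [Fin.val_zero, pow_zero, one_smul, removeNth_zero_cons, Fin.cons_zero]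
    · refine Finset.sum_congr rfl fun i _ => ?_
      rw [removeNth_succ_cons, extMulTensor_zsmul_tmul, Fin.cons_succ, Fin.val_succ, pow_succ,
        mul_neg_one, neg_smul]
  rw [boundaryFormula, e1, bracketSum_tensor_cons h, boundaryFormula, lieForm, LinearMap.map_add]
  abel

end Boundary

/-! ### Compatibility of ▲ with Lie derivatives and differentials. -/

section ModularDuality

variable {n : ℕ} {M : Type*} [TopologicalSpace M] [ChartedSpace (EuclideanSpace ℝ (Fin n)) M]
  [IsManifold (𝓡 n) ∞ M]
variable {W : Type*} [AddCommGroup W] [Module ℝ W] [Module (SmoothFunction n M) W]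
  [IsScalarTower ℝ (SmoothFunction n M) W]
variable {N : ℕ} {y : Fin N → SmoothFunction n M} {E : Fin N → SmoothVectorField n M}

lemma twist_neg_apply (b : W →ₗ[ℝ] SmoothFunction n M →ₗ[ℝ] W) (φ : SmoothVectorField n M) (w : W)
    (f : SmoothFunction n M) : twist b (-φ) w f = b w f - derivAlong φ f • w := by
  have : derivAlong (-φ) f = - derivAlong φ f := by
    ext p
    exact map_neg (diffAt f p) (φ p)
  change b w f + derivAlong (-φ) f • w = _
  rw [this, neg_smul, sub_eq_add_neg]

/-- The divergence form of the modularity condition: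
`{(df₁ ∧ ⋯ ∧ df_n)/μ, g} = ∑ᵢ (df₁ ∧ ⋯ ∧ d{fᵢ, g} ∧ ⋯ ∧ df_n)/μ - φ(g) (df₁ ∧ ⋯ ∧ df_n)/μ`. -/
def IsModularDerivation (hE : IsDualFrame y E) {μ : SmoothForm n M n} (hμ : IsVolumeForm μ)
    (br : SmoothFunction n M →ₗ[ℝ] SmoothFunction n M →ₗ[ℝ] SmoothFunction n M)
    (φ : SmoothVectorField n M) : Prop :=
  ∀ (f : Fin n → SmoothFunction n M) (g : SmoothFunction n M),
    br (starForm hE hμ (wedgeDiff f)) g =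
      ∑ i, starForm hE hμ (wedgeDiff (Function.update f i (br (f i) g))) -
        derivAlong φ g * starForm hE hμ (wedgeDiff f)

variable {br : SmoothFunction n M →ₗ[ℝ] SmoothFunction n M →ₗ[ℝ] SmoothFunction n M}
  {b : W →ₗ[ℝ] SmoothFunction n M →ₗ[ℝ] W}

lemma tmul_volumeForm (hE : IsDualFrame y E) {μ : SmoothForm n M n} (hμ : IsVolumeForm μ) (w : W)
    (η : SmoothForm n M n) : w ⊗ₜ[SmoothFunction n M] η = (starForm hE hμ η • w) ⊗ₜ μ := by
  rw [TensorProduct.smul_tmul, starForm_smul]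

variable (hE : IsDualFrame y E) (hW : ExpandsDerivations W y E) {μ : SmoothForm n M n}
  (hμ : IsVolumeForm μ) (h : IsPoissonBracket br) (hb : IsPoissonModule br b)
  {φ : SmoothVectorField n M} (hφ : IsModularDerivation hE hμ br φ)

include hE hW hμ hφ

/-- Induction on k. Degree 0 is the modular condition. In higher degree both sides are compared
after inserting an arbitrary c, which corresponds to multiplication by -dc ∧ on forms and obeys the
same commutation rule with L_g on both sides. -/
lemma starMap_lieDer (g : SmoothFunction n M) (k j : ℕ) (hk : k + j = n) (w : W)
    (f : Fin j → SmoothFunction n M) (X : SkewDerivation (SmoothFunction n M) W k)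
    (hX : starMap W y E μ k j hk X = w ⊗ₜ wedgeDiff f) :
    starMap W y E μ k j hk (lieDer h hb g X) = lieForm br (twist b (-φ)) g w f := by
  induction k generalizing j with
  | zero =>
    obtain rfl : j = n := by omega
    have e : ∀ Y : SkewDerivation (SmoothFunction j M) W 0,
        starMap W y E μ 0 j hk Y = Y.1 0 ⊗ₜ μ := fun Y => by
      rw [starMap_apply]
      exact (one_smul ℤ _).trans (iota_zero j Y μ)
    have h0 : X.1 0 = starForm hE hμ (wedgeDiff f) • w := by
      have := congrArg (tensorEval (starForm hE hμ)) ((e X).symm.trans hX)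
      rwa [tensorEval_tmul, tensorEval_tmul, starForm_self, one_smul] at this
    rw [e, coe_lieDer, lieAlt_apply, h0, lieForm,
      tmul_volumeForm hE hμ (twist b (-φ) w g) (wedgeDiff f)]
    have e2 : ∀ i, w ⊗ₜ[SmoothFunction j M] wedgeDiff (Function.update f i (br.flip g (f i))) =
        (starForm hE hμ (wedgeDiff (Function.update f i (br (f i) g))) • w) ⊗ₜ μ := fun i =>
      tmul_volumeForm hE hμ _ _
    simp only [e2]
    rw [← TensorProduct.sum_tmul, ← TensorProduct.add_tmul, ← Finset.sum_smul]
    congr 1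
    -- Leibniz rule for {(df₁ ∧ ⋯ ∧ df_n / μ) w, g}. The term -φ(g) from modularity is what turns
    -- {w, g}_W into the bracket of W_{-φ}.
    rw [LinearMap.flip_apply, hb.smul_left, hφ f g, twist_neg_apply, sub_smul, smul_sub, mul_smul,
      smul_comm (derivAlong φ g)]
    simp only [Finset.univ_eq_empty, Finset.sum_empty]
    abel
  | succ k ih =>
    -- Writing the target form as ▲Z reduces the claim to an identity of skew derivations, which
    -- insertions can test.
    obtain ⟨Z, hZ⟩ := (starMap_bijective hE hW hμ (k + 1) j hk).2 (lieForm br (twist b (-φ)) g w f)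
    rw [← hZ]
    congr 1
    refine SkewDerivation.ext_ins fun c => starMap_injective hE hW hμ k (j + 1) (by omega) ?_
    have e1 : starMap W y E μ k (j + 1) (by omega) (- SkewDerivation.ins c X) =
        w ⊗ₜ wedgeDiff (Fin.cons c f) := by
      rw [map_neg, starMap_ins hW μ k j hk, hX, neg_neg, extMulTensor_tmul]
    have e2 := ih (j + 1) (by omega) (Fin.cons c f) _ e1
    have e3 : starMap W y E μ k (j + 1) (by omega)
        (- SkewDerivation.ins (br c g) X) = w ⊗ₜ wedgeDiff (Fin.cons (br c g) f) := by
      rw [map_neg, starMap_ins hW μ k j hk, hX, neg_neg, extMulTensor_tmul]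
    rw [lieDer_neg, map_neg] at e2
    rw [map_neg] at e3
    rw [ins_lieDer, starMap_ins hW μ k j hk, hZ, map_sub, sub_eq_add_neg, e3,
      ← neg_neg (starMap W y E μ k (j + 1) _ (lieDer h hb g (SkewDerivation.ins c X))), e2,
      lieForm_cons]
    abel

/-- With f = (g, f') and ▲X' = w ⊗ df', one has X = -X'(g, …), hence δX = L_g X' + i_g δX'. Applying
▲ gives L_g(w ⊗ df') - dg ∧ ▲δX', which is the recursion of `boundaryFormula_cons`. -/
lemma starMap_coboundary (r k : ℕ) (hk : k + (r + 1) = n) (hk' : k + 1 + r = n) (w : W)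
    (f : Fin (r + 1) → SmoothFunction n M) (X : SkewDerivation (SmoothFunction n M) W k)
    (hX : starMap W y E μ k (r + 1) hk X = w ⊗ₜ wedgeDiff f) :
    starMap W y E μ (k + 1) r hk' (coboundary h hb k X) =
      boundaryFormula br (twist b (-φ)) w f := by
  induction r generalizing k with
  | zero =>
    obtain ⟨g, f, rfl⟩ : ∃ (g : SmoothFunction n M) (f' : Fin 0 → SmoothFunction n M),
      f = Fin.cons g f' := ⟨f 0, Fin.tail f, (Fin.cons_self_tail f).symm⟩
    obtain ⟨X', hX'⟩ := exists_starMap_eq hE hW hμ 0 (k + 1) hk' w f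
    obtain rfl : X = - SkewDerivation.ins g X' := by
      refine starMap_injective hE hW hμ k 1 hk ?_
      rw [hX, map_neg, starMap_ins hW μ k 0 hk', hX', neg_neg, extMulTensor_tmul]
    -- Here k + 1 = n, so δX' lies in degree n + 1 and vanishes.
    have := subsingleton_skewDerivation hW (k := k + 2) (by omega)
    rw [map_neg, coboundary_ins, Subsingleton.elim (coboundary h hb (k + 1) X') 0, map_zero,
      sub_zero, neg_neg, starMap_lieDer hE hW hμ h hb hφ g _ _ hk' w f X' hX', boundaryFormula_one]
  | succ r ih =>
    obtain ⟨g, f, rfl⟩ : ∃ (g : SmoothFunction n M) (f' : Fin (r + 1) → SmoothFunction n M),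
      f = Fin.cons g f' := ⟨f 0, Fin.tail f, (Fin.cons_self_tail f).symm⟩
    obtain ⟨X', hX'⟩ := exists_starMap_eq hE hW hμ (r + 1) (k + 1) hk' w f
    obtain rfl : X = - SkewDerivation.ins g X' := by
      refine starMap_injective hE hW hμ k _ hk ?_
      rw [hX, map_neg, starMap_ins hW μ k _ hk', hX', neg_neg, extMulTensor_tmul]
    have e := ih (k + 1) (by omega) (by omega) f X' hX'
    rw [map_neg, coboundary_ins, neg_sub, sub_neg_eq_add, map_add,
      starMap_lieDer hE hW hμ h hb hφ g _ _ hk' w f X' hX',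
      starMap_ins hW μ (k + 1) r (by omega), e, boundaryFormula_cons h.self_eq_zero]
    abel

include h hb in
-- Needed for ∂ to exist on Ω^{n+1} = 0: the formula must vanish on every tuple. It does because L_g
-- X = -i_g δX in degree 0, so that L_g(w ⊗ df) equals dg ∧ ∂(w ⊗ df).
lemma boundaryFormula_eq_zero (w : W) (r : ℕ) (hr : r = n) (f : Fin (r + 1) → SmoothFunction n M) :
    boundaryFormula br (twist b (-φ)) w f = 0 := by
  obtain ⟨g, f, rfl⟩ : ∃ (g : SmoothFunction n M) (f' : Fin r → SmoothFunction n M),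
    f = Fin.cons g f' := ⟨f 0, Fin.tail f, (Fin.cons_self_tail f).symm⟩
  obtain ⟨X, hX⟩ := exists_starMap_eq hE hW hμ r 0 (by omega) w f
  have hL := starMap_lieDer hE hW hμ h hb hφ g _ _ _ w f X hX
  rw [lieDer, map_neg] at hL
  rcases r with _ | r
  · have := subsingleton_skewDerivation hW (k := 1) (by omega)
    rw [boundaryFormula_one, ← hL, Subsingleton.elim (coboundary h hb 0 X) 0, map_zero, map_zero,
      neg_zero]
  · rw [boundaryFormula_cons h.self_eq_zero, ← hL,
      ← starMap_coboundary hE hW hμ h hb hφ r 0 (by omega) (by omega) w f X hX,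
      starMap_ins hW μ 0 r (by omega), neg_neg, sub_self]

end ModularDuality

/-! ### The twisted module, and the boundary as a transport of δ. -/

section PoissonDuality

variable {n : ℕ} {M : Type*} [TopologicalSpace M] [ChartedSpace (EuclideanSpace ℝ (Fin n)) M]
  [IsManifold (𝓡 n) ∞ M]
variable {W : Type*} [AddCommGroup W] [Module ℝ W] [Module (SmoothFunction n M) W]
  [IsScalarTower ℝ (SmoothFunction n M) W]
variable {N : ℕ} {y : Fin N → SmoothFunction n M} {E : Fin N → SmoothVectorField n M}
variable {br : SmoothFunction n M →ₗ[ℝ] SmoothFunction n M →ₗ[ℝ] SmoothFunction n M}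
  {b : W →ₗ[ℝ] SmoothFunction n M →ₗ[ℝ] W} {μ : SmoothForm n M n} {φ : SmoothVectorField n M}

lemma eq_zero_of_mul_starForm (hE : IsDualFrame y E) (hμ : IsVolumeForm μ) {c : SmoothFunction n M}
    (hc : ∀ f : Fin n → SmoothFunction n M, c * starForm hE hμ (wedgeDiff f) = 0) : c = 0 := by
  have h : c • starForm hE hμ = 0 := LinearMap.ext_on_range (hE.span_wedgeDiff n) hc
  have h1 : c * starForm hE hμ μ = 0 := congrArg (fun L => L μ) h
  rwa [starForm_self, mul_one] at h1

/-- φ is a Poisson vector field. On the n-vector field dual to μ, L_g is multiplication by -φ(g);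
comparing the commutator of L_c and L_d with L_{{d, c}} there gives the identity. -/
lemma IsModularDerivation.derivAlong_bracket {hE : IsDualFrame y E} {hμ : IsVolumeForm μ}
    (h : IsPoissonBracket br) (hφ : IsModularDerivation hE hμ br φ) (c d : SmoothFunction n M) :
    derivAlong φ (br d c) = br (derivAlong φ d) c - br (derivAlong φ c) d := by
  have hL : ∀ (g : SmoothFunction n M) (f : Fin n → SmoothFunction n M),
      lieAlt (br.flip g) (br.flip g) (wedgeAlt (starForm hE hμ)) f =
        - (derivAlong φ g * starForm hE hμ (wedgeDiff f)) := fun g f => by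
    rw [lieAlt_apply]
    refine sub_eq_iff_eq_add.2 ((hφ f g).trans ?_)
    rw [sub_eq_add_neg, add_comm]
    rfl
  have hLL : ∀ (g g' : SmoothFunction n M) (f : Fin n → SmoothFunction n M),
      lieAlt (br.flip g) (br.flip g)
        (lieAlt (br.flip g') (br.flip g') (wedgeAlt (starForm hE hμ))) f =
      (derivAlong φ g' * derivAlong φ g - br (derivAlong φ g') g) *
        starForm hE hμ (wedgeDiff f) := fun g g' f => by
    have h1 := hφ f g
    rw [lieAlt_apply, hL, LinearMap.flip_apply, map_neg, LinearMap.neg_apply, h.leibniz, h1]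
    simp only [hL, LinearMap.flip_apply, Finset.sum_neg_distrib, ← Finset.mul_sum]
    ring
  refine eq_of_sub_eq_zero (eq_zero_of_mul_starForm hE hμ fun f => ?_)
  have h2 := congrArg (fun L => L f) (lieAlt_commutator (br.flip c) (br.flip d) (br.flip c)
    (br.flip d) (wedgeAlt (starForm hE hμ)))
  simp only [AlternatingMap.sub_apply, hLL, h.flip_commutator, hL] at h2
  linear_combination h2

lemma IsModularDerivation.isPoissonModule_twist {hE : IsDualFrame y E} {hμ : IsVolumeForm μ}
    (h : IsPoissonBracket br) (hb : IsPoissonModule br b) (hφ : IsModularDerivation hE hμ br φ) :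
    IsPoissonModule br (twist b (-φ)) where
  lie w x z := by
    simp only [twist_neg_apply, hφ.derivAlong_bracket h, hb.lie, map_sub, LinearMap.sub_apply,
      hb.smul_left, sub_smul, smul_smul, mul_comm (derivAlong φ x)]
    abel
  smul_left w x z := by
    simp only [twist_neg_apply, hb.smul_left, smul_sub, smul_comm x]
    abel
  mul_right w x z := by
    have : derivAlong φ (x * z) = x * derivAlong φ z + z * derivAlong φ x := by
      ext p
      change diffAt (x * z : SmoothFunction n M) p (φ p) =
        x p * diffAt z p (φ p) + z p * diffAt x p (φ p)
      rw [diffAt_mul]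
      rfl
    simp only [twist_neg_apply, hb.mul_right, smul_sub, this, add_smul, mul_smul]
    abel

lemma signedStar_eq_starMap (hE : IsDualFrame y E) (hW : ExpandsDerivations W y E)
    (μ : SmoothForm n M n) {k j : ℕ} (h : k + j = n)
    (X : SkewDerivation (SmoothFunction n M) W k) :
    signedStar μ h X = starMap W y E μ k j h X := by
  rw [signedStar, interiorProduct_eq_iota hE hW]
  rfl

variable {π : PoissonStructure n M}

set_option synthInstance.maxHeartbeats 200000 in
-- The coefficient f₀ can be moved across the tensor product into w, so f₀ = 1 suffices.
lemma isPoissonBoundary_iff {r : ℕ} (D : FormsWithValues (n := n) (M := M) W (r + 1) →ₗ[ℝ]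
      FormsWithValues (n := n) (M := M) W r) :
    IsPoissonBoundary π b D ↔
      ∀ w f, D (w ⊗ₜ wedgeDiff f) = boundaryFormula π.bracket b w f := by
  have e : ∀ (w : W) (f₀ : SmoothFunction n M) (j : ℕ) (f : Fin j → SmoothFunction n M),
      w ⊗ₜ[SmoothFunction n M] (f₀ • wedgeDiff f) = (f₀ • w) ⊗ₜ wedgeDiff f := fun w f₀ j f =>
    (TensorProduct.smul_tmul f₀ w _).symm
  constructor
  · intro h w f
    have := h w 1 f
    simp only [one_smul] at this
    exact this
  · intro h w f₀ f
    simp only [e]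
    exact h (f₀ • w) f

lemma IsPoissonBoundary.unique (hE : IsDualFrame y E) {r : ℕ}
    {D D' : FormsWithValues (n := n) (M := M) W (r + 1) →ₗ[ℝ]
      FormsWithValues (n := n) (M := M) W r}
    (hD : IsPoissonBoundary π b D) (hD' : IsPoissonBoundary π b D') : D = D' := by
  refine LinearMap.ext fun x => ?_
  refine hE.tensor_induction (D.toAddMonoidHom.eqLocus D'.toAddMonoidHom) (fun w f => ?_) x
  exact ((isPoissonBoundary_iff D).1 hD w f).trans ((isPoissonBoundary_iff D').1 hD' w f).symm

variable (hE : IsDualFrame y E) (hW : ExpandsDerivations W y E) (hμ : IsVolumeForm μ)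

/-- `▲ᵏ` as an isomorphism. -/
def starEquiv (k j : ℕ) (h : k + j = n) :
    SkewDerivation (SmoothFunction n M) W k ≃ₗ[SmoothFunction n M]
      FormsWithValues (n := n) (M := M) W j :=
  LinearEquiv.ofBijective (starMap W y E μ k j h) (starMap_bijective hE hW hμ k j h)

lemma subsingleton_formsWithValues {j : ℕ} (hj : n < j) :
    Subsingleton (FormsWithValues (n := n) (M := M) W j) := by
  have := subsingleton_smoothForm (M := M) hj
  infer_instance

variable (hb : IsPoissonModule π.bracket b) (hφ : IsModularDerivation hE hμ π.bracket φ)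

include hE hW hμ hb hφ

/-- For r < n the map ▲ δ ▲⁻¹ satisfies the formula. For r > n the target is zero, and for r = n the
source is zero and the formula vanishes by `boundaryFormula_eq_zero`. -/
lemma exists_isPoissonBoundary (r : ℕ) : ∃ D, IsPoissonBoundary (r := r) π (twist b (-φ)) D := by
  rcases lt_or_ge r n with hr | hr
  · obtain ⟨k, hk⟩ : ∃ k, k + (r + 1) = n := ⟨n - (r + 1), by omega⟩
    have hk' : k + 1 + r = n := by omega
    refine ⟨(starMap W y E μ (k + 1) r hk').restrictScalars ℝ ∘ₗ
      coboundary π.isPoissonBracket hb k ∘ₗ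
        ((starEquiv hE hW hμ k (r + 1) hk).symm : _ →ₗ[SmoothFunction n M] _).restrictScalars ℝ,
      (isPoissonBoundary_iff _).2 fun w f => ?_⟩
    refine starMap_coboundary hE hW hμ π.isPoissonBracket hb hφ r k hk hk' w f _ ?_
    exact (starEquiv hE hW hμ k (r + 1) hk).apply_symm_apply _
  · refine ⟨0, (isPoissonBoundary_iff _).2 fun w f => ?_⟩
    rcases hr.lt_or_eq with hr | hr
    · have := subsingleton_formsWithValues (M := M) (W := W) hr
      exact Subsingleton.elim _ _
    · exact (boundaryFormula_eq_zero hE hW hμ π.isPoissonBracket hb hφ w r hr.symm f).symm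

lemma isPoissonBoundary_poissonBoundary (r : ℕ) :
    IsPoissonBoundary π (twist b (-φ)) (poissonBoundary π (twist b (-φ)) r) :=
  Classical.epsilon_spec (p := IsPoissonBoundary (r := r) π (twist b (-φ)))
    (exists_isPoissonBoundary hE hW hμ hb hφ r)

lemma poissonBoundary_starMap (k j : ℕ) (h : k + (j + 1) = n) (h' : k + 1 + j = n)
    (X : SkewDerivation (SmoothFunction n M) W k) :
    poissonBoundary π (twist b (-φ)) j (starMap W y E μ k (j + 1) h X) =
      starMap W y E μ (k + 1) j h' (coboundary π.isPoissonBracket hb k X) := by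
  let e := starEquiv hE hW hμ k (j + 1) h
  let A := (poissonBoundary π (twist b (-φ)) j).toAddMonoidHom
  let B := ((starMap W y E μ (k + 1) j h').restrictScalars ℝ ∘ₗ
    coboundary π.isPoissonBracket hb k ∘ₗ
      e.symm.toLinearMap.restrictScalars ℝ).toAddMonoidHom
  have key : ∀ x, A x = B x := fun x => by
    refine hE.tensor_induction (A.eqLocus B) (fun w f => ?_) x
    refine ((isPoissonBoundary_iff _).1
      (isPoissonBoundary_poissonBoundary hE hW hμ hb hφ j) w f).trans
      (starMap_coboundary hE hW hμ π.isPoissonBracket hb hφ j k h h' w f _ ?_).symm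
    exact e.apply_symm_apply _
  have := key (e X)
  simp only [A, B, LinearMap.toAddMonoidHom_coe, LinearMap.comp_apply,
    LinearMap.restrictScalars_apply, LinearEquiv.coe_coe, LinearEquiv.symm_apply_apply] at this
  exact this

lemma poissonBoundary_poissonBoundary (r : ℕ) (x : FormsWithValues (n := n) (M := M) W (r + 2)) :
    poissonBoundary π (twist b (-φ)) r (poissonBoundary π (twist b (-φ)) (r + 1) x) = 0 := by
  rcases lt_or_ge n (r + 2) with hr | hr
  · have := subsingleton_formsWithValues (M := M) (W := W) hr
    rw [Subsingleton.elim x 0, map_zero, map_zero]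
  · obtain ⟨k, hk⟩ : ∃ k, k + (r + 2) = n := ⟨n - (r + 2), by omega⟩
    obtain ⟨X, rfl⟩ := (starMap_bijective hE hW hμ k (r + 2) hk).2 x
    rw [poissonBoundary_starMap hE hW hμ hb hφ k (r + 1) hk (by omega),
      poissonBoundary_starMap hE hW hμ hb hφ (k + 1) r (by omega) (by omega),
      coboundary_coboundary, map_zero]

end PoissonDuality

/-! ### Lie brackets of vector fields as commutators of derivations. -/

section Commutator

open VectorField Set Filter Topology

variable {n : ℕ} {M : Type*} [TopologicalSpace M] [ChartedSpace (EuclideanSpace ℝ (Fin n)) M]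
  [IsManifold (𝓡 n) ∞ M]

lemma two_le_infty : (2 : WithTop ℕ∞) ≤ ∞ :=
  WithTop.coe_le_coe.2 le_top

/-- A vector field in the chart around `p`. -/
def chartField (p : M) (V : ∀ q : M, TangentSpace (𝓡 n) q) (z : EuclideanSpace ℝ (Fin n)) :
    EuclideanSpace ℝ (Fin n) :=
  mpullbackWithin 𝓘(ℝ, EuclideanSpace ℝ (Fin n)) (𝓡 n) (extChartAt (𝓡 n) p).symm V (range (𝓡 n)) z

lemma fderiv_comp_extChartAt_symm (g : SmoothFunction n M) (p : M) {z : EuclideanSpace ℝ (Fin n)}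
    (hz : z ∈ (extChartAt (𝓡 n) p).target) (u : EuclideanSpace ℝ (Fin n)) :
    fderiv ℝ (g ∘ (extChartAt (𝓡 n) p).symm) z u =
      diffAt g ((extChartAt (𝓡 n) p).symm z)
        (mfderivWithin 𝓘(ℝ, EuclideanSpace ℝ (Fin n)) (𝓡 n) (extChartAt (𝓡 n) p).symm
          (range (𝓡 n)) z u) := by
  have h1 : MDifferentiableAt 𝓘(ℝ, EuclideanSpace ℝ (Fin n)) (𝓡 n) (extChartAt (𝓡 n) p).symm z := by
    have := mdifferentiableWithinAt_extChartAt_symm (I := 𝓡 n) hz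
    rwa [ModelWithCorners.range_eq_univ, mdifferentiableWithinAt_univ] at this
  have h2 := mfderiv_comp z (g.mdifferentiableAt (x := (extChartAt (𝓡 n) p).symm z)) h1
  rw [mfderiv_eq_fderiv] at h2
  rw [h2, ModelWithCorners.range_eq_univ, mfderivWithin_univ]
  rfl

lemma fderiv_chartField (g : SmoothFunction n M) (p : M) (V : ∀ q : M, TangentSpace (𝓡 n) q)
    {z : EuclideanSpace ℝ (Fin n)} (hz : z ∈ (extChartAt (𝓡 n) p).target) :
    fderiv ℝ (g ∘ (extChartAt (𝓡 n) p).symm) z (chartField p V z) =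
      diffAt g ((extChartAt (𝓡 n) p).symm z) (V ((extChartAt (𝓡 n) p).symm z)) := by
  rw [fderiv_comp_extChartAt_symm g p hz, chartField, mpullbackWithin_apply]
  congr 1
  exact (isInvertible_mfderivWithin_extChartAt_symm hz).self_apply_inverse _

lemma diffAt_eq_fderiv (g : SmoothFunction n M) (p : M) (u : EuclideanSpace ℝ (Fin n)) :
    diffAt g p u = fderiv ℝ (g ∘ (extChartAt (𝓡 n) p).symm) (extChartAt (𝓡 n) p p) u := by
  refine (congrArg (fun L : EuclideanSpace ℝ (Fin n) →L[ℝ] ℝ => L u)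
    (g.mdifferentiableAt (x := p)).mfderiv).trans ?_
  change fderivWithin ℝ (g ∘ (extChartAt (𝓡 n) p).symm) (range (𝓡 n)) (extChartAt (𝓡 n) p p) u = _
  rw [ModelWithCorners.range_eq_univ, fderivWithin_univ]

/-- The chart around p has identity derivative at p itself, so no change of coordinates remains. -/
lemma mlieBracket_eq_lieBracket_chartField (p : M) (V W : ∀ q : M, TangentSpace (𝓡 n) q) :
    mlieBracket (𝓡 n) V W p =
      lieBracket ℝ (chartField p V) (chartField p W) (extChartAt (𝓡 n) p p) := by
  have hinv : ∀ u : EuclideanSpace ℝ (Fin n),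
      (mfderiv (𝓡 n) 𝓘(ℝ, EuclideanSpace ℝ (Fin n)) (extChartAt (𝓡 n) p) p).inverse u = u :=
    fun u => (congrArg (fun L : EuclideanSpace ℝ (Fin n) →L[ℝ] EuclideanSpace ℝ (Fin n) =>
      L.inverse u) (mfderiv_extChartAt_self (I := 𝓡 n) (x := p))).trans
      (congrArg (fun L : EuclideanSpace ℝ (Fin n) →L[ℝ] EuclideanSpace ℝ (Fin n) => L u)
        ContinuousLinearMap.inverse_id)
  refine (hinv (lieBracketWithin ℝ (chartField p V) (chartField p W)
    ((extChartAt (𝓡 n) p).symm ⁻¹' univ ∩ range (𝓡 n)) (extChartAt (𝓡 n) p p))).trans ?_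
  rw [preimage_univ, univ_inter, ModelWithCorners.range_eq_univ, lieBracketWithin_univ]

lemma chartField_self (p : M) (V : ∀ q : M, TangentSpace (𝓡 n) q) :
    chartField p V (extChartAt (𝓡 n) p p) = V p :=
  (mfderivWithin_extChartAt_symm_inverse_apply (I := 𝓡 n) (x := p)
    (V ((extChartAt (𝓡 n) p).symm (extChartAt (𝓡 n) p p)))).trans
    (congrArg (fun q => (V q : EuclideanSpace ℝ (Fin n))) (extChartAt_to_inv p))

lemma differentiableAt_chartField (V : SmoothVectorField n M) (p : M) :
    DifferentiableAt ℝ (chartField p fun q => V q) (extChartAt (𝓡 n) p p) := by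
  have h : MDifferentiableWithinAt (𝓡 n) (𝓡 n).tangent
      (fun q => (⟨q, V q⟩ : TangentBundle (𝓡 n) M)) univ p :=
    (V.contMDiff.contMDiffAt.mdifferentiableAt (by simp)).mdifferentiableWithinAt
  have : IsManifold (𝓡 n) 2 M := IsManifold.of_le (n := ∞) two_le_infty
  have h1 : DifferentiableWithinAt ℝ (chartField p fun q => V q)
      ((extChartAt (𝓡 n) p).symm ⁻¹' univ ∩ range (𝓡 n)) (extChartAt (𝓡 n) p p) :=
    h.differentiableWithinAt_mpullbackWithin_vectorField
  rwa [preimage_univ, univ_inter, ModelWithCorners.range_eq_univ, differentiableWithinAt_univ] at h1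

lemma contDiffAt_comp_extChartAt_symm (g : SmoothFunction n M) (p : M) :
    ContDiffAt ℝ ∞ (g ∘ (extChartAt (𝓡 n) p).symm) (extChartAt (𝓡 n) p p) := by
  have h := (contMDiffAt_iff.1 (g.contMDiff p)).2
  rw [ModelWithCorners.range_eq_univ, contDiffWithinAt_univ] at h
  exact h

lemma diffAt_derivAlong_eq (f : SmoothFunction n M) (V : SmoothVectorField n M) (p : M)
    (u : EuclideanSpace ℝ (Fin n)) :
    diffAt (derivAlong V f) p u =
      fderiv ℝ (fun z => fderiv ℝ (f ∘ (extChartAt (𝓡 n) p).symm) z (chartField p (fun q => V q) z))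
        (extChartAt (𝓡 n) p p) u := by
  rw [diffAt_eq_fderiv]
  congr 1
  refine Filter.EventuallyEq.fderiv_eq ?_
  filter_upwards [extChartAt_target_mem_nhds (I := 𝓡 n) p] with z hz
  exact (fderiv_chartField f p _ hz).symm

/-- In the chart around p the second-order terms cancel by symmetry of the second derivative of f.
-/
lemma diffAt_mlieBracket (f : SmoothFunction n M) (V W : SmoothVectorField n M) (p : M) :
    diffAt f p (mlieBracket (𝓡 n) (fun q => V q) (fun q => W q) p) =
      diffAt (derivAlong W f) p (V p) - diffAt (derivAlong V f) p (W p) := by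
  have hf := contDiffAt_comp_extChartAt_symm f p
  rw [mlieBracket_eq_lieBracket_chartField, diffAt_eq_fderiv,
    fderiv_apply_lieBracket_of_isSymmSndFDerivAt (hf.of_le two_le_infty)
      (hf.isSymmSndFDerivAt (by simpa using two_le_infty)) (differentiableAt_chartField W p)
      (differentiableAt_chartField V p), chartField_self, chartField_self]
  exact congrArg₂ (· - ·) (diffAt_derivAlong_eq f W p (V p)).symm
    (diffAt_derivAlong_eq f V p (W p)).symm

end Commutator

/-! ### Derivations of determinants. -/

section DetDerivation

variable {R : Type*} [CommRing R] (D : R →+ R) (hD : ∀ a b, D (a * b) = a * D b + D a * b)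

include hD

lemma derivation_prod {m : ℕ} (a : Fin m → R) :
    D (∏ i, a i) = ∑ i, ∏ l, Function.update a i (D (a i)) l := by
  induction m with
  | zero =>
    have := hD 1 1
    simpa using this
  | succ m ih =>
    rw [Fin.prod_univ_succ, hD, ih fun i => a i.succ, Fin.sum_univ_succ, Fin.prod_univ_succ,
      Function.update_self, add_comm, Finset.mul_sum]
    congr 1
    refine Finset.sum_congr rfl fun i _ => ?_
    rw [Fin.prod_univ_succ, Function.update_of_ne (Fin.succ_ne_zero i).symm]
    congr 1
    refine Finset.prod_congr rfl fun l _ => ?_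
    simp [Function.update_apply]

lemma derivation_det {m : ℕ} (A : Matrix (Fin m) (Fin m) R) :
    D A.det = ∑ j, (A.updateCol j fun i => D (A i j)).det := by
  have hz : ∀ (s : ℤ) (a : R), D ((s : R) * a) = (s : R) * D a := fun s a => by
    rw [← zsmul_eq_mul, map_zsmul, zsmul_eq_mul]
  simp only [Matrix.det_apply', map_sum, hz, derivation_prod D hD, Finset.mul_sum]
  rw [Finset.sum_comm]
  refine Finset.sum_congr rfl fun j _ => Finset.sum_congr rfl fun σ _ => ?_
  congr 1
  refine Finset.prod_congr rfl fun l _ => ?_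
  rw [Matrix.updateCol_apply, Function.update_apply]
  split_ifs with h
  · rw [h]
  · rfl

end DetDerivation

/-- Both sides equal ∑ adj(A)_{ji} B_{ij}. This passes from differentiating along vector fields
(columns) to differentiating the functions (rows). -/
lemma sum_det_updateCol_eq_sum_det_updateRow {R : Type*} [CommRing R] {m : ℕ}
    (A B : Matrix (Fin m) (Fin m) R) :
    ∑ j, (A.updateCol j fun i => B i j).det = ∑ i, (A.updateRow i (B i)).det := by
  have h1 : ∀ j, (A.updateCol j fun i => B i j).det = ∑ i, A.adjugate j i * B i j := fun j => by
    rw [← Matrix.cramer_apply, Matrix.cramer_eq_adjugate_mulVec]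
    rfl
  have h2 : ∀ i, (A.updateRow i (B i)).det = ∑ j, A.adjugate j i * B i j := fun i => by
    rw [← Matrix.cramer_transpose_apply, Matrix.cramer_eq_adjugate_mulVec, ← Matrix.adjugate_transpose]
    rfl
  simp only [h1, h2]
  exact Finset.sum_comm

/-! ### Hamiltonian fields as smooth sections. -/

section Hamiltonian

variable {n : ℕ} {M : Type*} [TopologicalSpace M] [ChartedSpace (EuclideanSpace ℝ (Fin n)) M]
  [IsManifold (𝓡 n) ∞ M]

lemma contMDiff_section_of_toChart (V : ∀ p : M, TangentSpace (𝓡 n) p)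
    (h : ∀ (p₀ : M) (i : Fin n), ContMDiffOn (𝓡 n) 𝓘(ℝ, ℝ) ∞ (fun p => toChart p₀ p (V p) i)
      (chartAt (EuclideanSpace ℝ (Fin n)) p₀).source) :
    ContMDiff (𝓡 n) ((𝓡 n).prod 𝓘(ℝ, EuclideanSpace ℝ (Fin n))) ∞
      (fun p => (⟨p, V p⟩ : TangentBundle (𝓡 n) M)) := by
  intro p₀
  set e := trivializationAt (EuclideanSpace ℝ (Fin n)) (TangentSpace (𝓡 n) : M → Type _) p₀ with he
  have hb : (chartAt (EuclideanSpace ℝ (Fin n)) p₀).source = e.baseSet :=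
    (TangentBundle.trivializationAt_baseSet p₀).symm
  refine ContMDiffOn.contMDiffAt (s := e.baseSet) ?_
    (hb ▸ (chartAt (EuclideanSpace ℝ (Fin n)) p₀).open_source.mem_nhds (mem_chart_source _ p₀))
  rw [e.contMDiffOn_section_baseSet_iff]
  have h1 : ContMDiffOn (𝓡 n) 𝓘(ℝ, EuclideanSpace ℝ (Fin n)) ∞ (fun p => toChart p₀ p (V p))
      e.baseSet := by
    rw [← hb]
    refine (contMDiffOn_finsetSum (t := Finset.univ) fun i _ => (h p₀ i).smul
      (contMDiffOn_const (c := EuclideanSpace.basisFun (Fin n) ℝ i))).congr fun p _ => ?_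
    conv_lhs => rw [← (EuclideanSpace.basisFun (Fin n) ℝ).sum_repr (toChart p₀ p (V p))]
    simp
  refine h1.congr fun p hp => ?_
  change _ = e.continuousLinearMapAt ℝ p (V p)
  rw [Bundle.Trivialization.continuousLinearMapAt_apply, Bundle.Trivialization.linearMapAt_apply,
    if_pos hp]

/-- The Hamiltonian vector field of `g`, as a smooth section. -/
def hamiltonianField (π : PoissonStructure n M) (g : SmoothFunction n M) : SmoothVectorField n M :=
  ⟨fun p => π.hamiltonian g p, by
    refine contMDiff_section_of_toChart _ fun p₀ i => ?_
    have h : ∀ p ∈ (chartAt (EuclideanSpace ℝ (Fin n)) p₀).source,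
        toChart p₀ p (π.hamiltonian g p) i = ∑ j,
          diffAt g p (ofChart p₀ p (EuclideanSpace.basisFun (Fin n) ℝ j)) *
          π.toFun p ((EuclideanSpace.basisFun (Fin n) ℝ).toBasis.coord i ∘ₗ toChart p₀ p)
            ((EuclideanSpace.basisFun (Fin n) ℝ).toBasis.coord j ∘ₗ toChart p₀ p) := by
      intro p hp
      have h1 := π.apply_hamiltonian g p
        ((EuclideanSpace.basisFun (Fin n) ℝ).toBasis.coord i ∘ₗ toChart p₀ p)
      rw [diffAt_eq_sum g hp] at h1
      simp only [map_sum, map_smul, smul_eq_mul] at h1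
      rw [← h1]
      simp
    refine ContMDiffOn.congr ?_ h
    refine contMDiffOn_finsetSum fun j _ => ?_
    exact (contMDiffOn_diffAt_ofChart g.contMDiff p₀ _).mul (π.smooth p₀ _ _)⟩

lemma derivAlong_hamiltonianField (π : PoissonStructure n M) (f g : SmoothFunction n M) :
    derivAlong (hamiltonianField π g) f = π.bracket f g := by
  ext p
  exact π.apply_hamiltonian g p (diffAt f p)

end Hamiltonian

/-! ### The modular condition in divergence form. -/

section Modular

variable {n : ℕ} {M : Type*} [TopologicalSpace M] [ChartedSpace (EuclideanSpace ℝ (Fin n)) M]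
  [IsManifold (𝓡 n) ∞ M]
variable {N : ℕ} {y : Fin N → SmoothFunction n M} {E : Fin N → SmoothVectorField n M}

lemma evalForm_wedgeDiff {k : ℕ} (Y : Fin k → SmoothVectorField n M)
    (f : Fin k → SmoothFunction n M) :
    evalForm Y (wedgeDiff f) = (Matrix.of fun i j => derivAlong (Y j) (f i)).det := by
  ext p
  rw [evalForm_apply, wedgeDiff_apply]
  exact (RingHom.map_det (ContMDiffMap.evalRingHom (I := 𝓡 n) (n := ∞) (I' := 𝓘(ℝ, ℝ)) (R := ℝ) p)
    (Matrix.of fun i j => derivAlong (Y j) (f i))).symm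

/-- The Leibniz rule for the Lie derivative of df₁ ∧ ⋯ ∧ df_k along X_g. The derivation {·, g} is
applied to det(Y_j(f_i)) column by column, with X_g(Y_j(f_i)) = [X_g, Y_j](f_i) + Y_j({f_i, g}). -/
lemma bracket_evalForm_wedgeDiff (π : PoissonStructure n M) {k : ℕ}
    (Y : Fin k → SmoothVectorField n M) (f : Fin k → SmoothFunction n M) (g : SmoothFunction n M)
    (p : M) :
    π.bracket (evalForm Y (wedgeDiff f)) g p =
      ∑ j, (wedgeDiff f).1 p (Function.update (fun l => Y l p) j
        (VectorField.mlieBracket (𝓡 n) (π.hamiltonian g) (fun q => Y j q) p)) +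
      ∑ i, (wedgeDiff (Function.update f i (π.bracket (f i) g))).1 p fun l => Y l p := by
  set A : Matrix (Fin k) (Fin k) ℝ := Matrix.of fun i j => diffAt (f i) p (Y j p) with hA
  set ev : SmoothFunction n M →+* ℝ :=
    ContMDiffMap.evalRingHom (I := 𝓡 n) (n := ∞) (I' := 𝓘(ℝ, ℝ)) (R := ℝ) p
  have h1 := derivation_det (π.bracket.flip g).toAddMonoidHom
    (fun a c => π.isPoissonBracket.leibniz a c g) (Matrix.of fun i j => derivAlong (Y j) (f i))
  have h2 := congrArg ev h1
  rw [map_sum] at h2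
  rw [evalForm_wedgeDiff]
  refine h2.trans ?_
  have h3 : ∀ j, ev (((Matrix.of fun i j => derivAlong (Y j) (f i)).updateCol j fun i =>
      (π.bracket.flip g).toAddMonoidHom ((Matrix.of fun i j => derivAlong (Y j) (f i)) i j)).det) =
      (wedgeDiff f).1 p (Function.update (fun l => Y l p) j
        (VectorField.mlieBracket (𝓡 n) (π.hamiltonian g) (fun q => Y j q) p)) +
      (A.updateCol j fun i => diffAt (π.bracket (f i) g) p (Y j p)).det := fun j => by
    have e1 : (wedgeDiff f).1 p (Function.update (fun l => Y l p) j
        (VectorField.mlieBracket (𝓡 n) (π.hamiltonian g) (fun q => Y j q) p)) =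
        (A.updateCol j fun i => diffAt (f i) p
          (VectorField.mlieBracket (𝓡 n) (π.hamiltonian g) (fun q => Y j q) p)).det := by
      rw [wedgeDiff_apply]
      congr 1
      ext i l
      rw [Matrix.updateCol_apply, Matrix.of_apply, Function.update_apply]
      split_ifs with h <;> rfl
    rw [e1, ← Matrix.det_updateCol_add, RingHom.map_det]
    congr 1
    ext i l
    rw [RingHom.mapMatrix_apply, Matrix.map_apply, Matrix.updateCol_apply, Matrix.updateCol_apply]
    split_ifs with h
    · have := diffAt_mlieBracket (f i) (hamiltonianField π g) (Y j) p
      rw [derivAlong_hamiltonianField] at this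
      refine Eq.trans ?_ (eq_sub_iff_add_eq.1 this).symm
      exact (π.apply_hamiltonian g p (diffAt (derivAlong (Y j) (f i)) p)).symm
    · rfl
  rw [Finset.sum_congr rfl fun j _ => h3 j, Finset.sum_add_distrib]
  refine (congrArg (_ + ·) (sum_det_updateCol_eq_sum_det_updateRow A
      (Matrix.of fun i j => diffAt (π.bracket (f i) g) p (Y j p)))).trans ?_
  congr 1
  refine Finset.sum_congr rfl fun i _ => ?_
  rw [wedgeDiff_apply]
  congr 1
  ext l j
  change _ = diffAt (Function.update f i (π.bracket (f i) g) l) p (Y j p)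
  rw [Matrix.updateRow_apply, Function.update_apply]
  split_ifs with h <;> rfl

/-- Write df₁ ∧ ⋯ ∧ df_n = s μ and compare its Lie derivative with the Leibniz rule for s μ.
Evaluating on a frame tuple on which μ does not vanish at p allows cancelling μ. -/
lemma IsModularVectorField.isModularDerivation {π : PoissonStructure n M} {μ : SmoothForm n M n}
    {φ : SmoothVectorField n M} (hE : IsDualFrame y E) (hμ : IsVolumeForm μ)
    (hφ : IsModularVectorField π μ φ) : IsModularDerivation hE hμ π.bracket φ := by
  intro f g
  ext p
  obtain ⟨b, hb⟩ := hE.exists_apply_ne_zero (hμ p)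
  change μ.1 p (fun i => (E ∘ b) i p) ≠ 0 at hb
  have hs : ∀ (f : Fin n → SmoothFunction n M) (v : Fin n → TangentSpace (𝓡 n) p),
      (wedgeDiff f).1 p v = starForm hE hμ (wedgeDiff f) p * μ.1 p v := fun f v => by
    conv_lhs => rw [← starForm_smul hE hμ (wedgeDiff f)]
    rfl
  have h1 := bracket_evalForm_wedgeDiff π (E ∘ b) f g p
  have h2 : evalForm (E ∘ b) (wedgeDiff f) = starForm hE hμ (wedgeDiff f) * evalForm (E ∘ b) μ := by
    conv_lhs => rw [← starForm_smul hE hμ (wedgeDiff f)]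
    exact map_smul _ _ _
  have h3 := hφ g (E ∘ b) p
  have h4 : diffAt (fun q => μ.1 q fun i => (E ∘ b) i q) p (π.hamiltonian g p) =
      π.bracket (evalForm (E ∘ b) μ) g p := by
    rw [π.apply_hamiltonian]
    have : (fun q => μ.1 q fun i => (E ∘ b) i q) = evalForm (E ∘ b) μ :=
      funext fun q => (evalForm_apply (E ∘ b) μ q).symm
    rw [this]
    rfl
  rw [lieDerivative, h4] at h3
  rw [h2, π.isPoissonBracket.leibniz] at h1
  simp only [hs] at h1
  rw [← Finset.mul_sum, ← Finset.sum_mul] at h1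
  change starForm hE hμ (wedgeDiff f) p * π.bracket (evalForm (E ∘ b) μ) g p +
    π.bracket (starForm hE hμ (wedgeDiff f)) g p * evalForm (E ∘ b) μ p = _ at h1
  rw [evalForm_apply] at h1
  refine mul_right_cancel₀ hb ?_
  change π.bracket (starForm hE hμ (wedgeDiff f)) g p * _ =
    ((∑ i, starForm hE hμ (wedgeDiff (Function.update f i (π.bracket (f i) g))) : SmoothFunction n M) p
      - derivAlong φ g p * starForm hE hμ (wedgeDiff f) p) * _
  rw [smoothFunction_sum_apply]
  linear_combination h1 - starForm hE hμ (wedgeDiff f) p * h3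

end Modular

/-! ### Hadamard's lemma through parametric integrals. -/

section ParametricIntegral

open Set Function MeasureTheory intervalIntegral

variable {E : Type} [NormedAddCommGroup E] [NormedSpace ℝ E] [ProperSpace E]

lemma hasFDerivAt_intervalIntegral_of_contDiff {F : Type} [NormedAddCommGroup F] [NormedSpace ℝ F]
    {f : E × ℝ → F} (hf : ContDiff ℝ ∞ f) (x₀ : E) :
    HasFDerivAt (fun x => ∫ t in (0 : ℝ)..1, f (x, t))
      (∫ t in (0 : ℝ)..1, (fderiv ℝ f (x₀, t)).comp (ContinuousLinearMap.inl ℝ E ℝ)) x₀ := by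
  have hf' : Continuous fun z : E × ℝ => (fderiv ℝ f z).comp (ContinuousLinearMap.inl ℝ E ℝ) :=
    (hf.continuous_fderiv (by simp)).clm_comp continuous_const
  obtain ⟨B, hB⟩ := ((isCompact_closedBall x₀ 1).prod (isCompact_Icc (a := (0 : ℝ)) (b := 1))).exists_bound_of_continuousOn
    hf'.continuousOn
  have hs : ∀ t : ℝ, Continuous fun x : E => (x, t) := fun t => by fun_prop
  have hs' : ∀ x : E, Continuous fun t : ℝ => (x, t) := fun t => by fun_prop
  refine hasFDerivAt_integral_of_dominated_of_fderiv_le (bound := fun _ => B)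
    (F' := fun x t => (fderiv ℝ f (x, t)).comp (ContinuousLinearMap.inl ℝ E ℝ))
    (Metric.closedBall_mem_nhds x₀ one_pos)
    (Filter.Eventually.of_forall fun x => (hf.continuous.comp (hs' x)).aestronglyMeasurable)
    ((hf.continuous.comp (hs' x₀)).intervalIntegrable _ _)
    (hf'.comp (hs' x₀)).aestronglyMeasurable
    (Filter.Eventually.of_forall fun t ht x hx => hB (x, t) ⟨hx, ?_⟩) intervalIntegrable_const
    (Filter.Eventually.of_forall fun t _ x _ => ?_)
  · rw [uIoc_of_le zero_le_one] at ht
    exact Ioc_subset_Icc_self ht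
  · have h1 : HasFDerivAt f (fderiv ℝ f (x, t)) (x, t) :=
      (hf.differentiable (by simp) _).hasFDerivAt
    exact h1.comp x (hasFDerivAt_prodMk_left x t)

/-- The derivative is an integral of the same kind with values in E →L F, so the induction runs over
all F; `E` and `F` lie in one universe for this purpose. -/
lemma contDiff_intervalIntegral_of_contDiff {F : Type} [NormedAddCommGroup F] [NormedSpace ℝ F]
    {f : E × ℝ → F} (hf : ContDiff ℝ ∞ f) :
    ContDiff ℝ ∞ (fun x => ∫ t in (0 : ℝ)..1, f (x, t)) := by
  rw [contDiff_infty]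
  intro k
  induction k generalizing F with
  | zero =>
    exact contDiff_zero.2 (continuous_parametric_intervalIntegral_of_continuous'
      (f := fun x t => f (x, t)) hf.continuous 0 1)
  | succ k ih =>
    refine contDiff_succ_iff_hasFDerivAt.2 ⟨_, ?_, hasFDerivAt_intervalIntegral_of_contDiff hf⟩
    exact ih (f := fun z => (fderiv ℝ f z).comp (ContinuousLinearMap.inl ℝ E ℝ))
      ((hf.fderiv_right (m := ∞) (by simp)).clm_comp contDiff_const)

/-- Hadamard's lemma. -/
lemma exists_contDiff_eq_add_apply {f : E → ℝ} (hf : ContDiff ℝ ∞ f) (x₀ : E) :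
    ∃ h : E → E →L[ℝ] ℝ, ContDiff ℝ ∞ h ∧ h x₀ = fderiv ℝ f x₀ ∧
      ∀ x, f x = f x₀ + h x (x - x₀) := by
  have hc : ContDiff ℝ ∞ fun z : E × ℝ => fderiv ℝ f (x₀ + z.2 • (z.1 - x₀)) :=
    (hf.fderiv_right (m := ∞) (by simp)).comp
      (contDiff_const.add (contDiff_snd.smul (contDiff_fst.sub contDiff_const)))
  -- The witness is h(x) = ∫₀¹ Df(x₀ + t(x - x₀)) dt; the identity is the fundamental theorem of
  -- calculus along the segment.
  refine ⟨_, contDiff_intervalIntegral_of_contDiff hc, by simp, fun x => ?_⟩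
  have hs' : Continuous fun t : ℝ => (x, t) := by fun_prop
  have hi := (hc.continuous.comp hs').intervalIntegrable (μ := volume) 0 1
  have hd : ∀ t ∈ uIcc (0 : ℝ) 1, HasDerivAt (fun t : ℝ => f (x₀ + t • (x - x₀)))
      (fderiv ℝ f (x₀ + t • (x - x₀)) (x - x₀)) t := fun t _ => by
    have h1 : HasFDerivAt f (fderiv ℝ f (x₀ + t • (x - x₀))) (x₀ + t • (x - x₀)) :=
      (hf.differentiable (by simp) _).hasFDerivAt
    have h2 : HasDerivAt (fun t : ℝ => x₀ + t • (x - x₀)) (x - x₀) t := by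
      simpa using ((hasDerivAt_id t).smul_const (x - x₀)).const_add x₀
    exact h1.comp_hasDerivAt t h2
  have h3 := integral_eq_sub_of_hasDerivAt hd
    (((ContinuousLinearMap.apply ℝ ℝ (x - x₀)).continuous.comp
      (hc.continuous.comp hs')).intervalIntegrable 0 1)
  have h4 : (∫ t in (0 : ℝ)..1, fderiv ℝ f (x₀ + t • (x - x₀))) (x - x₀) =
      ∫ t in (0 : ℝ)..1, fderiv ℝ f (x₀ + t • (x - x₀)) (x - x₀) :=
    ((ContinuousLinearMap.apply ℝ ℝ (x - x₀)).intervalIntegral_comp_comm hi).symm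
  rw [h4, h3]
  simp

end ParametricIntegral

/-! ### Derivations with values in a geometric module. -/

section Geometric

open Set Filter Topology

variable {n : ℕ} {M : Type*} [TopologicalSpace M] [ChartedSpace (EuclideanSpace ℝ (Fin n)) M]
  [IsManifold (𝓡 n) ∞ M]
variable {W : Type*} [AddCommGroup W] [Module ℝ W] [Module (SmoothFunction n M) W]
  [IsScalarTower ℝ (SmoothFunction n M) W]
variable {N : ℕ} {y : Fin N → SmoothFunction n M} {E : Fin N → SmoothVectorField n M}

lemma mem_vanishingIdeal {p : M} {f : SmoothFunction n M} :
    f ∈ vanishingIdeal n M p ↔ f p = 0 :=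
  Iff.rfl

/-- A smooth function on the model space, cut off and transported to `M`. -/
def cutoffComp [T2Space M] {p : M} (χ : SmoothBumpFunction (𝓡 n) p)
    (h : EuclideanSpace ℝ (Fin n) → ℝ) (hh : ContDiff ℝ ∞ h) : SmoothFunction n M :=
  ⟨fun q => χ q * h (extChartAt (𝓡 n) p q), χ.contMDiff_smul
    (hh.contMDiff.comp_contMDiffOn (contMDiffOn_extChartAt (I := 𝓡 n) (x := p)))⟩

lemma contDiff_bump_mul [T2Space M] {p : M} (χ : SmoothBumpFunction (𝓡 n) p)
    (g : SmoothFunction n M) :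
    ContDiff ℝ ∞ fun z => χ.toContDiffBump z * g ((extChartAt (𝓡 n) p).symm z) := by
  have hsub : tsupport χ.toContDiffBump ⊆ (extChartAt (𝓡 n) p).target := by
    rw [χ.toContDiffBump.tsupport_eq]
    simpa using χ.closedBall_subset
  refine contDiff_iff_contDiffAt.2 fun z => ?_
  by_cases hz : z ∈ tsupport χ.toContDiffBump
  · refine χ.toContDiffBump.contDiff.contDiffAt.mul ?_
    have h1 : ContMDiffOn 𝓘(ℝ, EuclideanSpace ℝ (Fin n)) 𝓘(ℝ, ℝ) ∞
        (g ∘ (extChartAt (𝓡 n) p).symm) (extChartAt (𝓡 n) p).target :=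
      g.contMDiff.comp_contMDiffOn (contMDiffOn_extChartAt_symm p)
    exact h1.contDiffOn.contDiffAt ((isOpen_extChartAt_target p).mem_nhds (hsub hz))
  · refine (contDiffAt_const (c := (0 : ℝ))).congr_of_eventuallyEq ?_
    filter_upwards [(isClosed_tsupport _).isOpen_compl.mem_nhds hz] with w hw
    rw [image_eq_zero_of_notMem_tsupport hw, zero_mul]

/-- Hadamard's lemma for χ g in the chart gives χ g = ∑ (z - z₀)_i h_i with h_i(z₀) = 0, because dg
vanishes at p. -/
lemma mem_vanishingIdeal_mul_self [T2Space M] {p : M} {g : SmoothFunction n M} (h0 : g p = 0)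
    (h1 : diffAt (n := n) g p = 0) : g ∈ vanishingIdeal n M p * vanishingIdeal n M p := by
  obtain ⟨χ⟩ : Nonempty (SmoothBumpFunction (𝓡 n) p) := inferInstance
  set z₀ := extChartAt (𝓡 n) p p with hz₀
  obtain ⟨h, hh, hh0, hg⟩ := exists_contDiff_eq_add_apply (contDiff_bump_mul χ g) z₀
  set e := EuclideanSpace.basisFun (Fin n) ℝ
  have hd : h z₀ = 0 := by
    rw [hh0]
    have : (fun z => χ.toContDiffBump z * g ((extChartAt (𝓡 n) p).symm z)) =ᶠ[𝓝 z₀]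
        g ∘ (extChartAt (𝓡 n) p).symm := by
      filter_upwards [χ.toContDiffBump.eventuallyEq_one] with z hz
      rw [hz]
      exact one_mul _
    rw [this.fderiv_eq]
    ext1 u
    rw [← diffAt_eq_fderiv, h1]
    rfl
  let X : Fin n → SmoothFunction n M := fun i => cutoffComp χ (fun z => (z - z₀) i)
    ((EuclideanSpace.proj (𝕜 := ℝ) i).contDiff.comp (contDiff_id.sub contDiff_const))
  let H : Fin n → SmoothFunction n M := fun i => cutoffComp χ (fun z => h z (e i))
    (hh.clm_apply contDiff_const)
  let c : SmoothFunction n M := cutoffComp χ (fun _ => 1) contDiff_const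
  have hc : ∀ q, c q = χ q := fun q => mul_one _
  have hX : ∀ i, X i ∈ vanishingIdeal n M p := fun i => by
    rw [mem_vanishingIdeal]
    change χ p * (extChartAt (𝓡 n) p p - z₀) i = 0
    rw [← hz₀, sub_self]
    exact mul_zero _
  have hH : ∀ i, H i ∈ vanishingIdeal n M p := fun i => by
    rw [mem_vanishingIdeal]
    change χ p * h (extChartAt (𝓡 n) p p) (e i) = 0
    rw [← hz₀, hd]
    exact mul_zero _
  have hcp : 1 - c * c * c ∈ vanishingIdeal n M p := by
    rw [mem_vanishingIdeal]
    change 1 - c p * c p * c p = 0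
    rw [hc, χ.eq_one]
    norm_num
  -- Two more factors χ extend the coordinate z_i - (z₀)_i and the coefficient h_i to global
  -- functions, hence χ³ g. The remainder (1 - χ³) g is again a product of two functions vanishing
  -- at p.
  have key : g = ∑ i, X i * H i + (1 - c * c * c) * g := by
    ext q
    change g q = (∑ i, X i * H i : SmoothFunction n M) q + (1 - c q * c q * c q) * g q
    rw [smoothFunction_sum_apply]
    have hs : ∑ i, (X i * H i : SmoothFunction n M) q = c q * c q * c q * g q := by
      by_cases hq : q ∈ (chartAt (EuclideanSpace ℝ (Fin n)) p).source
      · have h2 := hg (extChartAt (𝓡 n) p q)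
        have h3 : χ.toContDiffBump (extChartAt (𝓡 n) p q) = χ q := (χ.eqOn_source hq).symm
        rw [(extChartAt (𝓡 n) p).left_inv (by rwa [extChartAt_source]), h3] at h2
        have h4 : (extChartAt (𝓡 n) p).symm z₀ = p := extChartAt_to_inv p
        rw [h4, h0, mul_zero, zero_add, ← e.sum_repr (extChartAt (𝓡 n) p q - z₀), map_sum] at h2
        have h5 : ∀ i, (X i * H i : SmoothFunction n M) q = χ q * χ q *
            h (extChartAt (𝓡 n) p q) (e.repr (extChartAt (𝓡 n) p q - z₀) i • e i) := fun i => by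
          rw [map_smul]
          change χ q * (extChartAt (𝓡 n) p q - z₀) i * (χ q * h (extChartAt (𝓡 n) p q) (e i)) = _
          simp only [e, EuclideanSpace.basisFun_repr, smul_eq_mul]
          ring
        rw [Finset.sum_congr rfl fun i _ => h5 i, ← Finset.mul_sum, ← h2, hc]
        ring
      · have h2 : χ q = 0 := by
          by_contra h
          exact hq (χ.support_subset_source h)
        refine (Finset.sum_eq_zero fun i _ => ?_).trans (by rw [hc, h2]; ring)
        change χ q * _ * (χ q * _) = 0
        rw [h2]
        ring
    rw [hs]
    ring
  rw [key]
  refine add_mem (sum_mem fun i _ => Ideal.mul_mem_mul (hX i) (hH i)) (Ideal.mul_mem_mul hcp ?_)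
  exact mem_vanishingIdeal.2 h0

lemma derivation_mem_vanishingIdeal_smul [T2Space M] {D : SmoothFunction n M →ₗ[ℝ] W}
    (hD : ∀ x z, D (x * z) = x • D z + z • D x) {p : M} {g : SmoothFunction n M} (h0 : g p = 0)
    (h1 : diffAt (n := n) g p = 0) :
    D g ∈ vanishingIdeal n M p • (⊤ : Submodule (SmoothFunction n M) W) := by
  refine Submodule.mul_induction_on (C := fun g => D g ∈ vanishingIdeal n M p •
    (⊤ : Submodule (SmoothFunction n M) W)) (mem_vanishingIdeal_mul_self h0 h1) (fun a ha c hc => ?_)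
    fun a c ha hc => ?_
  · rw [hD]
    exact add_mem (Submodule.smul_mem_smul ha Submodule.mem_top)
      (Submodule.smul_mem_smul hc Submodule.mem_top)
  · rw [map_add]
    exact add_mem ha hc

/-- Fix p. Up to an element of 𝔪_p W, the difference of the two sides is D applied to f minus its
first-order approximation in the y_a at p. That function vanishes to second order, so the difference
lies in 𝔪_p W for every p, hence is zero. -/
lemma IsGeometric.expandsDerivations [T2Space M] (hW : IsGeometric n M W)
    (hE : IsDualFrame y E) : ExpandsDerivations W y E := by
  intro D hD f
  have hD1 : ∀ r : ℝ, D (r • 1) = 0 := fun r => by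
    have := hD 1 1
    rw [mul_one, one_smul, left_eq_add] at this
    rw [map_smul, this, smul_zero]
  rw [← sub_eq_zero, ← Submodule.mem_bot (SmoothFunction n M), ← hW, Submodule.mem_iInf]
  intro p
  set g : SmoothFunction n M :=
    f - f p • 1 - ∑ a, derivAlong (E a) f p • (y a - y a p • 1) with hg
  have hev : ∀ (r : ℝ) (h : SmoothFunction n M), (r • h) p = r * h p := fun _ _ => rfl
  have h0 : g p = 0 := by
    change f p - f p * 1 - (∑ a, derivAlong (E a) f p • (y a - y a p • 1) : SmoothFunction n M) p = 0
    rw [smoothFunction_sum_apply, Finset.sum_eq_zero fun a _ => ?_]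
    · ring
    · change _ * (y a p - y a p * 1) = 0
      ring
  have h1 : diffAt (n := n) g p = 0 := by
    let L : SmoothFunction n M →ₗ[ℝ] Module.Dual ℝ (TangentSpace (𝓡 n) p) :=
      { toFun := fun f => diffAt f p
        map_add' := fun f h => diffAt_add f h p
        map_smul' := fun c f => diffAt_smul c f p }
    have hL1 : L 1 = 0 := by
      have h : L (1 * 1) = (1 : ℝ) • L 1 + (1 : ℝ) • L 1 := diffAt_mul 1 1 p
      rwa [mul_one, one_smul, left_eq_add] at h
    change L g = 0
    rw [hg, map_sub, map_sub, map_smul, hL1, smul_zero, sub_zero, map_sum, sub_eq_zero]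
    ext v
    simp only [map_smul, map_sub, hL1, smul_zero, sub_zero, LinearMap.sum_apply,
      LinearMap.smul_apply, smul_eq_mul]
    have h := congrArg (L f) (hE p v)
    rw [map_sum] at h
    refine h.trans (Finset.sum_congr rfl fun a _ => ?_)
    rw [map_smul, smul_eq_mul, mul_comm]
    rfl
  have h2 : D g = D f - ∑ a, derivAlong (E a) f p • D (y a) := by
    rw [hg, map_sub, map_sub, hD1, sub_zero, map_sum]
    simp only [map_smul, map_sub, hD1, sub_zero]
  have h3 : D f - ∑ a, derivAlong (E a) f • D (y a) = D g -
      ∑ a, (derivAlong (E a) f - derivAlong (E a) f p • 1) • D (y a) := by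
    simp only [h2, sub_smul, Finset.sum_sub_distrib, smul_assoc, one_smul]
    abel
  rw [h3]
  refine sub_mem (derivation_mem_vanishingIdeal_smul hD h0 h1) (sum_mem fun a _ =>
    Submodule.smul_mem_smul (mem_vanishingIdeal.2 ?_) Submodule.mem_top)
  change derivAlong (E a) f p - derivAlong (E a) f p * 1 = 0
  ring

end Geometric

/-! ### Functions with spanning differentials, over compact sets. -/

section SpanningFamilies

open Set Filter Topology Module

variable {n : ℕ} {M : Type*} [TopologicalSpace M] [ChartedSpace (EuclideanSpace ℝ (Fin n)) M]
  [IsManifold (𝓡 n) ∞ M]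

/-- The differentials at `p` of the functions `y a` span the cotangent space. -/
def SpansCotangent {ι : Type*} (y : ι → SmoothFunction n M) (p : M) : Prop :=
  ∀ v : TangentSpace (𝓡 n) p, (∀ a, diffAt (y a) p v = 0) → v = 0

/-- The derivatives of a tuple of functions in the chart around `c`. -/
def chartDifferential {m : ℕ} (y : Fin m → SmoothFunction n M) (c : M)
    (z : EuclideanSpace ℝ (Fin n) × EuclideanSpace ℝ (Fin n)) : Fin m → ℝ :=
  fun a => fderiv ℝ (y a ∘ (extChartAt (𝓡 n) c).symm) z.1 z.2

lemma contDiffOn_comp_extChartAt_symm (g : SmoothFunction n M) (c : M) :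
    ContDiffOn ℝ ∞ (g ∘ (extChartAt (𝓡 n) c).symm) (extChartAt (𝓡 n) c).target :=
  (g.contMDiff.comp_contMDiffOn (contMDiffOn_extChartAt_symm c)).contDiffOn

lemma contDiffOn_chartDifferential {m : ℕ} (y : Fin m → SmoothFunction n M) (c : M) :
    ContDiffOn ℝ 1 (chartDifferential y c) ((extChartAt (𝓡 n) c).target ×ˢ univ) := by
  refine contDiffOn_pi.2 fun a => ContDiffOn.clm_apply ?_ contDiffOn_snd
  exact ((contDiffOn_comp_extChartAt_symm (y a) c).fderiv_of_isOpen (m := 1)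
    (isOpen_extChartAt_target c) (by simpa [one_add_one_eq_two] using two_le_infty)).comp
      contDiffOn_fst fun z hz => hz.1

lemma exists_chartDifferential_eq {m : ℕ} (y : Fin m → SmoothFunction n M) (c : M) {p : M}
    (hp : p ∈ (extChartAt (𝓡 n) c).source) (v : TangentSpace (𝓡 n) p) :
    ∃ z ∈ (extChartAt (𝓡 n) c).target ×ˢ (univ : Set (EuclideanSpace ℝ (Fin n))),
      chartDifferential y c z = fun a => diffAt (y a) p v := by
  obtain ⟨z, hz, rfl⟩ : ∃ z ∈ (extChartAt (𝓡 n) c).target, (extChartAt (𝓡 n) c).symm z = p :=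
    ⟨_, (extChartAt (𝓡 n) c).map_source hp, (extChartAt (𝓡 n) c).left_inv hp⟩
  refine ⟨(z, (mfderivWithin 𝓘(ℝ, EuclideanSpace ℝ (Fin n)) (𝓡 n) (extChartAt (𝓡 n) c).symm
    (range (𝓡 n)) z).inverse v), ⟨hz, mem_univ _⟩, funext fun a => ?_⟩
  rw [chartDifferential, fderiv_comp_extChartAt_symm (y a) c hz]
  congr 1
  exact (isInvertible_mfderivWithin_extChartAt_symm hz).self_apply_inverse _

/-- The set is a countable union of images of open subsets of ℝⁿ × ℝⁿ under C¹ maps, and these are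
locally Lipschitz. -/
lemma dimH_differentials_le [SecondCountableTopology M] {m : ℕ} (y : Fin m → SmoothFunction n M) :
    dimH {u : Fin m → ℝ | ∃ (p : M) (v : TangentSpace (𝓡 n) p), u = fun a => diffAt (y a) p v} ≤
      (n + n : ℕ) := by
  obtain ⟨s, hs, hsu⟩ := TopologicalSpace.countable_cover_nhds
    fun c : M => extChartAt_source_mem_nhds (I := 𝓡 n) c
  have hsub : {u : Fin m → ℝ | ∃ (p : M) (v : TangentSpace (𝓡 n) p),
      u = fun a => diffAt (y a) p v} ⊆
      ⋃ c ∈ s, chartDifferential y c '' ((extChartAt (𝓡 n) c).target ×ˢ univ) := by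
    rintro u ⟨p, v, rfl⟩
    obtain ⟨c, hc, hp⟩ := mem_iUnion₂.1 (hsu ▸ mem_univ p)
    obtain ⟨z, hz, h⟩ := exists_chartDifferential_eq y c hp v
    exact mem_iUnion₂.2 ⟨c, hc, z, hz, h⟩
  refine (dimH_mono hsub).trans ?_
  rw [dimH_bUnion hs]
  refine iSup₂_le fun c _ => ?_
  have ho : IsOpen ((extChartAt (𝓡 n) c).target ×ˢ (univ : Set (EuclideanSpace ℝ (Fin n)))) :=
    (isOpen_extChartAt_target c).prod isOpen_univ
  refine (dimH_image_le_of_locally_lipschitzOn fun z hz => ?_).trans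
    ((dimH_mono (subset_univ _)).trans_eq ?_)
  · obtain ⟨C, t, ht, hC⟩ :=
      ((contDiffOn_chartDifferential y c).contDiffAt (ho.mem_nhds hz)).exists_lipschitzOnWith
    exact ⟨C, t, nhdsWithin_le_nhds ht, hC⟩
  · rw [Real.dimH_univ_eq_finrank, finrank_prod, finrank_euclideanSpace_fin]

lemma exists_notMem_differentials [SecondCountableTopology M] {m : ℕ} (hm : n + n < m)
    (y : Fin m → SmoothFunction n M) :
    ∃ (u : Fin m → ℝ) (j : Fin m), u j ≠ 0 ∧
      ∀ (p : M) (v : TangentSpace (𝓡 n) p), u ≠ fun a => diffAt (y a) p v := by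
  set S := {u : Fin m → ℝ | ∃ (p : M) (v : TangentSpace (𝓡 n) p), u = fun a => diffAt (y a) p v}
  -- The origin is added so that u is nonzero and has a coordinate to divide by.
  have h : dimH (S ∪ {0}) < (finrank ℝ (Fin m → ℝ) : ENNReal) := by
    rw [dimH_union, dimH_singleton, finrank_fin_fun]
    refine max_lt ((dimH_differentials_le y).trans_lt (by exact_mod_cast hm)) ?_
    exact_mod_cast (Nat.zero_le _).trans_lt hm
  obtain ⟨u, hu⟩ := (dense_compl_of_dimH_lt_finrank h).nonempty
  have hu0 : u ≠ 0 := fun h0 => hu (Or.inr h0)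
  obtain ⟨j, hj⟩ := Function.ne_iff.1 hu0
  exact ⟨u, j, hj, fun p v hv => hu (Or.inl ⟨p, v, hv⟩)⟩

lemma diffAt_sub_smul (f g : SmoothFunction n M) (c : ℝ) (p : M) (v : TangentSpace (𝓡 n) p) :
    diffAt (n := n) (f - c • g : SmoothFunction n M) p v = diffAt f p v - c * diffAt g p v := by
  rw [sub_eq_add_neg, ← neg_smul, diffAt_add, diffAt_smul, LinearMap.add_apply,
    LinearMap.smul_apply, smul_eq_mul]
  ring

/-- Project along a direction u outside the set of all values dy(v), as in Whitney's immersion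
theorem. If the projected differentials kill v, then dy(v) is a multiple of u, and a nonzero
multiple could be rescaled to u. The subspace S keeps track of supports. -/
lemma exists_spansCotangent_of_succ [SecondCountableTopology M] {m : ℕ} (hm : n + n < m + 1)
    (S : Submodule ℝ (SmoothFunction n M)) (y : Fin (m + 1) → SmoothFunction n M)
    (hyS : ∀ a, y a ∈ S) : ∃ y' : Fin m → SmoothFunction n M,
      (∀ a, y' a ∈ S) ∧ ∀ p, SpansCotangent y p → SpansCotangent y' p := by
  obtain ⟨u, j, hj, hu⟩ := exists_notMem_differentials hm y
  refine ⟨fun i => y (j.succAbove i) - (u (j.succAbove i) / u j) • y j,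
    fun i => S.sub_mem (hyS _) (S.smul_mem _ (hyS _)), fun p hp v hv => hp v ?_⟩
  have h1 : ∀ a, diffAt (y a) p v = u a / u j * diffAt (y j) p v := fun a => by
    refine Fin.succAboveCases j ?_ (fun i => ?_) a
    · rw [div_self hj, one_mul]
    · have := hv i
      rwa [diffAt_sub_smul, sub_eq_zero] at this
  have h2 : diffAt (y j) p v = 0 := by
    by_contra h0
    refine hu p ((u j / diffAt (y j) p v) • v) (funext fun a => ?_)
    rw [map_smul, h1 a, smul_eq_mul]
    field_simp
  intro a
  rw [h1, h2, mul_zero]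

/-- The count n + n is the same for every family, which makes it possible to add up functions from
infinitely many shells in `exists_spansCotangent`. Shorter families are padded by zeros. -/
lemma exists_spansCotangent_of_finite [SecondCountableTopology M] {m : ℕ}
    (S : Submodule ℝ (SmoothFunction n M)) (y : Fin m → SmoothFunction n M)
    (hyS : ∀ a, y a ∈ S) : ∃ y' : Fin (n + n) → SmoothFunction n M,
      (∀ a, y' a ∈ S) ∧ ∀ p, SpansCotangent y p → SpansCotangent y' p := by
  induction m with
  | zero => exact ⟨0, fun a => S.zero_mem, fun p hp v _ => hp v fun a => a.elim0⟩
  | succ m ih =>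
    rcases lt_or_ge (n + n) (m + 1) with hm | hm
    · obtain ⟨y', hy', h⟩ := exists_spansCotangent_of_succ hm S y hyS
      obtain ⟨y'', hy'', h'⟩ := ih y' hy'
      exact ⟨y'', hy'', fun p hp => h' p (h p hp)⟩
    · refine ⟨fun a => if h : (a : ℕ) < m + 1 then y ⟨a, h⟩ else 0, fun a => ?_, fun p hp v hv =>
        hp v fun a => ?_⟩
      · dsimp only
        split_ifs
        exacts [hyS _, S.zero_mem]
      · have := hv (Fin.castLE hm a)
        simp only [Fin.val_castLE, a.2, dite_true, Fin.eta] at this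
        exact this

/-- The functions with support in `U`. -/
def supportedIn (U : Set M) : Submodule ℝ (SmoothFunction n M) where
  carrier := {f | ∀ p ∉ U, f p = 0}
  add_mem' {f g} hf hg p hp := by
    change f p + g p = 0
    rw [hf p hp, hg p hp, add_zero]
  zero_mem' _ _ := rfl
  smul_mem' c f hf p hp := by
    change c * f p = 0
    rw [hf p hp, mul_zero]

/-- The chart coordinates times a bump function that is 1 near c: near c their differentials are the
coordinate differentials. -/
lemma exists_local_spansCotangent [T2Space M] {U : Set M} (hU : IsOpen U) {c : M} (hc : c ∈ U) :
    ∃ y : Fin n → SmoothFunction n M, (∀ a, y a ∈ supportedIn U) ∧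
      ∀ᶠ p in 𝓝 c, SpansCotangent y p := by
  obtain ⟨χ, -, hχ⟩ := (SmoothBumpFunction.nhds_basis_support (I := 𝓡 n) (hU.mem_nhds hc)).mem_iff.1
    (hU.mem_nhds hc)
  refine ⟨fun i => cutoffComp χ (fun z => z i) (EuclideanSpace.proj (𝕜 := ℝ) i).contDiff,
    fun i p hp => ?_, ?_⟩
  · have : χ p = 0 := by
      by_contra h
      exact hp (hχ h)
    change χ p * _ = 0
    rw [this, zero_mul]
  · have hs : ∀ᶠ p in 𝓝 c, p ∈ (extChartAt (𝓡 n) c).source := extChartAt_source_mem_nhds c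
    filter_upwards [χ.eventuallyEq_one.eventually_nhds, hs] with p hp hps v hv
    obtain ⟨z, hz, rfl⟩ : ∃ z ∈ (extChartAt (𝓡 n) c).target, (extChartAt (𝓡 n) c).symm z = p :=
      ⟨_, (extChartAt (𝓡 n) c).map_source hps, (extChartAt (𝓡 n) c).left_inv hps⟩
    set L := mfderivWithin 𝓘(ℝ, EuclideanSpace ℝ (Fin n)) (𝓡 n) (extChartAt (𝓡 n) c).symm
      (range (𝓡 n)) z with hL
    have hi := isInvertible_mfderivWithin_extChartAt_symm hz
    have hu : L (L.inverse v) = v := hi.self_apply_inverse _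
    have h0 : (L.inverse v : EuclideanSpace ℝ (Fin n)) = 0 := by
      refine PiLp.ext fun i => ?_
      have h1 := fderiv_comp_extChartAt_symm (cutoffComp χ (fun z => z i)
        (EuclideanSpace.proj (𝕜 := ℝ) i).contDiff) c hz (L.inverse v)
      rw [← hL, hu, hv i] at h1
      have h2 : (cutoffComp χ (fun z => z i) (EuclideanSpace.proj (𝕜 := ℝ) i).contDiff ∘
          (extChartAt (𝓡 n) c).symm) =ᶠ[𝓝 z] EuclideanSpace.proj (𝕜 := ℝ) i := by
        have hcont : ContinuousAt (extChartAt (𝓡 n) c).symm z :=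
          continuousAt_extChartAt_symm'' hz
        filter_upwards [hcont.eventually hp, (isOpen_extChartAt_target c).mem_nhds hz] with w hw hwt
        change χ ((extChartAt (𝓡 n) c).symm w) *
          (extChartAt (𝓡 n) c ((extChartAt (𝓡 n) c).symm w)) i = w i
        rw [hw, (extChartAt (𝓡 n) c).right_inv hwt]
        exact one_mul _
      rw [h2.fderiv_eq, ContinuousLinearMap.fderiv] at h1
      exact h1
    rw [← hu, h0, map_zero]

lemma exists_spansCotangent_of_isCompact [T2Space M] [SecondCountableTopology M] {K U : Set M}
    (hK : IsCompact K) (hU : IsOpen U) (hKU : K ⊆ U) :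
    ∃ y : Fin (n + n) → SmoothFunction n M, (∀ a, y a ∈ supportedIn U) ∧
      ∀ p ∈ K, SpansCotangent y p := by
  have : ∃ (m : ℕ) (y : Fin m → SmoothFunction n M), (∀ a, y a ∈ supportedIn U) ∧
      ∀ p ∈ K, SpansCotangent y p := by
    refine hK.induction_on (p := fun s => ∃ (m : ℕ) (y : Fin m → SmoothFunction n M),
      (∀ a, y a ∈ supportedIn U) ∧ ∀ p ∈ s, SpansCotangent y p) ?_ ?_ ?_ ?_
    · exact ⟨0, fun a => a.elim0, fun a => a.elim0, fun p hp => hp.elim⟩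
    · rintro s t hst ⟨m, y, hy, h⟩
      exact ⟨m, y, hy, fun p hp => h p (hst hp)⟩
    · rintro s t ⟨m, y, hy, h⟩ ⟨m', y', hy', h'⟩
      refine ⟨m + m', Fin.append y y', fun a => ?_, ?_⟩
      · refine Fin.addCases (fun i => ?_) (fun i => ?_) a
        · rw [Fin.append_left]
          exact hy i
        · rw [Fin.append_right]
          exact hy' i
      · rintro p (hp | hp) v hv
        · refine h p hp v fun a => ?_
          have := hv (Fin.castAdd m' a)
          rwa [Fin.append_left] at this
        · refine h' p hp v fun a => ?_
          have := hv (Fin.natAdd m a)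
          rwa [Fin.append_right] at this
    · intro c hc
      obtain ⟨y, hy, h⟩ := exists_local_spansCotangent (n := n) hU (hKU hc)
      exact ⟨_, nhdsWithin_le_nhds h, n, y, hy, fun p hp => hp⟩
  obtain ⟨m, y, hy, h⟩ := this
  obtain ⟨y', hy', h'⟩ := exists_spansCotangent_of_finite _ y hy
  exact ⟨y', hy', fun p hp => h' p (h p hp)⟩

end SpanningFamilies

/-! ### Compact shells with locally finite neighbourhoods. -/

section Shells

open Set Filter Topology

lemma exists_shells (X : Type*) [TopologicalSpace X] [T2Space X] [LocallyCompactSpace X]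
    [SigmaCompactSpace X] : ∃ S U : ℕ → Set X, (∀ i, IsCompact (S i)) ∧ (∀ i, IsOpen (U i)) ∧
    (∀ i, S i ⊆ U i) ∧ (∀ p, ∃ i, p ∈ S i) ∧ LocallyFinite U ∧
    ∀ i j, i + 3 ≤ j → Disjoint (U i) (U j) := by
  let K := CompactExhaustion.choice X
  let J := K.shiftr
  -- The shifted exhaustion starts with the empty set, so the truncated index i - 1 removes nothing
  -- when i = 0.
  have h0 : J 0 = ∅ := rfl
  refine ⟨fun i => J (i + 1) \ interior (J i), fun i => interior (J (i + 2)) \ J (i - 1),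
    fun i => (J.isCompact _).diff isOpen_interior,
    fun i => isOpen_interior.sdiff (J.isCompact _).isClosed, fun i p hp => ⟨?_, fun hp' => ?_⟩,
    fun p => ⟨K.find p, (K.mem_sdiff_shiftr_find p).1, fun h =>
      (K.mem_sdiff_shiftr_find p).2 (interior_subset h)⟩, fun p => ?_, fun i j hij => ?_⟩
  · exact J.subset_interior_succ _ hp.1
  · rcases i with _ | i
    · rw [Nat.zero_sub, h0] at hp'
      exact hp'
    · exact hp.2 (J.subset_interior_succ i hp')
  · obtain ⟨m, hm⟩ := J.exists_mem_nhds p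
    refine ⟨J m, hm, (finite_Iic m).subset ?_⟩
    rintro i ⟨q, hq, hqm⟩
    by_contra hi
    exact hq.2 (J.subset (by simp at hi; omega) hqm)
  · refine disjoint_left.2 fun q hq hq' => hq'.2 (J.subset (by omega) (interior_subset hq.1))

end Shells

/-! ### A finite global family with spanning differentials. -/

section GlobalSpanning

open Set Filter Topology

variable (n : ℕ) (M : Type*) [TopologicalSpace M] [ChartedSpace (EuclideanSpace ℝ (Fin n)) M]
  [IsManifold (𝓡 n) ∞ M] [T2Space M] [SecondCountableTopology M]

/-- Neighbourhoods of shells whose indices differ by at least 3 are disjoint, so the 2n functions of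
all shells in one residue class mod 3 can be added without interference. This gives 3 · 2n
functions, and near shell k those in its class agree with the functions of that shell. -/
lemma exists_spansCotangent :
    ∃ (N : ℕ) (y : Fin N → SmoothFunction n M), ∀ p, SpansCotangent y p := by
  have : LocallyCompactSpace M := Manifold.locallyCompact_of_finiteDimensional (𝓡 n)
  have : SigmaCompactSpace M := sigmaCompactSpace_of_locallyCompact_secondCountable
  obtain ⟨S, U, hS, hU, hSU, hcov, hfin, hdisj⟩ := exists_shells M
  choose y hy hspan using fun i => exists_spansCotangent_of_isCompact (n := n) (hS i) (hU i) (hSU i)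
  have hlf : ∀ (c : Fin 3) (a : Fin (n + n)),
      LocallyFinite fun i => Function.support (y (3 * i + c) a) := fun c a => by
    have hinj : Function.Injective fun i : ℕ => 3 * i + (c : ℕ) := fun i j h => by
      dsimp only at h
      omega
    refine (hfin.comp_injective hinj).subset fun i p hp => ?_
    by_contra h
    exact hp (hy _ a p h)
  let Y : Fin 3 × Fin (n + n) → SmoothFunction n M := fun z =>
    ⟨fun p => ∑ᶠ i, y (3 * i + z.1) z.2 p,
      contMDiff_finsum (fun i => (y (3 * i + z.1) z.2).contMDiff) (hlf z.1 z.2)⟩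
  have hY : ∀ (k : ℕ) (a : Fin (n + n)), ∀ q ∈ U k, Y (⟨k % 3, Nat.mod_lt _ (by norm_num)⟩, a) q =
      y k a q := fun k a q hq => by
    have hk : 3 * (k / 3) + k % 3 = k := Nat.div_add_mod k 3
    refine (finsum_eq_single _ (k / 3) fun i hi => hy _ a q fun hq' => ?_).trans ?_
    · dsimp only at hq'
      rcases lt_or_gt_of_ne hi with h | h
      · exact disjoint_left.1 (hdisj _ _ (by omega)) hq' hq
      · exact disjoint_left.1 (hdisj _ _ (by omega)) hq hq'
    · dsimp only
      rw [hk]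
  refine ⟨_, Y ∘ finProdFinEquiv.symm, fun p v hv => ?_⟩
  obtain ⟨k, hk⟩ := hcov p
  refine hspan k p hk v fun a => ?_
  have h1 := hv (finProdFinEquiv (⟨k % 3, Nat.mod_lt _ (by norm_num)⟩, a))
  rw [Function.comp_apply, Equiv.symm_apply_apply] at h1
  have h2 : (Y (⟨k % 3, Nat.mod_lt _ (by norm_num)⟩, a) : M → ℝ) =ᶠ[𝓝 p] y k a := by
    filter_upwards [(hU k).mem_nhds (hSU k hk)] with q hq using hY k a q hq
  rw [← h1, diffAt, diffAt, h2.mfderiv_eq]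

end GlobalSpanning

/-! ### The dual frame of gradients. -/

section GramFrame

open Set Module

variable {n : ℕ} {M : Type*} [TopologicalSpace M] [ChartedSpace (EuclideanSpace ℝ (Fin n)) M]
  [IsManifold (𝓡 n) ∞ M]

lemma contMDiffOn_det {U : Set M} {m : ℕ} {A : M → Matrix (Fin m) (Fin m) ℝ}
    (hA : ∀ i j, ContMDiffOn (𝓡 n) 𝓘(ℝ, ℝ) ∞ (fun p => A p i j) U) :
    ContMDiffOn (𝓡 n) 𝓘(ℝ, ℝ) ∞ (fun p => (A p).det) U := by
  simp only [Matrix.det_apply']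
  exact contMDiffOn_finsetSum fun σ _ => contMDiffOn_const.mul
    (contMDiffOn_finsetProd fun i _ => hA _ _)

lemma contMDiffOn_inv_apply {U : Set M} {m : ℕ} {A : M → Matrix (Fin m) (Fin m) ℝ}
    (hA : ∀ i j, ContMDiffOn (𝓡 n) 𝓘(ℝ, ℝ) ∞ (fun p => A p i j) U)
    (hdet : ∀ p ∈ U, (A p).det ≠ 0) (i j : Fin m) :
    ContMDiffOn (𝓡 n) 𝓘(ℝ, ℝ) ∞ (fun p => (A p)⁻¹ i j) U := by
  simp only [Matrix.inv_def, Matrix.smul_apply, smul_eq_mul, Ring.inverse_eq_inv',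
    Matrix.adjugate_apply]
  refine ((contMDiffOn_det hA).inv₀ hdet).mul (contMDiffOn_det fun k l => ?_)
  simp only [Matrix.updateRow_apply]
  split_ifs
  exacts [contMDiffOn_const, hA k l]

variable {N : ℕ} (y : Fin N → SmoothFunction n M)

/-- The Gram form `v ↦ ∑ dy_a(v) dy_a`. -/
def gramMap (p : M) : TangentSpace (𝓡 n) p →ₗ[ℝ] Dual ℝ (TangentSpace (𝓡 n) p) :=
  ∑ a, (diffAt (y a) p).smulRight (diffAt (y a) p)

lemma gramMap_apply (p : M) (v w : TangentSpace (𝓡 n) p) :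
    gramMap y p v w = ∑ a, diffAt (y a) p v * diffAt (y a) p w := by
  simp [gramMap]

variable {y}

lemma gramMap_injective {p : M} (hy : SpansCotangent y p) : Function.Injective (gramMap y p) := by
  rw [injective_iff_map_eq_zero]
  intro v hv
  have h := congrArg (fun L => L v) hv
  simp only [gramMap_apply] at h
  refine hy v fun a => ?_
  exact mul_self_eq_zero.1 ((Finset.sum_eq_zero_iff_of_nonneg fun a _ => mul_self_nonneg _).1 h a
    (Finset.mem_univ a))

/-- The Gram form as an isomorphism. -/
def gramEquiv {p : M} (hy : SpansCotangent y p) :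
    TangentSpace (𝓡 n) p ≃ₗ[ℝ] Dual ℝ (TangentSpace (𝓡 n) p) :=
  LinearMap.linearEquivOfInjective (gramMap y p) (gramMap_injective hy)
    Subspace.dual_finrank_eq.symm

lemma gramMap_gramEquiv_symm {p : M} (hy : SpansCotangent y p)
    (α : Dual ℝ (TangentSpace (𝓡 n) p)) : gramMap y p ((gramEquiv hy).symm α) = α :=
  (gramEquiv hy).apply_symm_apply α

variable (y) in
/-- The matrix of the Gram form in the chart around `p₀`. -/
def gramMatrix (p₀ p : M) : Matrix (Fin n) (Fin n) ℝ :=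
  Matrix.of fun i j => gramMap y p (ofChart p₀ p (EuclideanSpace.basisFun (Fin n) ℝ i))
    (ofChart p₀ p (EuclideanSpace.basisFun (Fin n) ℝ j))

lemma gramMatrix_mulVec_toChart {p₀ p : M}
    (hp : p ∈ (chartAt (EuclideanSpace ℝ (Fin n)) p₀).source) (v : TangentSpace (𝓡 n) p) :
    (gramMatrix y p₀ p).mulVec (fun i => toChart p₀ p v i) = fun i =>
      gramMap y p v (ofChart p₀ p (EuclideanSpace.basisFun (Fin n) ℝ i)) := by
  have hsymm : ∀ v w : TangentSpace (𝓡 n) p, gramMap y p v w = gramMap y p w v := fun v w => by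
    simp only [gramMap_apply, mul_comm]
  funext i
  change ∑ j, gramMatrix y p₀ p i j * toChart p₀ p v j = _
  conv_rhs => rw [hsymm, eq_sum_ofChart hp v, map_sum]
  refine Finset.sum_congr rfl fun j _ => ?_
  rw [map_smul, smul_eq_mul, mul_comm]
  rfl

lemma toChart_ofChart {p₀ p : M} (hp : p ∈ (chartAt (EuclideanSpace ℝ (Fin n)) p₀).source)
    (v : EuclideanSpace ℝ (Fin n)) : toChart p₀ p (ofChart p₀ p v) = v :=
  Bundle.Trivialization.continuousLinearMapAt_symmL _ (by simpa using hp) v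

lemma gramMatrix_det_ne_zero {p₀ p : M} (hy : SpansCotangent y p)
    (hp : p ∈ (chartAt (EuclideanSpace ℝ (Fin n)) p₀).source) : (gramMatrix y p₀ p).det ≠ 0 := by
  intro h
  obtain ⟨x, hx, h0⟩ := Matrix.exists_mulVec_eq_zero_iff.2 h
  refine hx ?_
  set v := ofChart p₀ p (WithLp.toLp 2 x) with hv
  have e : toChart p₀ p v = WithLp.toLp 2 x := toChart_ofChart hp _
  have h1 := gramMatrix_mulVec_toChart (y := y) hp v
  rw [e] at h1
  have h2 : gramMap y p v = 0 := by
    ext w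
    rw [eq_sum_ofChart hp w, map_sum]
    refine (Finset.sum_eq_zero fun i _ => ?_).trans rfl
    rw [map_smul, ← congrFun h1 i]
    exact smul_eq_zero_of_right _ (congrFun h0 i)
  have h3 := (injective_iff_map_eq_zero _).1 (gramMap_injective hy) v h2
  rw [h3, map_zero] at e
  exact (WithLp.toLp_eq_zero (p := 2)).1 e.symm

/-- The dual frame of a spanning family with respect to the Gram metric. -/
def gramField (hy : ∀ p, SpansCotangent y p) (a : Fin N) : SmoothVectorField n M :=
  ⟨fun p => (gramEquiv (hy p)).symm (diffAt (y a) p), by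
    refine contMDiff_section_of_toChart _ fun p₀ i => ?_
    -- The chart components of the gradient solve a linear system with the Gram matrix; inverting
    -- that matrix displays their smoothness.
    have h : ∀ p ∈ (chartAt (EuclideanSpace ℝ (Fin n)) p₀).source,
        toChart p₀ p ((gramEquiv (hy p)).symm (diffAt (y a) p)) i = ∑ j,
          (gramMatrix y p₀ p)⁻¹ i j *
            diffAt (y a) p (ofChart p₀ p (EuclideanSpace.basisFun (Fin n) ℝ j)) := by
      intro p hp
      have h1 := gramMatrix_mulVec_toChart (y := y) hp ((gramEquiv (hy p)).symm (diffAt (y a) p))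
      rw [gramMap_gramEquiv_symm] at h1
      have h2 := congrArg (gramMatrix y p₀ p)⁻¹.mulVec h1
      rw [Matrix.mulVec_mulVec, Matrix.nonsing_inv_mul _
        (gramMatrix_det_ne_zero (hy p) hp).isUnit, Matrix.one_mulVec] at h2
      exact congrFun h2 i
    refine ContMDiffOn.congr ?_ h
    refine contMDiffOn_finsetSum fun j _ => (contMDiffOn_inv_apply (fun k l => ?_)
      (fun p hp => gramMatrix_det_ne_zero (hy p) hp) i j).mul
        (contMDiffOn_diffAt_ofChart (y a).contMDiff p₀ _)
    simp only [gramMatrix, Matrix.of_apply, gramMap_apply]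
    exact contMDiffOn_finsetSum fun b _ => (contMDiffOn_diffAt_ofChart (y b).contMDiff p₀ _).mul
      (contMDiffOn_diffAt_ofChart (y b).contMDiff p₀ _)⟩

/-- Apply the Gram isomorphism: it maps v to ∑ dy_a(v) dy_a and E_a to dy_a. -/
lemma isDualFrame_gramField (hy : ∀ p, SpansCotangent y p) : IsDualFrame y (gramField hy) := by
  intro p v
  refine (gramEquiv (hy p)).injective ?_
  rw [map_sum]
  have h : ∀ a, gramEquiv (hy p) (diffAt (y a) p v • gramField hy a p) =
      diffAt (y a) p v • diffAt (y a) p := fun a => by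
    rw [map_smul]
    congr 1
    exact gramMap_gramEquiv_symm (hy p) _
  rw [Finset.sum_congr rfl fun a _ => h a]
  ext w
  refine (gramMap_apply y p v w).trans ?_
  simp

variable (n M) in
lemma exists_isDualFrame [T2Space M] [SecondCountableTopology M] :
    ∃ (N : ℕ) (y : Fin N → SmoothFunction n M) (E : Fin N → SmoothVectorField n M),
      IsDualFrame y E := by
  obtain ⟨N, y, hy⟩ := exists_spansCotangent n M
  exact ⟨N, y, gramField hy, isDualFrame_gramField hy⟩

end GramFrame

end TwistedDuality

end

open TwistedDuality

theorem mainTheorem1 {n : ℕ} {M : Type*} [TopologicalSpace M] [T2Space M]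
    [SecondCountableTopology M] [ChartedSpace (EuclideanSpace ℝ (Fin n)) M]
    [IsManifold (𝓡 n) ∞ M]
    (π : PoissonStructure n M)
    (μ : SmoothForm n M n) (hμ : IsVolumeForm μ)
    (φ : SmoothVectorField n M) (hφ : IsModularVectorField π μ φ)
    {W : Type*} [AddCommGroup W] [Module ℝ W] [Module (SmoothFunction n M) W]
    [IsScalarTower ℝ (SmoothFunction n M) W] (hW : IsGeometric n M W)
    (b : W →ₗ[ℝ] SmoothFunction n M →ₗ[ℝ] W) (hb : IsPoissonModule π.bracket b) :
    -- the twisted module `W_{-φ}` is a Poisson module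
    IsPoissonModule π.bracket (twist b (-φ)) ∧
    -- interior products by elements of `𝔛ᵏ(W)` and the boundaries for `W_{-φ}` are well defined
    (∀ (k j q : ℕ) (h : k + j = q) (X : SkewDerivation (SmoothFunction n M) W k),
      IsInteriorProduct h X (interiorProduct h X) ∧
        ∀ ι, IsInteriorProduct h X ι → ι = interiorProduct h X) ∧
    (∀ r : ℕ, IsPoissonBoundary π (twist b (-φ)) (poissonBoundary π (twist b (-φ)) r) ∧
      ∀ D : FormsWithValues (n := n) (M := M) W (r + 1) →ₗ[ℝ]
          FormsWithValues (n := n) (M := M) W r,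
        IsPoissonBoundary π (twist b (-φ)) D → D = poissonBoundary π (twist b (-φ)) r) ∧
    -- both sequences are complexes, and they vanish in degrees above `n`
    (∀ (k : ℕ) (X : SkewDerivation (SmoothFunction n M) W k),
      coboundary π.isPoissonBracket hb (k + 1) (coboundary π.isPoissonBracket hb k X) = 0) ∧
    (∀ (r : ℕ) (x : FormsWithValues (n := n) (M := M) W (r + 2)),
      poissonBoundary π (twist b (-φ)) r (poissonBoundary π (twist b (-φ)) (r + 1) x) = 0) ∧
    (∀ k : ℕ, n < k → Subsingleton (SkewDerivation (SmoothFunction n M) W k)) ∧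
    (∀ j : ℕ, n < j → Subsingleton (FormsWithValues (n := n) (M := M) W j)) ∧
    -- each `▲ᵏ` is an isomorphism of `C^∞(M)`-modules
    (∀ (k j : ℕ) (h : k + j = n),
      ∃ e : SkewDerivation (SmoothFunction n M) W k ≃ₗ[SmoothFunction n M]
          FormsWithValues (n := n) (M := M) W j,
        ∀ X, e X = signedStar μ h X) ∧
    -- the `▲ᵏ` commute with the differentials
    (∀ (k j : ℕ) (h : k + (j + 1) = n) (h' : (k + 1) + j = n)
      (X : SkewDerivation (SmoothFunction n M) W k),
      poissonBoundary π (twist b (-φ)) j (signedStar μ h X) =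
        signedStar μ h' (coboundary π.isPoissonBracket hb k X)) := by
  obtain ⟨N, y, E, hE⟩ := exists_isDualFrame n M
  -- Geometricity of W enters only here, and modularity of φ only in the next line.
  have hD := hW.expandsDerivations hE
  have hm := hφ.isModularDerivation hE hμ
  refine ⟨hm.isPoissonModule_twist π.isPoissonBracket hb, fun k j q h X => ?_, fun r => ?_,
    fun k X => coboundary_coboundary π.isPoissonBracket hb k X,
    poissonBoundary_poissonBoundary hE hD hμ hb hm, fun k => subsingleton_skewDerivation hD,
    fun j => subsingleton_formsWithValues, fun k j h => ?_, fun k j h h' X => ?_⟩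
  · rw [interiorProduct_eq_iota hE hD]
    exact ⟨isInteriorProduct_iota hD h X, fun ι hι =>
      IsInteriorProduct.unique hE hι (isInteriorProduct_iota hD h X)⟩
  · have h := isPoissonBoundary_poissonBoundary hE hD hμ hb hm r
    exact ⟨h, fun D h' => IsPoissonBoundary.unique hE h' h⟩
  · exact ⟨starEquiv hE hD hμ k j h, fun X => (signedStar_eq_starMap hE hD μ h X).symm⟩
  · rw [signedStar_eq_starMap hE hD, signedStar_eq_starMap hE hD]
    exact poissonBoundary_starMap hE hD hμ hb hm k j h h' X
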